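/- Let $G=(V,E,\mathrm{len})$ be a finite simple undirected graph with positive edge lengths, $n=|V|$, $m=|E|$, and let $v_0:V\to\mathbb R\cup\{*\}$ be a partial voltage assignment with terminal set $T(v_0)=\{x: v_0(x)\ne *\}$. The instance $(G,v_0)$ is well-posed if every connected component of $G$ contains a terminal. A lex-minimizer is a function $v:V\to\mathbb R$ that agrees with $v_0$ on $T(v_0)$ and such that for every $w:V\to\mathbb R$ that agrees with $v_0$ on $T(v_0)$, the list of the numbers $|v(x)-v(y)|/\mathrm{len}(x,y)$, $(x,y)\in E$, sorted in non-increasing order, is lexicographically at most the corresponding list for $w$. The randomized algorithm CompLexMin does the following while some vertex is not a terminal: it removes all edges between two terminals, calls SteepestPath to find a path $P=(x_0,\dots,x_r)$ between terminals of largest gradient $\nabla P=(v_0(x_0)-v_0(x_r))/\mathrm{len}(P)$, and assigns to each non-terminal $x_i$ on $P$ the voltage $v_0(x_0)-\nabla P\cdot\mathrm{len}(x_0,\dots,x_i)$; finally it returns $v_0$. SteepestPath draws a uniformly random edge $(x_1,x_2)$ and a uniformly random vertex $x_3$, computes for each $x_i$ a steepest path between terminals through $x_i$ (by Dijkstra's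 algorithm from $x_i$, followed by a direct maximization over the terminals if $x_i$ is a terminal and by the randomized algorithm StarSteepestPath otherwise), takes the steepest of these paths, of gradient $\alpha$ say, and computes with two further runs of Dijkstra's algorithm the subgraph $G'$ induced on the vertices $x$ with $\max_t (v_0(t)-\alpha\,\mathrm{dist}(t,x))>\min_t(v_0(t)+\alpha\,\mathrm{dist}(x,t))$, where $t$ ranges over the terminals; it returns that path if $G'$ has no edges, and otherwise recurses on $G'$. StarSteepestPath, for a set $T$ of terminals with values $v(t)$ and distances $d(t)$ from $x$, draws $t_1\in T$ uniformly, finds $t_2\in T$ maximizing $|v(t_1)-v(t_2)|/(d(t_1)+d(t_2))$, and with $\alpha$ the maximum, computes in two scans of $T$ the set $T'$ of those $t\in T$ with $v(t)-\alpha d(t)>\min_{s\in T}(v(s)+\alpha d(s))$ or $v(t)+\alpha d(t)<\max_{s\in T}(v(s)-\alpha d(s))$; if $T'=\emptyset$ it returns $t_1,t_2$ in order of decreasing value, and otherwise it recurses on $T'$. Dijkstra's algorithm uses Fibonacci heaps, and time is counted in steps of a real RAM. Statement: there is a constant $C$ such that for every well-posed instance $(G,v_0)$, given by a list of the vertices and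 a list of the edges with their lengths, there is exactly one lex-minimizer, every run of CompLexMin (whatever the random choices) outputs it, and the expected number of steps is at most $C\,(n(m+n\log n)+1)$; that is, the expected running time is $O(n(m+n\log n))$ for $n\ge 2$, and $O(1)$ for $n\le 1$. -/

import Mathlib

open Filter
open scoped ENNReal

noncomputable section

/-! ### Partially labelled graphs and lex-minimizers

A weighted graph is a `SimpleGraph` with a length for every unordered pair of vertices (only the
lengths of edges matter, and these are positive).  A voltage assignment is a function
`V → Option ℝ`; the vertices with a value are the terminals. -/

/-- Every connected component contains a terminal. -/
def WellPosed {V : Type} (G : SimpleGraph V) (v₀ : V → Option ℝ) : Prop :=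
  ∀ c : G.ConnectedComponent, ∃ t ∈ c.supp, (v₀ t).isSome

/-- The complete assignment `v` extends the partial assignment `v₀`. -/
def Extends {V : Type} (v : V → ℝ) (v₀ : V → Option ℝ) : Prop :=
  ∀ x a, v₀ x = some a → v x = a

/-- The absolute value of the gradient of `v` on an edge, `|v x - v y| / len (x, y)`. -/
def absGrad {V : Type} (len : Sym2 V → ℝ) (v : V → ℝ) (e : Sym2 V) : ℝ :=
  Sym2.lift ⟨fun x y => |v x - v y|, fun x y => abs_sub_comm (v x) (v y)⟩ e / len e

/-- The absolute values of the gradient on the edges of `G`, one entry for each edge, listed in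
non-increasing order. -/
def sortedGrad {V : Type} [Fintype V] [DecidableEq V] (G : SimpleGraph V) [DecidableRel G.Adj]
    (len : Sym2 V → ℝ) (v : V → ℝ) : List ℝ :=
  (G.edgeFinset.val.map (absGrad len v)).sort (· ≥ ·)

/-- `r` comes before `s` in the lexicographic order, or is equal to it. -/
def LexLE (r s : List ℝ) : Prop := r = s ∨ List.Lex (· < ·) r s

/-- `v` is a complete assignment extending `v₀` whose gradient is lexicographically minimal. -/
def IsLexMinimizer {V : Type} [Fintype V] [DecidableEq V] (G : SimpleGraph V)
    [DecidableRel G.Adj] (len : Sym2 V → ℝ) (v₀ : V → Option ℝ) (v : V → ℝ) : Prop :=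
  Extends v v₀ ∧ ∀ w : V → ℝ, Extends w v₀ → LexLE (sortedGrad G len v) (sortedGrad G len w)

/-! ### Randomized programs with a step count

The machine is a real RAM: one step pays for a bounded number of elementary operations, which are
real arithmetic and comparisons, reading or writing one cell of an array, `cons` / `head` / `tail`
on a linked list, and drawing a uniformly random index.  Arrays indexed by vertices are functions
that are only changed by `Function.update` and are used linearly.  Every procedure call without a
loop costs a bounded number of steps, every iteration of a loop and every recursive call costs at
least one step, and a pass over a list (`filter`, `map`, `argmax`, ...) costs its length. -/

/-- Programs: return a value; give up; make one step; draw a uniformly random element of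
`{0, ..., k}` (one step). -/
inductive Prog (α : Type) : Type where
  | ret : α → Prog α
  | fail : Prog α
  | tick : Prog α → Prog α
  | draw : (k : ℕ) → (Fin (k + 1) → Prog α) → Prog α

namespace Prog

def bind {α β : Type} : Prog α → (α → Prog β) → Prog β
  | ret a, f => f a
  | fail, _ => fail
  | tick p, f => tick (bind p f)
  | draw k p, f => draw k (fun i => bind (p i) f)

instance : Monad Prog where
  pure := ret
  bind := bind

/-- The joint distribution of the result (`none` if the program gave up) and the number of steps. -/
def run {α : Type} : Prog α → PMF (Option α × ℕ)
  | ret a => PMF.pure (some a, 0)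
  | fail => PMF.pure (none, 0)
  | tick p => (run p).map (fun o => (o.1, o.2 + 1))
  | draw k p =>
      (PMF.uniformOfFintype (Fin (k + 1))).bind (fun i => (run (p i)).map (fun o => (o.1, o.2 + 1)))

/-- The expected number of steps. -/
def expectedTime {α : Type} (p : Prog α) : ℝ≥0∞ := ∑' o, p.run o * (o.2 : ℝ≥0∞)

/-- Make `k` steps. -/
def charge : ℕ → Prog Unit
  | 0 => ret ()
  | k + 1 => tick (charge k)

/-- A loop over a list; every iteration costs one step more than its body. -/
def loop {α β : Type} (l : List α) (init : β) (body : β → α → Prog β) : Prog β :=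
  l.foldlM (fun b a => tick (body b a)) init

/-- A uniformly random entry of a list, found by walking along the list. -/
def sample {α : Type} : List α → Prog α
  | [] => fail
  | a :: l => do
      charge (l.length + 1)
      draw l.length (fun i => ret ((a :: l).get i))

/-- One pass over a list that keeps the entries satisfying a test. -/
def select {α : Type} (l : List α) (p : α → Bool) : Prog (List α) := do
  charge l.length
  ret (l.filter p)

/-- One pass over a list that finds an entry with the largest value of `f`. -/
def argmax {α : Type} (l : List α) (f : α → ℝ) : Prog (Option α) := do
  charge l.length
  ret (l.argmax f)

/-- A new array with one cell for each entry of `cells`, all of them holding `a`. -/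
def newArray {ι α : Type} (cells : List ι) (a : α) : Prog (ι → α) := do
  charge cells.length
  ret (fun _ => a)

end Prog

open Prog

/-! ### Fibonacci heaps

All loops that are not passes over a list get a bound on the number of their iterations as their
first argument and give up when it is exceeded. -/

/-- A Fibonacci heap on items in `V` with keys in `ℝ ∪ {∞}`.  An item that is cut from its parent `p`
stays in the list `kids p` until `p` is removed, so `c` is a child of `p` iff `parent c = some p`.
The array `table` is indexed by degrees and is empty between the operations. -/
structure FibHeap (V : Type) where
  key : V → WithTop ℝ
  parent : V → Option V
  kids : V → List V
  deg : V → ℕ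
  mark : V → Bool
  table : ℕ → Option V
  roots : List V

namespace FibHeap

variable {V : Type} [DecidableEq V]

/-- The heap whose items are the entries of `items`, all with key `∞`. -/
def init (items : List V) : Prog (FibHeap V) := do
  charge (7 * items.length + 1)
  ret { key := fun _ => ⊤, parent := fun _ => none, kids := fun _ => [], deg := fun _ => 0,
        mark := fun _ => false, table := fun _ => none, roots := items }

/-- Make the child `x` of `p` a root. -/
def cut (h : FibHeap V) (x p : V) : FibHeap V :=
  { h with
    parent := Function.update h.parent x none
    deg := Function.update h.deg p (h.deg p - 1)
    mark := Function.update h.mark x false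
    roots := x :: h.roots }

/-- Cascading cuts: `y` has just lost a child. -/
def cascade : ℕ → FibHeap V → V → Prog (FibHeap V)
  | 0, _, _ => fail
  | fuel + 1, h, y => tick <|
      match h.parent y with
      | none => ret h
      | some z =>
          if h.mark y then cascade fuel (h.cut y z) z
          else ret { h with mark := Function.update h.mark y true }

/-- Decrease the key of `x` to `k`. -/
def decreaseKey (fuel : ℕ) (h : FibHeap V) (x : V) (k : WithTop ℝ) : Prog (FibHeap V) := tick <|
  let h₁ := { h with key := Function.update h.key x k }
  match h₁.parent x with
  | none => ret h₁
  | some p => if k < h₁.key p then cascade fuel (h₁.cut x p) p else ret h₁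

/-- Make the root `c` a child of the root `p`. -/
def link (h : FibHeap V) (c p : V) : FibHeap V :=
  { h with
    parent := Function.update h.parent c (some p)
    mark := Function.update h.mark c false
    kids := Function.update h.kids p (c :: h.kids p)
    deg := Function.update h.deg p (h.deg p + 1) }

/-- Enter the root `r` into the table, linking it with roots of equal degree. -/
def place : ℕ → FibHeap V → V → Prog (FibHeap V)
  | 0, _, _ => fail
  | fuel + 1, h, r => tick <|
      match h.table (h.deg r) with
      | none => ret { h with table := Function.update h.table (h.deg r) (some r) }
      | some s =>
          let h₁ := { h with table := Function.update h.table (h.deg r) none }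
          if h.key r ≤ h.key s then place fuel (h₁.link s r) r else place fuel (h₁.link r s) s

/-- Link roots until all of them have different degrees, then list them and clear the table. -/
def consolidate (fuel : ℕ) (h : FibHeap V) : Prog (FibHeap V) := do
  let h₁ ← loop h.roots h (fun g r => place fuel g r)
  loop h.roots { h₁ with roots := [] } (fun g r => ret <|
    if (g.parent r).isNone then
      { g with table := Function.update g.table (g.deg r) none, roots := r :: g.roots }
    else g)

/-- Remove an item with the smallest key and return it; `none` if the heap is empty. -/
def popMin (fuel : ℕ) (h : FibHeap V) : Prog (Option (V × FibHeap V)) := do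
  let h₁ ← consolidate fuel h
  charge (h₁.roots.length + 1)
  match h₁.roots.argmin h₁.key with
  | none => ret none
  | some x => do
      let rest ← select h₁.roots (fun r => r ≠ x)
      let h₂ ← loop (h₁.kids x) { h₁ with roots := rest } (fun g c => ret <|
        if g.parent c = some x then
          { g with parent := Function.update g.parent c none, roots := c :: g.roots }
        else g)
      ret (some (x, h₂))

end FibHeap

/-! ### The algorithms -/

/-- The input of the algorithms: a list of the vertices, and a list of the edges, each with its two
end points (in some order) and its length. -/
structure Net (V : Type) where
  verts : List V
  edges : List (V × V × ℝ)

/-- `N` lists every vertex once, and every edge of `G` once and with its length. -/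
structure Net.Encodes {V : Type} (N : Net V) (G : SimpleGraph V) (len : Sym2 V → ℝ) : Prop where
  verts_nodup : N.verts.Nodup
  mem_verts : ∀ x, x ∈ N.verts
  edges_nodup : (N.edges.map (fun e => s(e.1, e.2.1))).Nodup
  mem_edges : ∀ e, e ∈ N.edges.map (fun e => s(e.1, e.2.1)) ↔ e ∈ G.edgeSet
  length_eq : ∀ e ∈ N.edges, e.2.2 = len s(e.1, e.2.1)

section Algorithms

variable {V : Type} [DecidableEq V]

/-- The lists of the neighbours of the vertices, with the lengths of the connecting edges. -/
def adjacency (N : Net V) : Prog (V → List (V × ℝ)) := do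
  let a ← newArray N.verts []
  loop N.edges a (fun a e =>
    let b := Function.update a e.1 ((e.2.1, e.2.2) :: a e.1)
    ret (Function.update b e.2.1 ((e.1, e.2.2) :: b e.2.1)))

/-- The state of Dijkstra's algorithm. -/
structure DState (V : Type) where
  heap : FibHeap V
  value : V → WithTop ℝ
  finished : V → Bool
  parent : V → Option V

/-- Process the edge from the finished vertex `x` to its neighbour `y.1`, of length `y.2`. -/
def relax (fuel : ℕ) (α : ℝ) (x : V) (s : DState V) (y : V × ℝ) : Prog (DState V) :=
  let k := s.value x + ((α * y.2 : ℝ) : WithTop ℝ)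
  if s.finished y.1 = false ∧ k < s.heap.key y.1 then do
    let h ← s.heap.decreaseKey fuel y.1 k
    ret { s with heap := h, parent := Function.update s.parent y.1 (some x) }
  else ret s

/-- While the heap is not empty, remove a vertex with the smallest key and process its edges. -/
def dijkstraLoop (α : ℝ) (adj : V → List (V × ℝ)) : ℕ → DState V → Prog (DState V)
  | 0, _ => fail
  | fuel + 1, s => tick <| do
      match ← s.heap.popMin fuel with
      | none => ret s
      | some (x, h) => do
          let s' ← loop (adj x)
            { s with
              heap := h
              value := Function.update s.value x (h.key x)
              finished := Function.update s.finished x true }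
            (relax fuel α x)
          dijkstraLoop α adj fuel s'

/-- `ModDijkstra`: the values `min_t (v₀ t + α * dist x t)` over all terminals `t`, and the pointers
to the vertices from which they were obtained. -/
def modDijkstra (fuel : ℕ) (N : Net V) (v₀ : V → Option ℝ) (α : ℝ) :
    Prog ((V → WithTop ℝ) × (V → Option V)) := do
  let adj ← adjacency N
  let h ← FibHeap.init N.verts
  let h ← loop N.verts h (fun h x =>
    match v₀ x with
    | none => ret h
    | some a => h.decreaseKey fuel x (a : WithTop ℝ))
  let value ← newArray N.verts ⊤
  let finished ← newArray N.verts false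
  let parent ← newArray N.verts none
  let s ← dijkstraLoop α adj fuel
    { heap := h, value := value, finished := finished, parent := parent }
  ret (s.value, s.parent)

/-- `CompVLow`; all values are finite when every vertex is connected to a terminal. -/
def compVLow (fuel : ℕ) (N : Net V) (v₀ : V → Option ℝ) (α : ℝ) : Prog (V → ℝ) := do
  let r ← modDijkstra fuel N v₀ α
  charge N.verts.length
  ret (fun x => (r.1 x).untopD 0)

/-- `CompVHigh`. -/
def compVHigh (fuel : ℕ) (N : Net V) (v₀ : V → Option ℝ) (α : ℝ) : Prog (V → ℝ) := do
  charge N.verts.length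
  let r ← modDijkstra fuel N (fun x => (v₀ x).map (fun a => -a)) α
  charge N.verts.length
  ret (fun x => -(r.1 x).untopD 0)

/-- `CompHighPressGraph`: the subgraph induced on the vertices with pressure more than `α`. -/
def compHighPressGraph (fuel : ℕ) (N : Net V) (v₀ : V → Option ℝ) (α : ℝ) : Prog (Net V) := do
  let lo ← compVLow fuel N v₀ α
  let hi ← compVHigh fuel N v₀ α
  let vs ← select N.verts (fun x => decide (hi x > lo x))
  let es ← select N.edges (fun e => decide (hi e.1 > lo e.1) && decide (hi e.2.1 > lo e.2.1))
  ret { verts := vs, edges := es }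

/-- `StarSteepestPath`: two terminals `t₁`, `t₂` in `T` that maximize
`(v t₁ - v t₂) / (d t₁ + d t₂)`. -/
def starSteepestPath : ℕ → List V → (V → ℝ) → (V → ℝ) → Prog (V × V)
  | 0, _, _, _ => fail
  | fuel + 1, T, v, d => tick <| do
      let t₁ ← sample T
      match ← argmax T (fun t => |v t₁ - v t| / (d t₁ + d t)) with
      | none => fail
      | some t₂ => do
          let α := |v t₂ - v t₁| / (d t₁ + d t₂)
          match ← argmax T (fun t => -(v t + α * d t)), ← argmax T (fun t => v t - α * d t) with
          | some a, some b => do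
              let vlow := v a + α * d a
              let vhigh := v b - α * d b
              let T' ← select T (fun t =>
                decide (v t > vlow + α * d t) || decide (v t < vhigh - α * d t))
              if T'.isEmpty then
                if v t₁ ≥ v t₂ then ret (t₁, t₂) else ret (t₂, t₁)
              else starSteepestPath fuel T' v d
          | _, _ => fail

/-- A terminal path: its vertices in their order, each with the length of the path up to it, the
voltage of its first vertex, and its gradient. -/
structure TPath (V : Type) where
  steps : List (V × ℝ)
  start : ℝ
  grad : ℝ

/-- Follow the pointers from `y` until the root of the tree of shortest paths. -/
def follow (parent : V → Option V) : ℕ → V → Prog (List V)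
  | 0, _ => fail
  | fuel + 1, y => tick <|
      match parent y with
      | none => ret [y]
      | some z => do
          let l ← follow parent fuel z
          ret (y :: l)

/-- The path that consists of a shortest path from `t₁` to `x` and a shortest path from `x` to `t₂`,
where `d` and `parent` are the distances and the pointers for shortest paths to `x`. -/
def pathThrough (fuel : ℕ) (v d : V → ℝ) (parent : V → Option V) (t₁ t₂ : V) :
    Prog (TPath V) := do
  let A ← follow parent fuel t₁
  let B ← follow parent fuel t₂
  charge (A.length + B.length)
  ret { steps := A.map (fun y => (y, d t₁ - d y)) ++ B.reverse.tail.map (fun y => (y, d t₁ + d y))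
        start := v t₁
        grad := (v t₁ - v t₂) / (d t₁ + d t₂) }

/-- `VertexSteepestPath`: a steepest terminal path through `x`.  The result is `none` when `x` is the
only terminal in its connected component. -/
def vertexSteepestPath (fuel : ℕ) (N : Net V) (v₀ : V → Option ℝ) (x : V) :
    Prog (Option (TPath V)) := do
  charge N.verts.length
  let r ← modDijkstra fuel N (fun y => if y = x then some 0 else none) 1
  charge (2 * N.verts.length)
  let d : V → ℝ := fun y => (r.1 y).untopD 0
  let v : V → ℝ := fun y => (v₀ y).getD 0
  let T ← select N.verts (fun t => (v₀ t).isSome && decide (r.1 t < ⊤))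
  if (v₀ x).isSome then do
    let T₁ ← select T (fun t => t ≠ x)
    match ← argmax T₁ (fun y => |v x - v y| / d y) with
    | none => ret none
    | some y => do
        let P ← if v x ≥ v y then pathThrough fuel v d r.2 x y else pathThrough fuel v d r.2 y x
        ret (some P)
  else do
    let t ← starSteepestPath fuel T v d
    let P ← pathThrough fuel v d r.2 t.1 t.2
    ret (some P)

/-- `SteepestPath`: a steepest free terminal path, if there are no terminal-terminal edges and some
vertex is not a terminal. -/
def steepestPath : ℕ → Net V → (V → Option ℝ) → Prog (TPath V)
  | 0, _, _ => fail
  | fuel + 1, N, v₀ => tick <| do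
      let e ← sample N.edges
      let x₃ ← sample N.verts
      let P₁ ← vertexSteepestPath fuel N v₀ e.1
      let P₂ ← vertexSteepestPath fuel N v₀ e.2.1
      let P₃ ← vertexSteepestPath fuel N v₀ x₃
      match ← argmax (P₁.toList ++ P₂.toList ++ P₃.toList) (fun P => P.grad) with
      | none => fail
      | some P => do
          let N' ← compHighPressGraph fuel N v₀ P.grad
          if N'.edges.isEmpty then ret P else steepestPath fuel N' v₀

/-- `fix[v₀, P]`: give the non-terminals on `P` the voltages that are linear along `P`. -/
def fixPath (v₀ : V → Option ℝ) (P : TPath V) : Prog (V → Option ℝ) :=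
  loop P.steps v₀ (fun u y => ret <|
    if (u y.1).isNone then Function.update u y.1 (some (P.start - P.grad * y.2)) else u)

/-- `CompLexMin`. -/
def compLexMin : ℕ → Net V → (V → Option ℝ) → Prog (V → Option ℝ)
  | 0, _, _ => fail
  | fuel + 1, N, v₀ => tick <| do
      let free ← select N.verts (fun x => (v₀ x).isNone)
      if free.isEmpty then ret v₀
      else do
        let es ← select N.edges (fun e => !((v₀ e.1).isSome && (v₀ e.2.1).isSome))
        let N' : Net V := { verts := N.verts, edges := es }
        let P ← steepestPath fuel N' v₀
        let v₁ ← fixPath v₀ P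
        compLexMin fuel N' v₁

end Algorithms

end

/-! Correctness rests on one exchange argument. Let α be the largest gradient of a terminal path and
let P attain it. Every value on P is pinned between two terminals by walks of gradient α, so an
extension of `v₀` that deviates from the linear interpolation on P has gradient above α on some edge
(`Net.Walk.sub_le`). Fixing P creates no terminal walk steeper than α (`OnPath.gradLE`), so the
output stays within α on all edges that are not between terminals, where nothing can change. By
induction on the rounds (`good_of_fix`) the output satisfies `Good`: every other extension is worse
above some threshold β, while above β the output has nonzero freedom nowhere. `lex_sort_map` turns
this into strict lexicographic inequality, which gives optimality, uniqueness and independence of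
the random choices together. Existence comes from the algorithm itself, as some run must end with a
`Good` result.

The randomized searches use one principle. All candidates of pressure at most that of a random
candidate are discarded, and on average at most half of the candidates beat a random one
(`sum_length_filter_le`, `sum_numBeats`). Linear work per call therefore gives linear expected time
in all. The recursion is legitimate because a walk witnessing high pressure consists of vertices of
high pressure (`HP.hpNet`), so passing to the subgraph loses no steep path.

One call of Dijkstra's algorithm costs O(m + n log n) by the amortized analysis of Fibonacci heaps:
`Core.two_pow_le_card_desc` makes degrees logarithmic, and the potential `pot` pays for cascading
cuts, links and stale child entries. A round of CompLexMin costs a constant number of such calls in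
expectation and fixes at least one vertex, so there are at most n rounds.

Costs are tracked by two program logics: `Spec` for worst-case bounds, where the potential can enter
the postcondition, and `Triple` for expected bounds. Failure and wrong results cost ⊤ in `Triple`,
so a finite expectation also certifies that every run is correct. -/

namespace Prog

variable {α β γ : Type}

/-! ### Worst-case specifications -/

/-- `p` never gives up, and every possible result `a`, obtained after `k` steps, satisfies
`Q a k`. -/
def Spec : Prog α → (α → ℕ → Prop) → Prop
  | ret a, Q => Q a 0
  | fail, _ => False
  | tick p, Q => Spec p (fun a k => Q a (k + 1))
  | draw _ p, Q => ∀ i, Spec (p i) (fun a k => Q a (k + 1))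

theorem Spec.mono {p : Prog α} : ∀ {Q Q' : α → ℕ → Prop}, Spec p Q →
    (∀ a k, Q a k → Q' a k) → Spec p Q' := by
  induction p with
  | ret a => intro Q Q' h h'; exact h' _ _ h
  | fail => intro Q Q' h _; exact h
  | tick p ih => intro Q Q' h h'; exact ih h (fun a k => h' a (k + 1))
  | draw k p ih => intro Q Q' h h' i; exact ih i (h i) (fun a k => h' a (k + 1))

theorem spec_bind {p : Prog α} {f : α → Prog β} : ∀ {Q : β → ℕ → Prop},
    Spec (p >>= f) Q ↔ Spec p (fun a k => Spec (f a) (fun b l => Q b (k + l))) := by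
  change ∀ {Q : β → ℕ → Prop},
    Spec (Prog.bind p f) Q ↔ Spec p (fun a k => Spec (f a) (fun b l => Q b (k + l)))
  induction p with
  | ret a => intro Q; simp [Prog.bind, Spec]
  | fail => intro Q; simp [Prog.bind, Spec]
  | tick p ih =>
    intro Q
    simp only [Prog.bind, Spec, ih]
    simp only [add_right_comm]
  | draw k p ih =>
    intro Q
    simp only [Prog.bind, Spec, ih]
    simp only [add_right_comm]

@[simp] theorem spec_ret {a : α} {Q : α → ℕ → Prop} : Spec (ret a) Q ↔ Q a 0 := Iff.rfl

@[simp] theorem spec_tick {p : Prog α} {Q : α → ℕ → Prop} :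
    Spec (tick p) Q ↔ Spec p (fun a k => Q a (k + 1)) := Iff.rfl

@[simp] theorem spec_charge {n : ℕ} {Q : Unit → ℕ → Prop} : Spec (charge n) Q ↔ Q () n := by
  induction n generalizing Q with
  | zero => exact Iff.rfl
  | succ n ih => simp only [charge, spec_tick, ih]

@[simp] theorem spec_select {l : List α} {p : α → Bool} {Q : List α → ℕ → Prop} :
    Spec (select l p) Q ↔ Q (l.filter p) l.length := by
  simp [select, spec_bind]

@[simp] theorem spec_argmax {l : List α} {f : α → ℝ} {Q : Option α → ℕ → Prop} :
    Spec (argmax l f) Q ↔ Q (l.argmax f) l.length := by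
  simp [argmax, spec_bind]

@[simp] theorem spec_newArray {l : List α} {b : β} {Q : (α → β) → ℕ → Prop} :
    Spec (newArray l b) Q ↔ Q (fun _ => b) l.length := by
  simp [newArray, spec_bind]

/-- The rule for loops: the invariant `I` may depend on the entries that are still to be
processed and on the number of steps made so far. -/
theorem spec_loop {l : List α} {init : β} {body : β → α → Prog β} (I : List α → β → ℕ → Prop)
    (h0 : I l init 0)
    (hs : ∀ a r b k, I (a :: r) b k → Spec (body b a) (fun b' j => I r b' (k + j + 1))) :
    Spec (loop l init body) (fun b k => I [] b k) := by
  have key : ∀ (l : List α) (b : β) (k : ℕ), I l b k →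
      Spec (loop l b body) (fun b' j => I [] b' (k + j)) := by
    intro l
    induction l with
    | nil => intro b k h; exact h
    | cons a r ih =>
      intro b k h
      have : loop (a :: r) b body = (tick (body b a) >>= fun b' => loop r b' body) := by
        simp [loop, List.foldlM_cons]
      rw [this, spec_bind, spec_tick]
      refine (hs a r b k h).mono fun b' j h' => ?_
      refine (ih b' _ h').mono fun b'' j' h'' => ?_
      convert h'' using 1
      ring
  simpa using key l init 0 h0

/-! ### Expected running times -/

/-- The expectation of the number of steps plus `g` of the result, where giving up counts as
infinitely many steps. -/
noncomputable def ert : Prog α → (α → ℝ≥0∞) → ℝ≥0∞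
  | ret a, g => g a
  | fail, _ => ⊤
  | tick p, g => 1 + ert p g
  | draw k p, g => 1 + (∑ i, ert (p i) g) / (k + 1 : ℕ)

theorem ert_bind (p : Prog α) (f : α → Prog β) (g : β → ℝ≥0∞) :
    ert (p >>= f) g = ert p (fun a => ert (f a) g) := by
  change ert (Prog.bind p f) g = _
  induction p with
  | ret a => rfl
  | fail => rfl
  | tick p ih => simp only [Prog.bind, ert, ih]
  | draw k p ih => simp only [Prog.bind, ert, ih]

theorem ert_mono (p : Prog α) {g g' : α → ℝ≥0∞} (h : ∀ a, g a ≤ g' a) : ert p g ≤ ert p g' := by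
  induction p with
  | ret a => exact h a
  | fail => exact le_rfl
  | tick p ih => simp only [ert]; gcongr
  | draw k p ih =>
    simp only [ert]
    gcongr with i
    exact ih i

/-- The probabilities sum to one, so a constant passes through every average; a failing branch does
no harm because ⊤ absorbs it. This is why bounds of consecutive programs add. -/
theorem ert_add_const (p : Prog α) (g : α → ℝ≥0∞) (c : ℝ≥0∞) :
    ert p (fun a => g a + c) = ert p g + c := by
  induction p with
  | ret a => rfl
  | fail => simp [ert]
  | tick p ih => simp only [ert, ih, add_assoc]
  | draw k p ih =>
    simp only [ert, ih]
    rw [Finset.sum_add_distrib, ENNReal.add_div, Finset.sum_const, add_assoc]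
    congr 2
    rw [Finset.card_univ, Fintype.card_fin, nsmul_eq_mul, mul_comm]
    exact ENNReal.mul_div_cancel_right (by simp) (by simp)

open Classical in
/-- `p` never gives up, all its results satisfy `Q`, and its expected running time is at
most `B`. -/
def Triple (p : Prog α) (Q : α → Prop) (B : ℝ≥0∞) : Prop :=
  ert p (fun a => if Q a then 0 else ⊤) ≤ B

theorem Triple.mono {p : Prog α} {Q Q' : α → Prop} {B B' : ℝ≥0∞} (h : Triple p Q B)
    (hQ : ∀ a, Q a → Q' a) (hB : B ≤ B') : Triple p Q' B' := by
  refine (ert_mono p fun a => ?_).trans (h.trans hB)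
  by_cases h1 : Q a
  · simp [h1, hQ a h1]
  · simp [h1]

/-- Results that violate `Q` already cost ⊤ in the first program, so the bound on the continuation
is needed only for results with `Q`. -/
theorem Triple.bind {p : Prog α} {f : α → Prog β} {Q : α → Prop} {Q' : β → Prop}
    {B B' : ℝ≥0∞} (h : Triple p Q B) (h' : ∀ a, Q a → Triple (f a) Q' B') :
    Triple (p >>= f) Q' (B + B') := by
  classical
  unfold Triple
  rw [ert_bind]
  calc _ ≤ ert p (fun a => (if Q a then 0 else ⊤) + B') := by
        refine ert_mono p fun a => ?_
        by_cases h1 : Q a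
        · simpa [h1, Triple] using h' a h1
        · simp [h1]
    _ = _ := ert_add_const _ _ _
    _ ≤ _ := by gcongr; exact h

theorem Triple.ret {a : α} {Q : α → Prop} (h : Q a) : Triple (ret a) Q 0 := by
  simp [Triple, ert, h]

theorem Triple.tick {p : Prog α} {Q : α → Prop} {B : ℝ≥0∞} (h : Triple p Q B) :
    Triple (tick p) Q (1 + B) := by
  simp only [Triple, ert] at *
  gcongr

theorem Triple.draw {k : ℕ} {p : Fin (k + 1) → Prog α} {Q : α → Prop} {B : Fin (k + 1) → ℝ≥0∞}
    (h : ∀ i, Triple (p i) Q (B i)) :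
    Triple (draw k p) Q (1 + (∑ i, B i) / (k + 1 : ℕ)) := by
  simp only [Triple, ert] at *
  gcongr with i
  exact h i

theorem average_add_const {k : ℕ} (f : Fin (k + 1) → ℝ≥0∞) (c : ℝ≥0∞) :
    (∑ i, (f i + c)) / (k + 1 : ℕ) = (∑ i, f i) / (k + 1 : ℕ) + c := by
  rw [Finset.sum_add_distrib, ENNReal.add_div, Finset.sum_const, Finset.card_univ,
    Fintype.card_fin, nsmul_eq_mul, mul_comm]
  congr 1
  exact ENNReal.mul_div_cancel_right (by simp) (by simp)

theorem Spec.triple {p : Prog α} {Q : α → Prop} {B : ℕ}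
    (h : Spec p (fun a k => Q a ∧ k ≤ B)) : Triple p Q B := by
  classical
  -- The number `j` counts the steps already made, so that the induction can pass below a `tick` or
  -- a `draw`.
  have key : ∀ j : ℕ, Spec p (fun a k => Q a ∧ k + j ≤ B) →
      ert p (fun a => if Q a then 0 else ⊤) + j ≤ B := by
    clear h
    induction p with
    | ret a =>
      intro j h
      rw [spec_ret] at h
      simp only [ert, h.1, if_true]
      simpa using h.2
    | fail => intro j h; exact h.elim
    | tick p ih =>
      intro j h
      refine le_trans (le_of_eq ?_) (ih (j + 1) (Spec.mono (p := p) h fun a k hk => ⟨hk.1, by linarith [hk.2]⟩))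
      simp only [ert]; push_cast; ring
    | draw k p ih =>
      intro j h
      have := fun i => ih i (j + 1) ((h i).mono fun a k hk => ⟨hk.1, by linarith [hk.2]⟩)
      simp only [ert]
      calc _ = (∑ i, (ert (p i) (fun a => if Q a then 0 else ⊤) + (j + 1 : ℕ))) / (k + 1 : ℕ) := by
            rw [average_add_const]; push_cast; ring
        _ ≤ (∑ _i : Fin (k + 1), (B : ℝ≥0∞)) / (k + 1 : ℕ) := by
            gcongr with i
            exact this i
        _ = B := by simpa using average_add_const (k := k) (fun _ => 0) B
  simpa [Triple] using key 0 (by simpa using h)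

/-- A random choice from a list costs its length and the average over its entries. -/
theorem Triple.sample_bind {l : List α} {f : α → Prog β} {Q : β → Prop} {B : α → ℝ≥0∞}
    (hl : l ≠ []) (h : ∀ a ∈ l, Triple (f a) Q (B a)) :
    Triple (sample l >>= f) Q (l.length + 1 + (l.map B).sum / l.length) := by
  obtain ⟨a, l, rfl⟩ := List.exists_cons_of_ne_nil hl
  -- The continuation is moved inside the draw. `Triple.bind` alone would require one bound for all
  -- entries, whereas the bound here has to depend on the entry drawn.
  have h1 : (sample (a :: l) >>= f) =
      (charge (l.length + 1) >>= fun _ =>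
        Prog.draw l.length (fun i => f ((a :: l).get i))) := by
    change Prog.bind (Prog.bind _ _) _ = Prog.bind _ _
    have : ∀ n : ℕ, Prog.bind (Prog.bind (charge n)
        fun _ => Prog.draw l.length (fun i => Prog.ret ((a :: l).get i))) f =
        Prog.bind (charge n) fun _ => Prog.draw l.length (fun i => f ((a :: l).get i)) := by
      intro n
      induction n with
      | zero => simp [charge, Prog.bind]
      | succ n ih => simp only [charge, Prog.bind]; rw [ih]
    exact this _
  rw [h1]
  refine (Triple.bind (Q := fun _ => True) (B := (l.length + 1 : ℕ)) (Spec.triple (by simp))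
    (fun _ _ => Triple.draw (B := fun i => B ((a :: l).get i))
      (fun i => h _ (List.get_mem _ _)))).mono (fun _ => id) (le_of_eq ?_)
  have h2 : ((a :: l).map B).sum = ∑ i : Fin (l.length + 1), B ((a :: l).get i) := by
    rw [← List.sum_ofFn]
    congr 1
    apply List.ext_get <;> simp
  rw [h2]
  simp only [List.length_cons]
  push_cast
  ring

/-- The average number of entries that beat a random entry of a list. -/
theorem sum_length_filter_le (l : List α) (R : α → α → Bool)
    (hR : ∀ a b, R a b = true → R b a = true → False) :
    2 * (l.map fun a => (l.filter fun b => R b a).length).sum ≤ l.length * l.length := by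
  have h1 : ∀ (p : α → Bool) (l : List α), (l.filter p).length =
      (l.map fun b => if p b then 1 else 0).sum := by
    intro p l
    induction l with
    | nil => rfl
    | cons a l ih => by_cases h : p a <;> simp [h, ih, add_comm]
  have key : ∀ l : List α,
      2 * (l.map fun a => (l.filter fun b => R b a).length).sum ≤ l.length * l.length := by
    intro l
    induction l with
    | nil => simp
    | cons a l ih =>
      have h2 : (l.map fun x => ((a :: l).filter fun b => R b x).length).sum =
          (l.map fun x => (l.filter fun b => R b x).length).sum +
            (l.map fun x => if R a x then 1 else 0).sum := by
        rw [← List.sum_map_add]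
        congr 1
        refine List.map_congr_left fun x _ => ?_
        by_cases h : R a x <;> simp [h]
      have h3 : ((a :: l).filter fun b => R b a).length = (l.filter fun b => R b a).length := by
        have : R a a = false := by
          by_contra h
          exact hR a a (by simpa using h) (by simpa using h)
        simp [this]
      -- By asymmetry each `b` contributes to at most one of the two counts.
      have h4 : (l.filter fun b => R b a).length + (l.map fun x => if R a x then 1 else 0).sum
          ≤ l.length := by
        rw [h1, ← List.sum_map_add]
        have : ∀ m : List α, (m.map fun i => (if R i a then 1 else 0) +
            if R a i then 1 else 0).sum ≤ m.length := by
          intro m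
          induction m with
          | nil => simp
          | cons b m ih =>
            have := hR a b
            simp only [List.map_cons, List.sum_cons, List.length_cons]
            by_cases h : R a b <;> by_cases h' : R b a <;> simp_all <;> omega
        exact this l
      simp only [List.map_cons, List.sum_cons, List.length_cons]
      rw [h2, h3]
      nlinarith
  exact key l

/-! ### Soundness -/

theorem tsum_map_mul {δ ε : Type} (p : PMF δ) (f : δ → ε) (g : ε → ℝ≥0∞) :
    ∑' b, p.map f b * g b = ∑' a, p a * g (f a) := by
  classical
  simp only [PMF.map_apply, ← ENNReal.tsum_mul_right]
  rw [ENNReal.tsum_comm]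
  refine tsum_congr fun a => ?_
  rw [tsum_eq_single (f a)]
  · simp
  · intro b hb; simp [hb]

theorem tsum_bind_mul {δ ε : Type} (p : PMF δ) (f : δ → PMF ε) (g : ε → ℝ≥0∞) :
    ∑' b, p.bind f b * g b = ∑' a, p a * ∑' b, f a b * g b := by
  simp only [PMF.bind_apply, ← ENNReal.tsum_mul_right, ← ENNReal.tsum_mul_left, mul_assoc]
  rw [ENNReal.tsum_comm]

theorem tsum_map_succ (p : PMF (Option α × ℕ)) :
    ∑' o : Option α × ℕ, p.map (fun o => (o.1, o.2 + 1)) o * (o.2 : ℝ≥0∞) = 1 + ∑' o, p o * (o.2 : ℝ≥0∞) := by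
  rw [tsum_map_mul]
  push_cast
  simp only [mul_add, mul_one]
  rw [ENNReal.tsum_add, p.tsum_coe, add_comm]

/-- Only an inequality, since giving up is infinitely expensive on the right and free on the left.
-/
theorem expectedTime_le_ert (p : Prog α) (g : α → ℝ≥0∞) : expectedTime p ≤ ert p g := by
  induction p with
  | ret a =>
    simp only [expectedTime, run, ert]
    rw [tsum_eq_single (some a, 0)]
    · simp
    · intro b hb; simp [PMF.pure_apply, hb]
  | fail => simp [ert]
  | tick p ih =>
    simp only [expectedTime, run, ert] at *
    rw [tsum_map_succ]
    gcongr
  | draw k p ih =>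
    simp only [expectedTime, run, ert] at *
    rw [tsum_bind_mul]
    simp only [tsum_map_succ, PMF.uniformOfFintype_apply, Fintype.card_fin]
    rw [tsum_fintype, ← Finset.mul_sum, mul_comm, ← div_eq_mul_inv]
    simp only [add_comm (1 : ℝ≥0∞)]
    rw [average_add_const]
    gcongr with i
    exact ih i

theorem Triple.expectedTime_le {p : Prog α} {Q : α → Prop} {B : ℝ≥0∞} (h : Triple p Q B) :
    expectedTime p ≤ B :=
  (expectedTime_le_ert p _).trans h

/-- An outcome in the support has positive probability, so a single bad one would make the
expectation infinite. -/
theorem Triple.support {p : Prog α} {Q : α → Prop} {B : ℝ≥0∞} (h : Triple p Q B) (hB : B ≠ ⊤) :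
    ∀ o ∈ (run p).support, ∃ a, o.1 = some a ∧ Q a := by
  classical
  have h' : ert p (fun a => if Q a then 0 else ⊤) ≠ ⊤ := ne_top_of_le_ne_top hB h
  clear h
  induction p with
  | ret a =>
    intro o ho
    have : o = (some a, 0) := by simpa [run] using ho
    subst this
    refine ⟨a, rfl, ?_⟩
    by_contra hQ
    simp [ert, hQ] at h'
  | fail => simp [ert] at h'
  | tick p ih =>
    intro o ho
    simp only [run, PMF.support_map, Set.mem_image] at ho
    obtain ⟨o', ho', rfl⟩ := ho
    simp only [ert] at h'
    exact ih (fun h => h' (by simp [h])) o' ho'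
  | draw k p ih =>
    intro o ho
    simp only [run, PMF.support_bind, PMF.support_map, Set.mem_iUnion, Set.mem_image] at ho
    obtain ⟨i, _, o', ho', rfl⟩ := ho
    refine ih i (fun h => h' ?_) o' ho'
    simp only [ert]
    rw [ENNReal.sum_eq_top.2 ⟨i, Finset.mem_univ _, h⟩, ENNReal.top_div_of_ne_top (by simp)]
    simp

end Prog

namespace FibHeap
open Prog

variable {V : Type} [DecidableEq V]

/-! ### Invariants of Fibonacci heaps -/

/-- The children of `p`. -/
def children (h : FibHeap V) (S : Finset V) (p : V) : Finset V :=
  S.filter (fun c => h.parent c = some p)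

/-- The invariants of the forest of a heap with item set `S`.  The function `e` counts the children
that a vertex has lost but has not yet accounted for by a mark. -/
structure Core (h : FibHeap V) (S : Finset V) (e : V → ℕ) : Prop where
  mem_of_parent : ∀ c p, h.parent c = some p → c ∈ S ∧ p ∈ S
  key_le : ∀ c p, h.parent c = some p → h.key p ≤ h.key c
  mem_kids : ∀ c p, h.parent c = some p → c ∈ h.kids p
  deg_eq : ∀ p ∈ S, h.deg p = (h.children S p).card
  few : ∀ p j, ((h.children S p).filter
    (fun c => h.deg c + (if h.mark c then 1 else 0) + e c < j)).card ≤ j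
  acyclic : ∃ rank : V → ℕ, ∀ c p, h.parent c = some p → rank c < rank p

/-- The invariants of a heap with item set `S` between the operations. -/
structure Inv (h : FibHeap V) (S : Finset V) (e : V → ℕ) : Prop where
  core : h.Core S e
  nodup_roots : h.roots.Nodup
  mem_roots : ∀ x, x ∈ h.roots ↔ x ∈ S ∧ h.parent x = none
  table_eq : ∀ d, h.table d = none

/-- The potential, with weight `a` for each root. -/
def pot (a : ℕ) (h : FibHeap V) (S : Finset V) : ℕ :=
  a * (S.filter (fun x => h.parent x = none)).card +
    6 * (S.filter (fun x => h.mark x = true)).card + ∑ x ∈ S, (h.kids x).length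

theorem Core.parent_ne {h : FibHeap V} {S : Finset V} {e : V → ℕ} (H : h.Core S e) {c p : V}
    (hc : h.parent c = some p) : c ≠ p := by
  rintro rfl
  obtain ⟨rank, hr⟩ := H.acyclic
  exact lt_irrefl _ (hr _ _ hc)

/-- Climbing to the parent raises the rank, which is bounded on `S`, and never raises the key. Hence
a minimum over the roots is a minimum over the heap. -/
theorem Core.exists_root {h : FibHeap V} {S : Finset V} {e : V → ℕ} (H : h.Core S e) {y : V}
    (hy : y ∈ S) : ∃ r ∈ S, h.parent r = none ∧ h.key r ≤ h.key y := by
  obtain ⟨rank, hr⟩ := H.acyclic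
  have hB : ∀ z ∈ S, rank z ≤ S.sup rank := fun z hz => Finset.le_sup hz
  generalize hn : S.sup rank - rank y = n
  induction n using Nat.strong_induction_on generalizing y with
  | _ n ih =>
    cases hp : h.parent y with
    | none => exact ⟨y, hy, hp, le_rfl⟩
    | some p =>
      have h1 := hr _ _ hp
      have h2 := (H.mem_of_parent _ _ hp).2
      have h3 := hB p h2
      obtain ⟨r, hr1, hr2, hr3⟩ := ih (S.sup rank - rank p) (by omega) h2 rfl
      exact ⟨r, hr1, hr2, hr3.trans (H.key_le _ _ hp)⟩

open Classical in
/-- The descendants of `x`. -/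
noncomputable def desc (h : FibHeap V) (S : Finset V) (x : V) : Finset V :=
  S.filter (fun y => Relation.ReflTransGen (fun a b => h.parent a = some b) y x)

omit [DecidableEq V] in
theorem desc_subset (h : FibHeap V) (S : Finset V) (x : V) : h.desc S x ⊆ S := by
  classical
  exact Finset.filter_subset _ _

omit [DecidableEq V] in
theorem Core.rank_le {h : FibHeap V} {rank : V → ℕ}
    (hr : ∀ c p, h.parent c = some p → rank c < rank p) {a b : V}
    (hab : Relation.ReflTransGen (fun a b => h.parent a = some b) a b) : rank a ≤ rank b := by
  induction hab with
  | refl => exact le_rfl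
  | tail _ h1 ih => exact ih.trans (hr _ _ h1).le

/-- Parents are unique, so the ancestors of a common descendant form a chain and one sibling would
lie above the other. But the first step up from the lower one leads to `x`, whose rank already
exceeds that of its children. -/
theorem Core.disjoint_desc {h : FibHeap V} {S : Finset V} {e : V → ℕ} (H : h.Core S e)
    {c c' x : V} (hc : h.parent c = some x) (hc' : h.parent c' = some x) (hne : c ≠ c') :
    Disjoint (h.desc S c) (h.desc S c') := by
  obtain ⟨rank, hr⟩ := H.acyclic
  have key : ∀ {c c' : V}, h.parent c = some x → h.parent c' = some x → c ≠ c' →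
      ¬ Relation.ReflTransGen (fun a b => h.parent a = some b) c c' := by
    intro c c' hc hc' hne hcc
    rcases Relation.ReflTransGen.cases_head hcc with h1 | ⟨d, h1, h2⟩
    · exact hne h1
    · rw [hc] at h1
      cases h1
      exact absurd (Core.rank_le hr h2) (not_le.2 (hr _ _ hc'))
  rw [Finset.disjoint_left]
  intro y hy hy'
  simp only [desc, Finset.mem_filter] at hy hy'
  have hu : Relator.RightUnique (fun a b => h.parent a = some b) := by
    intro a b b' h1 h2
    rw [h1] at h2
    exact Option.some_injective _ h2
  rcases Relation.ReflTransGen.total_of_right_unique hu hy.2 hy'.2 with h1 | h1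
  · exact key hc hc' hne h1
  · exact key hc' hc hne.symm h1

/-- Replaces the golden-ratio estimate: three more children guarantee two children one level up in
the induction, and their descendants are disjoint. -/
theorem Core.two_pow_le_card_desc {h : FibHeap V} {S : Finset V} (H : h.Core S 0) (k : ℕ) :
    ∀ x ∈ S, 3 * k ≤ h.deg x → 2 ^ k ≤ (h.desc S x).card := by
  induction k with
  | zero =>
    intro x hx _
    refine Finset.card_pos.2 ⟨x, ?_⟩
    simp [desc, hx, Relation.ReflTransGen.refl]
  | succ k ih =>
    intro x hx hdeg
    -- At most `3 * k + 1` of the at least `3 * k + 3` children have degree plus mark below `3 * k +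
    -- 1`. Two children remain, and dropping the mark still leaves them degree at least `3 * k`.
    have h1 := H.few x (3 * k + 1)
    rw [H.deg_eq x hx] at hdeg
    have h2 := Finset.card_filter_add_card_filter_not (s := h.children S x)
      (fun c => h.deg c + (if h.mark c then 1 else 0) + (0 : V → ℕ) c < 3 * k + 1)
    obtain ⟨c, hc, c', hc', hne⟩ := Finset.one_lt_card.1 (show 1 < ((h.children S x).filter
      (fun c => ¬ h.deg c + (if h.mark c then 1 else 0) + (0 : V → ℕ) c < 3 * k + 1)).card by omega)
    simp only [Finset.mem_filter, children, Pi.zero_apply] at hc hc'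
    have hd : ∀ c, ¬ h.deg c + (if h.mark c then 1 else 0) + 0 < 3 * k + 1 → 3 * k ≤ h.deg c := by
      intro c hc
      split_ifs at hc <;> omega
    have h3 := ih c hc.1.1 (hd _ hc.2)
    have h4 := ih c' hc'.1.1 (hd _ hc'.2)
    have h5 := Finset.card_union_of_disjoint (H.disjoint_desc hc.1.2 hc'.1.2 hne)
    have h6 : h.desc S c ∪ h.desc S c' ⊆ h.desc S x := by
      intro y hy
      simp only [desc, Finset.mem_union, Finset.mem_filter] at hy ⊢
      rcases hy with hy | hy
      · exact ⟨hy.1, hy.2.tail hc.1.2⟩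
      · exact ⟨hy.1, hy.2.tail hc'.1.2⟩
    have h7 := Finset.card_le_card h6
    rw [pow_succ]
    omega

theorem Core.deg_lt {h : FibHeap V} {S : Finset V} {L : ℕ} (H : h.Core S 0) (hL : S.card < 2 ^ L)
    {x : V} (hx : x ∈ S) : h.deg x < 3 * L := by
  by_contra hd
  have h1 := H.two_pow_le_card_desc L x hx (by omega)
  have h2 := Finset.card_le_card (h.desc_subset S x)
  omega

/-! ### Cuts and links -/

theorem Core.setKey {h : FibHeap V} {S : Finset V} {e : V → ℕ} (H : h.Core S e) {x : V}
    {k : WithTop ℝ} (hk : k ≤ h.key x) (hp : ∀ p, h.parent x = some p → h.key p ≤ k) :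
    Core { h with key := Function.update h.key x k } S e where
  mem_of_parent := H.mem_of_parent
  key_le c p hc := by
    have h1 := H.key_le c p hc
    have h2 := H.parent_ne hc
    simp only [Function.update_apply]
    split_ifs with h3 h4 h4
    · exact le_rfl
    · subst h3; exact hk.trans h1
    · subst h4; exact hp p hc
    · exact h1
  mem_kids := H.mem_kids
  deg_eq := H.deg_eq
  few := H.few
  acyclic := H.acyclic

/-- The degree of `p` falls by one, and `e'` must absorb this loss to preserve `few`. Nothing is
asked at `x`, which is no longer a child. -/
theorem Core.cut {h : FibHeap V} {S : Finset V} {e e' : V → ℕ} (H : h.Core S e) {x p : V}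
    (hx : h.parent x = some p) (he : ∀ c, c ≠ x → e c + (if c = p then 1 else 0) ≤ e' c) :
    Core (h.cut x p) S e' := by
  have hpar : ∀ c q, (h.cut x p).parent c = some q → c ≠ x ∧ h.parent c = some q := by
    intro c q hc
    simp only [FibHeap.cut, Function.update_apply] at hc
    split_ifs at hc with h1
    exact ⟨h1, hc⟩
  have hch : ∀ q, (h.cut x p).children S q = (h.children S q).erase x := by
    intro q
    ext c
    simp only [children, FibHeap.cut, Function.update_apply, Finset.mem_filter, Finset.mem_erase]
    by_cases h1 : c = x <;> simp [h1]
  obtain ⟨hxS, hpS⟩ := H.mem_of_parent _ _ hx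
  have hxp : x ∈ h.children S p := by simp [children, hxS, hx]
  have hdp := H.deg_eq p hpS
  have hpos : 0 < (h.children S p).card := Finset.card_pos.2 ⟨x, hxp⟩
  constructor
  · intro c q hc
    exact H.mem_of_parent _ _ (hpar c q hc).2
  · intro c q hc
    exact H.key_le _ _ (hpar c q hc).2
  · intro c q hc
    exact H.mem_kids _ _ (hpar c q hc).2
  · intro q hq
    rw [hch]
    simp only [FibHeap.cut, Function.update_apply]
    split_ifs with h1
    · subst h1
      rw [Finset.card_erase_of_mem hxp, hdp]
    · rw [Finset.erase_eq_of_notMem, H.deg_eq q hq]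
      simp only [children, Finset.mem_filter, hx, not_and]
      intro _ h2
      exact h1 (Option.some_injective _ h2).symm
  · intro q j
    rw [hch]
    refine le_trans (Finset.card_le_card ?_) (H.few q j)
    intro c hc
    simp only [Finset.mem_filter, Finset.mem_erase, FibHeap.cut, Function.update_apply] at hc ⊢
    obtain ⟨⟨h1, h2⟩, h3⟩ := hc
    refine ⟨h2, ?_⟩
    have h4 := he c h1
    rw [if_neg h1] at h3
    split_ifs at h3 h4 ⊢ <;> subst_vars <;> omega
  · obtain ⟨rank, hr⟩ := H.acyclic
    exact ⟨rank, fun c q hc => hr _ _ (hpar c q hc).2⟩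

/-- For `a = 5`, cutting a marked vertex lowers the potential by `6 - 5 = 1`, which pays for one
step of the cascade. -/
theorem pot_cut {a : ℕ} {h : FibHeap V} {S : Finset V} {x p : V} (hxS : x ∈ S)
    (hx : h.parent x = some p) :
    pot a (h.cut x p) S + (if h.mark x then 6 else 0) = pot a h S + a := by
  have h1 : S.filter (fun y => (h.cut x p).parent y = none) =
      insert x (S.filter (fun y => h.parent y = none)) := by
    ext c
    simp only [FibHeap.cut, Function.update_apply, Finset.mem_filter, Finset.mem_insert]
    by_cases h1 : c = x <;> simp [h1, hxS]
  have h2 : S.filter (fun y => (h.cut x p).mark y = true) =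
      (S.filter (fun y => h.mark y = true)).erase x := by
    ext c
    simp only [FibHeap.cut, Function.update_apply, Finset.mem_filter, Finset.mem_erase]
    by_cases h1 : c = x <;> simp [h1]
  have h3 : ∀ y, (h.cut x p).kids y = h.kids y := fun _ => rfl
  simp only [pot, h1, h2, h3]
  rw [Finset.card_insert_of_notMem (by simp [hx])]
  split_ifs with hm
  · have hmem : x ∈ S.filter (fun y => h.mark y = true) := by simp [hxS, hm]
    have := Finset.card_erase_add_one hmem
    rw [← this]
    ring
  · rw [Finset.erase_eq_of_notMem (by simp [hm])]
    ring

theorem Inv.cut {h : FibHeap V} {S : Finset V} {e e' : V → ℕ} (H : h.Inv S e) {x p : V}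
    (hx : h.parent x = some p) (he : ∀ c, c ≠ x → e c + (if c = p then 1 else 0) ≤ e' c) :
    Inv (h.cut x p) S e' := by
  have hxS := (H.core.mem_of_parent _ _ hx).1
  refine ⟨H.core.cut hx he, ?_, ?_, H.table_eq⟩
  · refine List.nodup_cons.2 ⟨?_, H.nodup_roots⟩
    rw [H.mem_roots]
    simp [hx]
  · intro c
    simp only [FibHeap.cut, List.mem_cons, H.mem_roots, Function.update_apply]
    by_cases h1 : c = x <;> simp [h1, hxS]

theorem Inv.setKey {h : FibHeap V} {S : Finset V} {e : V → ℕ} (H : h.Inv S e) {x : V}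
    {k : WithTop ℝ} (hk : k ≤ h.key x) (hp : ∀ p, h.parent x = some p → h.key p ≤ k) :
    Inv { h with key := Function.update h.key x k } S e :=
  ⟨H.core.setKey hk hp, H.nodup_roots, H.mem_roots, H.table_eq⟩

/-- `Pi.single y 1` records that `y` owes a mark for the child it has lost. If `y` is a root the
debt is void, if `y` is unmarked a mark settles it, and if `y` is marked then `y` is cut and the
debt moves to its parent. The 7 is the final step together with the weight 6 of a new mark. -/
theorem spec_cascade {S : Finset V} (fuel : ℕ) : ∀ (h : FibHeap V) (y : V),
    h.Inv S (Pi.single y 1) → (S.filter (fun x => h.mark x = true)).card < fuel →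
    Spec (cascade fuel h y) (fun h' k =>
      h'.Inv S 0 ∧ h'.key = h.key ∧ k + pot 5 h' S ≤ pot 5 h S + 7) := by
  induction fuel with
  | zero => intro h y _ hf; omega
  | succ fuel ih =>
    intro h y H hf
    unfold cascade
    cases hp : h.parent y with
    | none =>
      simp only [spec_tick, spec_ret]
      refine ⟨⟨⟨H.core.mem_of_parent, H.core.key_le, H.core.mem_kids, H.core.deg_eq, ?_,
        H.core.acyclic⟩, H.nodup_roots, H.mem_roots, H.table_eq⟩, trivial, by omega⟩
      intro q j
      refine le_trans (Finset.card_le_card ?_) (H.core.few q j)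
      intro c hc
      simp only [Finset.mem_filter, children] at hc ⊢
      refine ⟨hc.1, ?_⟩
      have hcy : c ≠ y := by
        rintro rfl
        simp [hp] at hc
      simpa [hcy] using hc.2
    | some z =>
      obtain ⟨hyS, hzS⟩ := H.core.mem_of_parent _ _ hp
      by_cases hm : h.mark y
      · simp only [hm, if_true, spec_tick]
        have hpot := pot_cut (a := 5) hyS hp
        simp only [hm, if_true] at hpot
        refine (ih (h.cut y z) z (H.cut hp ?_) ?_).mono fun h' k h'' => ⟨h''.1, h''.2.1, ?_⟩
        · intro c hc
          by_cases hcz : c = z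
          · subst hcz; simp [hc]
          · simp [hc, hcz]
        -- Each cascading cut removes a mark, so the number of marked items bounds the depth of the
        -- recursion.
        · have h2 : S.filter (fun x => (h.cut y z).mark x = true) =
              (S.filter (fun x => h.mark x = true)).erase y := by
            ext c
            simp only [FibHeap.cut, Function.update_apply, Finset.mem_filter, Finset.mem_erase]
            by_cases h1 : c = y <;> simp [h1]
          rw [h2]
          have hmem : y ∈ S.filter (fun x => h.mark x = true) := by simp [hyS, hm]
          have := Finset.card_erase_lt_of_mem hmem
          omega
        · omega
      · simp only [hm, spec_tick]
        refine ⟨⟨⟨H.core.mem_of_parent, H.core.key_le, H.core.mem_kids, H.core.deg_eq, ?_,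
          H.core.acyclic⟩, H.nodup_roots, H.mem_roots, H.table_eq⟩, rfl, ?_⟩
        · intro q j
          refine le_trans (Finset.card_le_card ?_) (H.core.few q j)
          intro c hc
          simp only [Finset.mem_filter, children, Function.update_apply] at hc ⊢
          refine ⟨hc.1, ?_⟩
          by_cases hcy : c = y
          · subst hcy; simpa [hm] using hc.2
          · simpa [hcy] using hc.2
        · have h2 : S.filter (fun x => Function.update h.mark y true x = true) =
              insert y (S.filter (fun x => h.mark x = true)) := by
            ext c
            simp only [Function.update_apply, Finset.mem_filter, Finset.mem_insert]
            by_cases h1 : c = y <;> simp [h1, hyS]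
          simp only [pot, h2]
          have := Finset.card_insert_le y (S.filter (fun x => h.mark x = true))
          omega

/-- 13 is 1 for the step, 5 for the new root and 7 for the cascade. -/
theorem spec_decreaseKey {S : Finset V} {fuel : ℕ} {h : FibHeap V} (H : h.Inv S 0)
    (hf : S.card < fuel) {x : V} {k : WithTop ℝ} (hk : k ≤ h.key x) :
    Spec (decreaseKey fuel h x k) (fun h' t => h'.Inv S 0 ∧
      h'.key = Function.update h.key x k ∧ t + pot 5 h' S ≤ pot 5 h S + 13) := by
  unfold decreaseKey
  cases hp : h.parent x with
  | none =>
    simp only [hp, spec_tick, spec_ret]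
    exact ⟨H.setKey hk (by simp [hp]), trivial, by simp [pot]; omega⟩
  | some p =>
    have hpx := (H.core.parent_ne hp).symm
    obtain ⟨hxS, hpS⟩ := H.core.mem_of_parent _ _ hp
    simp only [hp, Function.update_apply, if_neg hpx]
    by_cases hlt : k < h.key p
    · simp only [hlt, if_true, spec_tick]
      have H1 : Inv (h.cut x p) S (Pi.single p 1) := H.cut hp (by
        intro c _
        by_cases hcp : c = p
        · subst hcp; simp
        · simp [hcp])
      have H2 := H1.setKey (x := x) (k := k) hk (by simp [FibHeap.cut])
      refine (spec_cascade fuel _ p H2 ?_).mono fun h' t h'' => ⟨h''.1, h''.2.1, ?_⟩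
      · exact lt_of_le_of_lt (Finset.card_filter_le _ _) hf
      · have h1 := pot_cut (a := 5) hxS hp
        have h2 : t + pot 5 h' S ≤ pot 5 (h.cut x p) S + 7 := h''.2.2
        omega
    · simp only [hlt, if_false, spec_tick, spec_ret]
      refine ⟨H.setKey hk ?_, trivial, by simp [pot]; omega⟩
      intro q hq
      rw [hp] at hq
      cases hq
      exact not_lt.1 hlt

/-- The equality of degrees preserves `few`: the new child has as many children as `p` had. So
either it is not counted, because `j` is at most that number, or all children of `p` together number
at most `j`. The other degrees and marks that change belong to roots, which occur among nobody's
children. -/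
theorem Core.link {h : FibHeap V} {S : Finset V} (H : h.Core S 0) {c p : V} (hcS : c ∈ S)
    (hpS : p ∈ S) (hcp : c ≠ p) (hc : h.parent c = none) (hp : h.parent p = none)
    (hdeg : h.deg c = h.deg p) (hkey : h.key p ≤ h.key c) : Core (h.link c p) S 0 := by
  have hpar : ∀ d q, (h.link c p).parent d = some q → (d = c ∧ q = p) ∨
      (d ≠ c ∧ d ≠ p ∧ h.parent d = some q) := by
    intro d q hd
    simp only [FibHeap.link, Function.update_apply] at hd
    split_ifs at hd with h1
    · cases hd; exact Or.inl ⟨h1, rfl⟩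
    · refine Or.inr ⟨h1, ?_, hd⟩
      rintro rfl
      simp [hp] at hd
  have hcp' : c ∉ h.children S p := by simp [children, hc]
  have hch : ∀ q, (h.link c p).children S q =
      if q = p then insert c (h.children S p) else h.children S q := by
    intro q
    split_ifs with hq
    · subst hq
      ext d
      simp only [children, FibHeap.link, Function.update_apply, Finset.mem_filter,
        Finset.mem_insert]
      by_cases h1 : d = c <;> simp [h1, hcS]
    · ext d
      simp only [children, FibHeap.link, Function.update_apply, Finset.mem_filter]
      by_cases h1 : d = c
      · subst h1; simp [hc, Ne.symm hq]
      · simp [h1]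
  constructor
  · intro d q hd
    rcases hpar d q hd with ⟨rfl, rfl⟩ | ⟨_, _, h3⟩
    · exact ⟨hcS, hpS⟩
    · exact H.mem_of_parent _ _ h3
  · intro d q hd
    rcases hpar d q hd with ⟨rfl, rfl⟩ | ⟨_, _, h3⟩
    · exact hkey
    · exact H.key_le _ _ h3
  · intro d q hd
    simp only [FibHeap.link, Function.update_apply]
    rcases hpar d q hd with ⟨rfl, rfl⟩ | ⟨_, _, h3⟩
    · simp
    · have := H.mem_kids _ _ h3
      split_ifs with h4
      · subst h4; exact List.mem_cons_of_mem _ this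
      · exact this
  · intro q hq
    rw [hch]
    simp only [FibHeap.link, Function.update_apply]
    split_ifs with h1
    · rw [Finset.card_insert_of_notMem hcp', H.deg_eq p hpS]
    · exact H.deg_eq q hq
  · intro q j
    rw [hch]
    have hm : ∀ d, d ≠ c → d ≠ p → (h.link c p).deg d + (if (h.link c p).mark d then 1 else 0) =
        h.deg d + (if h.mark d then 1 else 0) := by
      intro d h1 h2
      simp [FibHeap.link, h1, h2]
    have hne : ∀ d r, d ∈ h.children S r → d ≠ c ∧ d ≠ p := by
      intro d r hd
      simp only [children, Finset.mem_filter] at hd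
      constructor
      · rintro rfl; simp [hc] at hd
      · rintro rfl; simp [hp] at hd
    split_ifs with h1
    · subst h1
      by_cases hj : j ≤ h.deg c
      · refine le_trans (Finset.card_le_card ?_) (H.few q j)
        intro d hd
        simp only [Finset.mem_filter, Finset.mem_insert] at hd ⊢
        obtain ⟨h1 | h1, h2⟩ := hd
        · subst h1
          simp only [FibHeap.link, Function.update_apply, if_neg hcp] at h2
          omega
        · rw [hm d (hne _ _ h1).1 (hne _ _ h1).2] at h2
          exact ⟨h1, h2⟩
      · refine le_trans (Finset.card_filter_le _ _) ?_
        rw [Finset.card_insert_of_notMem hcp', ← H.deg_eq q hpS]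
        omega
    · refine le_trans (Finset.card_le_card ?_) (H.few q j)
      intro d hd
      simp only [Finset.mem_filter] at hd ⊢
      rw [hm d (hne _ _ hd.1).1 (hne _ _ hd.1).2] at hd
      exact hd
  · obtain ⟨rank, hr⟩ := H.acyclic
    -- Raising the rank of `p` is harmless because `p` is a root.
    refine ⟨Function.update rank p (max (rank p) (rank c + 1)), fun d q hd => ?_⟩
    rcases hpar d q hd with ⟨rfl, rfl⟩ | ⟨_, h2, h3⟩
    · simp [hcp]
    · have := hr _ _ h3
      simp only [Function.update_apply, if_neg h2]
      split_ifs with h4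
      · subst h4; exact lt_of_lt_of_le this (le_max_left _ _)
      · exact this

/-- One root fewer releases `a`, and the new entry in `kids p` costs 1. -/
theorem pot_link {a : ℕ} {h : FibHeap V} {S : Finset V} {c p : V} (hcS : c ∈ S) (hpS : p ∈ S)
    (hc : h.parent c = none) :
    pot a (h.link c p) S + a ≤ pot a h S + 1 := by
  have h1 : S.filter (fun y => (h.link c p).parent y = none) =
      (S.filter (fun y => h.parent y = none)).erase c := by
    ext d
    simp only [FibHeap.link, Function.update_apply, Finset.mem_filter, Finset.mem_erase]
    by_cases h1 : d = c <;> simp [h1]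
  have h2 : S.filter (fun y => (h.link c p).mark y = true) ⊆
      S.filter (fun y => h.mark y = true) := by
    intro d
    simp only [FibHeap.link, Function.update_apply, Finset.mem_filter]
    by_cases h1 : d = c <;> simp [h1]
  have h3 : ∑ x ∈ S, ((h.link c p).kids x).length = ∑ x ∈ S, (h.kids x).length + 1 := by
    rw [← Finset.add_sum_erase _ _ hpS, ← Finset.add_sum_erase _ (fun x => (h.kids x).length) hpS]
    have : ∑ x ∈ S.erase p, ((h.link c p).kids x).length =
        ∑ x ∈ S.erase p, (h.kids x).length := by
      refine Finset.sum_congr rfl fun x hx => ?_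
      simp [FibHeap.link, (Finset.mem_erase.1 hx).1]
    rw [this]
    simp [FibHeap.link]
    ring
  have h4 := Finset.card_le_card h2
  have hmem : c ∈ S.filter (fun y => h.parent y = none) := by simp [hcS, hc]
  have h5 := Finset.card_erase_add_one hmem
  simp only [pot, h1, h3]
  rw [← h5]
  nlinarith

end FibHeap

namespace FibHeap
open Prog

variable {V : Type} [DecidableEq V]

/-! ### Removing the minimum -/

/-- The invariants while the roots in `U` have not yet been entered into the table. -/
structure Cons (h : FibHeap V) (S : Finset V) (U : List V) : Prop where
  core : h.Core S 0
  nodup : U.Nodup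
  mem_U : ∀ y ∈ U, y ∈ S ∧ h.parent y = none
  table_some : ∀ d s, h.table d = some s → s ∈ S ∧ h.parent s = none ∧ h.deg s = d ∧ s ∉ U
  complete : ∀ y ∈ S, h.parent y = none → y ∈ U ∨ h.table (h.deg y) = some y

theorem Cons.perm {h : FibHeap V} {S : Finset V} {U U' : List V} (H : h.Cons S U)
    (hU : U.Perm U') : h.Cons S U' where
  core := H.core
  nodup := hU.nodup_iff.1 H.nodup
  mem_U y hy := H.mem_U y (hU.mem_iff.2 hy)
  table_some d s hs := by simpa only [hU.mem_iff] using H.table_some d s hs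
  complete y hy hp := by simpa only [hU.mem_iff] using H.complete y hy hp

theorem Core.setTable {h : FibHeap V} {S : Finset V} {e : V → ℕ} (H : h.Core S e)
    (t : ℕ → Option V) : Core { h with table := t } S e :=
  ⟨H.mem_of_parent, H.key_le, H.mem_kids, H.deg_eq, H.few, H.acyclic⟩

theorem Cons.clear {h : FibHeap V} {S : Finset V} {U : List V} (H : h.Cons S U) {d : ℕ} {s : V}
    (hs : h.table d = some s) :
    Cons { h with table := Function.update h.table d none } S (s :: U) := by
  obtain ⟨hsS, hsp, hsd, hsU⟩ := H.table_some d s hs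
  refine ⟨H.core.setTable _, List.nodup_cons.2 ⟨hsU, H.nodup⟩, ?_, ?_, ?_⟩
  · intro y hy
    rcases List.mem_cons.1 hy with rfl | hy
    · exact ⟨hsS, hsp⟩
    · exact H.mem_U y hy
  · intro d' t ht
    simp only [Function.update_apply] at ht
    split_ifs at ht with h1
    obtain ⟨a, b, c, e⟩ := H.table_some d' t ht
    refine ⟨a, b, c, ?_⟩
    rw [List.mem_cons]
    rintro (rfl | h2)
    · exact h1 (c.symm.trans hsd)
    · exact e h2
  · intro y hy hyp
    rw [List.mem_cons]
    simp only [Function.update_apply]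
    rcases H.complete y hy hyp with h1 | h1
    · exact Or.inl (Or.inr h1)
    · by_cases h2 : h.deg y = d
      · rw [h2, hs] at h1
        exact Or.inl (Or.inl (Option.some_injective _ h1).symm)
      · right; rw [if_neg h2]; exact h1

theorem Cons.link {h : FibHeap V} {S : Finset V} {U : List V} {c p : V}
    (H : h.Cons S (p :: c :: U)) (hdeg : h.deg c = h.deg p) (hkey : h.key p ≤ h.key c) :
    Cons (h.link c p) S (p :: U) := by
  have hnd := H.nodup
  simp only [List.nodup_cons, List.mem_cons, not_or] at hnd
  obtain ⟨⟨hpc, hpU⟩, hcU, hU⟩ := hnd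
  obtain ⟨hpS, hpp⟩ := H.mem_U p (by simp)
  obtain ⟨hcS, hcp⟩ := H.mem_U c (by simp)
  refine ⟨H.core.link hcS hpS (Ne.symm hpc) hcp hpp hdeg hkey, List.nodup_cons.2 ⟨hpU, hU⟩,
    ?_, ?_, ?_⟩
  · intro y hy
    have hyc : y ≠ c := by
      rintro rfl
      rcases List.mem_cons.1 hy with h1 | h1
      · exact hpc h1.symm
      · exact hcU h1
    have := H.mem_U y (by
      rcases List.mem_cons.1 hy with h1 | h1
      · simp [h1]
      · simp [h1])
    simpa [FibHeap.link, hyc] using this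
  · intro d s hs
    obtain ⟨h1, h2, h3, h4⟩ := H.table_some d s hs
    simp only [List.mem_cons, not_or] at h4
    simp only [FibHeap.link, Function.update_apply, if_neg h4.1, if_neg h4.2.1, List.mem_cons,
      not_or]
    exact ⟨h1, h2, h3, h4.1, h4.2.2⟩
  · intro y hy hyp
    simp only [FibHeap.link, Function.update_apply] at hyp ⊢
    split_ifs at hyp with h1
    rcases H.complete y hy hyp with h2 | h2
    · simp only [List.mem_cons, h1, false_or] at h2
      exact Or.inl (List.mem_cons.2 h2)
    · by_cases h3 : y = p
      · exact Or.inl (by simp [h3])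
      · right; rw [if_neg h3]; exact h2

/-- With root weight 2 every link releases one unit, enough for its own step; the remaining 1 is the
final insertion. Each link also raises the degree of the root in hand, which stays below `3 * L`, so
the fuel suffices. -/
theorem spec_place {S : Finset V} {L : ℕ} (hL : S.card < 2 ^ L) {U : List V} (fuel : ℕ) :
    ∀ (h : FibHeap V) (r : V), h.Cons S (r :: U) → 3 * L < fuel + h.deg r →
    Spec (place fuel h r) (fun h' k =>
      h'.Cons S U ∧ h'.key = h.key ∧ (∀ y, h'.parent y = none → h.parent y = none) ∧
      k + pot 2 h' S ≤ pot 2 h S + 1) := by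
  induction fuel with
  | zero =>
    intro h r H hf
    have := H.core.deg_lt hL (H.mem_U r (by simp)).1
    omega
  | succ fuel ih =>
    intro h r H hf
    obtain ⟨hrS, hrp⟩ := H.mem_U r (by simp)
    unfold place
    cases ht : h.table (h.deg r) with
    | none =>
      simp only [spec_tick, spec_ret]
      refine ⟨⟨H.core.setTable _, (List.nodup_cons.1 H.nodup).2,
        fun y hy => H.mem_U y (List.mem_cons_of_mem _ hy), ?_, ?_⟩, trivial, fun _ h => h, by simp [pot]; omega⟩
      · intro d s hs
        simp only [Function.update_apply] at hs
        split_ifs at hs with h1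
        · cases hs
          exact ⟨hrS, hrp, h1.symm, (List.nodup_cons.1 H.nodup).1⟩
        · obtain ⟨a, b, c, e⟩ := H.table_some d s hs
          exact ⟨a, b, c, fun h2 => e (List.mem_cons_of_mem _ h2)⟩
      · intro y hy hyp
        simp only [Function.update_apply]
        rcases H.complete y hy hyp with h1 | h1
        · rcases List.mem_cons.1 h1 with rfl | h1
          · right; simp
          · exact Or.inl h1
        · right
          split_ifs with h2
          · rw [h2, ht] at h1; cases h1
          · exact h1
    | some s =>
      have H1 := H.clear ht
      obtain ⟨hsS, hsp, hsd, _⟩ := H.table_some _ _ ht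
      have hne : r ≠ s := by
        rintro rfl
        have := H1.nodup
        simp at this
      by_cases hk : h.key r ≤ h.key s
      · simp only [hk, if_true, spec_tick]
        have H2 := (H1.perm (List.Perm.swap r s U)).link hsd hk
        refine (ih _ r H2 ?_).mono fun h' k h'' => ⟨h''.1, h''.2.1, fun y hy => ?_, ?_⟩
        · simp [FibHeap.link]; omega
        · have := h''.2.2.1 y hy
          simp only [FibHeap.link, Function.update_apply] at this
          split_ifs at this
          exact this
        · have h1 := pot_link (a := 2) (p := r)
            (h := { h with table := Function.update h.table (h.deg r) none }) hsS hrS hsp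
          have h2 : pot 2 { h with table := Function.update h.table (h.deg r) none } S =
            pot 2 h S := rfl
          have h3 := h''.2.2.2
          rw [h2] at h1
          omega
      · simp only [hk, if_false, spec_tick]
        have H2 := H1.link hsd.symm (not_le.1 hk).le
        refine (ih _ s H2 ?_).mono fun h' k h'' => ⟨h''.1, h''.2.1, fun y hy => ?_, ?_⟩
        · simp [FibHeap.link]; omega
        · have := h''.2.2.1 y hy
          simp only [FibHeap.link, Function.update_apply] at this
          split_ifs at this
          exact this
        · have h1 := pot_link (a := 2) (p := s)
            (h := { h with table := Function.update h.table (h.deg r) none }) hrS hsS hrp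
          have h2 : pot 2 { h with table := Function.update h.table (h.deg r) none } S =
            pot 2 h S := rfl
          have h3 := h''.2.2.2
          rw [h2] at h1
          omega

theorem Core.setRoots {h : FibHeap V} {S : Finset V} {e : V → ℕ} (H : h.Core S e)
    (t : ℕ → Option V) (l : List V) : Core { h with table := t, roots := l } S e :=
  ⟨H.mem_of_parent, H.key_le, H.mem_kids, H.deg_eq, H.few, H.acyclic⟩

/-- Lowering the root weight from 5 to 2 releases 3 units per old root: two for the first loop and
one for the second. Restoring the weight costs 3 for each of the at most `3 * L` final roots, hence
`9 * L`. -/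
theorem spec_consolidate {S : Finset V} {L : ℕ} (hL : S.card < 2 ^ L) {fuel : ℕ}
    (hf : 3 * L < fuel) {h : FibHeap V} (H : h.Inv S 0) :
    Spec (consolidate fuel h) (fun h' k => h'.Inv S 0 ∧ h'.key = h.key ∧
      h'.roots.length ≤ 3 * L ∧ k + pot 5 h' S ≤ pot 5 h S + 9 * L) := by
  have hR : S.filter (fun x => h.parent x = none) = h.roots.toFinset := by
    ext x; simp [H.mem_roots]
  have hRc : (S.filter (fun x => h.parent x = none)).card = h.roots.length := by
    rw [hR, List.toFinset_card_of_nodup H.nodup_roots]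
  have hpot : ∀ g : FibHeap V, pot 5 g S =
      pot 2 g S + 3 * (S.filter (fun x => g.parent x = none)).card := by
    intro g; simp only [pot]; ring
  unfold consolidate
  rw [spec_bind]
  have H0 : h.Cons S h.roots := ⟨H.core, H.nodup_roots, fun y hy => (H.mem_roots y).1 hy,
    fun d s hs => by simp [H.table_eq] at hs, fun y hy hp => Or.inl ((H.mem_roots y).2 ⟨hy, hp⟩)⟩
  refine (spec_loop (fun r g k => g.Cons S r ∧ g.key = h.key ∧
      (∀ y ∈ S, g.parent y = none → y ∈ h.roots) ∧
      k + pot 2 g S + 2 * r.length ≤ pot 2 h S + 2 * h.roots.length) ?_ ?_).mono ?_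
  · exact ⟨H0, rfl, fun y hy hp => (H.mem_roots y).2 ⟨hy, hp⟩, by omega⟩
  · rintro a r g k ⟨Hg, hgk, hgr, hgp⟩
    refine (spec_place hL fuel g a Hg (by omega)).mono ?_
    rintro g' j ⟨h1, h2, h3, h4⟩
    refine ⟨h1, h2.trans hgk, fun y hy hp => hgr y hy (h3 y hp), ?_⟩
    simp only [List.length_cons] at hgp
    omega
  rintro g k ⟨Hg, hgk, hgr, hgp⟩
  have hgt : ∀ d s, g.table d = some s → s ∈ h.roots := fun d s hs =>
    hgr s (Hg.table_some d s hs).1 (Hg.table_some d s hs).2.1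
  -- The table is cleared by walking along the old roots: an occupied cell always holds a root that
  -- is still to be visited.
  refine (spec_loop (fun r g' j =>
      g'.key = g.key ∧ g'.parent = g.parent ∧ g'.kids = g.kids ∧ g'.deg = g.deg ∧
      g'.mark = g.mark ∧ (∀ d, g'.table d = none ∨
        (g'.table d = g.table d ∧ ∀ s, g.table d = some s → s ∈ r)) ∧
      (∀ y, y ∈ g'.roots ↔ y ∉ r ∧ y ∈ S ∧ g.parent y = none) ∧
      g'.roots.Nodup ∧ r.Nodup ∧ (∀ y ∈ r, y ∈ S) ∧ j + r.length = h.roots.length) ?_ ?_).mono ?_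
  · refine ⟨rfl, rfl, rfl, rfl, rfl, fun d => Or.inr ⟨rfl, hgt d⟩, fun y => ?_, List.nodup_nil,
      H.nodup_roots, fun y hy => ((H.mem_roots y).1 hy).1, by omega⟩
    simp only [List.not_mem_nil, false_iff, not_and]
    intro h1 h2 h3
    exact h1 (hgr y h2 h3)
  · rintro a r g' j ⟨e1, e2, e3, e4, e5, h6, h7, h8, h9, h10, h11⟩
    obtain ⟨har, hr⟩ := List.nodup_cons.1 h9
    simp only [List.length_cons] at h11
    rw [spec_ret]
    by_cases hp : g.parent a = none
    · simp only [e2, hp, Option.isNone_none, if_true, e4]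
      refine ⟨e1, trivial, e3, trivial, e5, fun d => ?_, fun y => ?_, ?_, hr,
        fun y hy => h10 y (List.mem_cons_of_mem _ hy), by omega⟩
      · simp only [Function.update_apply]
        by_cases hd : d = g.deg a
        · simp [hd]
        · rw [if_neg hd]
          rcases h6 d with h12 | ⟨h12, h13⟩
          · exact Or.inl h12
          · refine Or.inr ⟨h12, fun s hs => ?_⟩
            rcases List.mem_cons.1 (h13 s hs) with rfl | h14
            · exact absurd (Hg.table_some d s hs).2.2.1.symm hd
            · exact h14
      · rw [List.mem_cons, h7, List.mem_cons, not_or]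
        constructor
        · rintro (rfl | ⟨⟨h12, h13⟩, h14⟩)
          · exact ⟨har, h10 y (by simp), hp⟩
          · exact ⟨h13, h14⟩
        · rintro ⟨h12, h13⟩
          by_cases hya : y = a
          · exact Or.inl hya
          · exact Or.inr ⟨⟨hya, h12⟩, h13⟩
      · rw [List.nodup_cons, h7]
        exact ⟨fun h12 => h12.1 (by simp), h8⟩
    · have hp' : (g.parent a).isNone = false := by
        simpa [Option.isSome_iff_ne_none] using hp
      simp only [e2, hp', Bool.false_eq_true, if_false]
      refine ⟨e1, trivial, e3, e4, e5, fun d => ?_, fun y => ?_, h8, hr,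
        fun y hy => h10 y (List.mem_cons_of_mem _ hy), by omega⟩
      · rcases h6 d with h12 | ⟨h12, h13⟩
        · exact Or.inl h12
        · refine Or.inr ⟨h12, fun s hs => ?_⟩
          rcases List.mem_cons.1 (h13 s hs) with rfl | h14
          · exact absurd (Hg.table_some d s hs).2.1 hp
          · exact h14
      · rw [h7, List.mem_cons, not_or]
        constructor
        · rintro ⟨⟨_, h12⟩, h13⟩
          exact ⟨h12, h13⟩
        · rintro ⟨h12, h13⟩
          refine ⟨⟨?_, h12⟩, h13⟩
          rintro rfl
          exact hp h13.2
  · rintro g' j ⟨e1, e2, e3, e4, e5, h6, h7, h8, -, -, h11⟩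
    obtain ⟨key, parent, kids, deg, mark, table, roots⟩ := g'
    simp only at e1 e2 e3 e4 e5 h6 h7 h8
    subst e1 e2 e3 e4 e5
    have h7' : ∀ y, y ∈ roots ↔ y ∈ S ∧ g.parent y = none := by simpa using h7
    have hRs : S.filter (fun x => g.parent x = none) = roots.toFinset := by
      ext x; simp [h7']
    have hRc' : (S.filter (fun x => g.parent x = none)).card = roots.length := by
      rw [hRs, List.toFinset_card_of_nodup h8]
    -- Each final root sits in the cell of its degree, so the degrees are distinct, and all are
    -- below `3 * L`.
    have hlen : roots.length ≤ 3 * L := by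
      rw [← hRc']
      have := Finset.card_le_card_of_injOn (s := S.filter (fun x => g.parent x = none))
        (t := Finset.range (3 * L)) g.deg ?_ ?_
      · simpa using this
      · intro x hx
        simp only [Finset.coe_filter, Set.mem_ofPred_eq] at hx
        simpa using Hg.core.deg_lt hL hx.1
      · intro x hx y hy hxy
        simp only [Finset.coe_filter, Set.mem_ofPred_eq] at hx hy
        have h12 := (Hg.complete x hx.1 hx.2).resolve_left (by simp)
        have h13 := (Hg.complete y hy.1 hy.2).resolve_left (by simp)
        rw [hxy, h13] at h12
        exact (Option.some_injective _ h12).symm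
    refine ⟨⟨Hg.core.setRoots _ _, h8, h7', fun d => ?_⟩, hgk, hlen, ?_⟩
    · rcases h6 d with h12 | ⟨h12, h13⟩
      · exact h12
      · simp only
        rw [h12]
        cases h14 : g.table d with
        | none => rfl
        | some s => exact absurd (h13 s h14) (by simp)
    · have h12 := hpot g
      have h13 := hpot h
      have h14 : pot 5 (FibHeap.mk g.key g.parent g.kids g.deg g.mark table roots) S =
        pot 5 g S := rfl
      simp only [List.length_nil] at hgp h11
      rw [h14]
      omega

theorem spec_init {items : List V} (hn : items.Nodup) :
    Spec (init items) (fun h k => h.Inv items.toFinset 0 ∧ (h.key = fun _ => ⊤) ∧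
      k + pot 5 h items.toFinset ≤ 12 * items.length + 1) := by
  simp only [init, spec_bind, spec_charge, spec_ret]
  refine ⟨⟨⟨by simp, by simp, by simp, by simp [children], by simp [children],
    ⟨fun _ => 0, by simp⟩⟩, hn, by simp, by simp⟩, trivial, ?_⟩
  simp [pot]
  rw [List.toFinset_card_of_nodup hn]
  omega

/-- The `30 * L` consists of `9 * L` for consolidation, two passes over at most `3 * L` roots, and
weight 5 for each of the fewer than `3 * L` children that become roots. The scan of `kids x`, stale
entries included, is paid by the potential of that list. -/
theorem spec_popMin {S : Finset V} {L : ℕ} (hL : S.card < 2 ^ L) {fuel : ℕ}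
    (hf : 3 * L < fuel) {h : FibHeap V} (H : h.Inv S 0) :
    Spec (popMin fuel h) (fun o k =>
      (S = ∅ ∧ o = none ∧ k ≤ pot 5 h S + 9 * L + 1) ∨
      ∃ x h', o = some (x, h') ∧ x ∈ S ∧ (∀ y ∈ S, h.key x ≤ h.key y) ∧
        h'.Inv (S.erase x) 0 ∧ h'.key = h.key ∧
        k + pot 5 h' (S.erase x) ≤ pot 5 h S + 30 * L + 1) := by
  unfold popMin
  rw [spec_bind]
  refine (spec_consolidate hL hf H).mono ?_
  rintro h₁ k ⟨H₁, hkey, hlen, hk⟩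
  rw [spec_bind, spec_charge]
  cases harg : h₁.roots.argmin h₁.key with
  | none =>
    rw [List.argmin_eq_none] at harg
    simp only [spec_ret]
    have hS : S = ∅ := by
      rw [Finset.eq_empty_iff_forall_notMem]
      intro y hy
      obtain ⟨r, hr, hrp, _⟩ := H₁.core.exists_root hy
      have := (H₁.mem_roots r).2 ⟨hr, hrp⟩
      simp [harg] at this
    refine Or.inl ⟨hS, trivial, ?_⟩
    simp [harg]
    omega
  | some x =>
    have hxr := List.argmin_mem harg
    obtain ⟨hxS, hxp⟩ := (H₁.mem_roots x).1 hxr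
    have hmin : ∀ y ∈ S, h.key x ≤ h.key y := by
      intro y hy
      obtain ⟨r, hr, hrp, hrk⟩ := H₁.core.exists_root hy
      have := List.le_of_mem_argmin ((H₁.mem_roots r).2 ⟨hr, hrp⟩) harg
      rw [← hkey]
      exact this.trans hrk
    simp only [spec_bind, spec_select, spec_ret]
    -- Entries of `kids x` may have been cut earlier; only those still pointing to `x` are released,
    -- and all such children appear in the list.
    refine (spec_loop (fun r g j => g.key = h₁.key ∧ g.deg = h₁.deg ∧ g.mark = h₁.mark ∧
      g.kids = h₁.kids ∧ g.table = h₁.table ∧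
      (∀ c, g.parent c = h₁.parent c ∨ (h₁.parent c = some x ∧ g.parent c = none)) ∧
      (∀ c, g.parent c = some x → c ∈ r) ∧ g.roots.Nodup ∧
      (∀ y, y ∈ g.roots ↔ y ∈ S.erase x ∧ g.parent y = none) ∧
      j + r.length = (h₁.kids x).length) ?_ ?_).mono ?_
    · refine ⟨rfl, rfl, rfl, rfl, rfl, fun c => Or.inl rfl, fun c hc => H₁.core.mem_kids _ _ hc,
        H₁.nodup_roots.filter _, fun y => ?_, by omega⟩
      simp [H₁.mem_roots]
      tauto
    · rintro c r g j ⟨e1, e2, e3, e4, e5, h6, h7, h8, h9, h10⟩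
      simp only [List.length_cons] at h10
      rw [spec_ret]
      by_cases hc : g.parent c = some x
      · simp only [hc, if_true]
        have hc1 : h₁.parent c = some x := by
          rcases h6 c with h11 | h11
          · rw [← h11]; exact hc
          · exact h11.1
        refine ⟨e1, e2, e3, e4, e5, fun d => ?_, fun d hd => ?_, ?_, fun y => ?_, by omega⟩
        · simp only [Function.update_apply]
          split_ifs with h11
          · subst h11; exact Or.inr ⟨hc1, rfl⟩
          · exact h6 d
        · simp only [Function.update_apply] at hd
          split_ifs at hd with h11
          exact (List.mem_cons.1 (h7 d hd)).resolve_left h11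
        · rw [List.nodup_cons, h9]
          exact ⟨by simp [hc], h8⟩
        · simp only [List.mem_cons, h9, Function.update_apply]
          have h12 := (H₁.core.mem_of_parent _ _ hc1).1
          have h13 := H₁.core.parent_ne hc1
          by_cases h11 : y = c
          · subst h11; simp [h12, h13]
          · simp [h11]
      · simp only [hc, if_false]
        refine ⟨e1, e2, e3, e4, e5, h6, fun d hd => ?_, h8, h9, by omega⟩
        refine (List.mem_cons.1 (h7 d hd)).resolve_left ?_
        rintro rfl
        exact hc hd
    · rintro g j ⟨e1, e2, e3, e4, e5, h6, h7, h8, h9, h10⟩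
      right
      have hpar : ∀ c p, g.parent c = some p → p ≠ x ∧ h₁.parent c = some p := by
        intro c p hc
        have h11 : p ≠ x := by
          rintro rfl
          simpa using h7 c hc
        refine ⟨h11, ?_⟩
        rcases h6 c with h12 | h12
        · rw [← h12]; exact hc
        · rw [h12.2] at hc; cases hc
      have hpar' : ∀ c p, p ≠ x → h₁.parent c = some p → g.parent c = some p := by
        intro c p hp hc
        rcases h6 c with h12 | h12
        · rw [h12]; exact hc
        · rw [h12.1] at hc; cases hc; exact absurd rfl hp
      have hcx : ∀ c p, h₁.parent c = some p → c ≠ x := by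
        rintro c p hc rfl
        rw [hxp] at hc; cases hc
      have hch : ∀ p, p ≠ x → g.children (S.erase x) p = h₁.children S p := by
        intro p hp
        ext c
        simp only [children, Finset.mem_filter, Finset.mem_erase]
        constructor
        · rintro ⟨⟨_, h11⟩, h12⟩
          exact ⟨h11, (hpar c p h12).2⟩
        · rintro ⟨h11, h12⟩
          exact ⟨⟨hcx _ _ h12, h11⟩, hpar' c p hp h12⟩
      have hchx : g.children (S.erase x) x = ∅ := by
        rw [Finset.eq_empty_iff_forall_notMem]
        intro c hc
        exact (hpar c x (Finset.mem_filter.1 hc).2).1 rfl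
      refine ⟨x, g, rfl, hxS, hmin, ⟨⟨?_, ?_, ?_, ?_, ?_, ?_⟩, h8, h9, ?_⟩, e1.trans hkey, ?_⟩
      · intro c p hc
        obtain ⟨h11, h12⟩ := hpar c p hc
        obtain ⟨h13, h14⟩ := H₁.core.mem_of_parent _ _ h12
        exact ⟨Finset.mem_erase.2 ⟨hcx _ _ h12, h13⟩, Finset.mem_erase.2 ⟨h11, h14⟩⟩
      · intro c p hc
        rw [e1]
        exact H₁.core.key_le _ _ (hpar c p hc).2
      · intro c p hc
        rw [e4]
        exact H₁.core.mem_kids _ _ (hpar c p hc).2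
      · intro p hp
        rw [e2, hch p (Finset.mem_erase.1 hp).1]
        exact H₁.core.deg_eq p (Finset.mem_erase.1 hp).2
      · intro p i
        by_cases hp : p = x
        · subst hp; simp [hchx]
        · rw [hch p hp, e2, e3]
          exact H₁.core.few p i
      · obtain ⟨rank, hr⟩ := H₁.core.acyclic
        exact ⟨rank, fun c p hc => hr _ _ (hpar c p hc).2⟩
      · intro d; rw [e5]; exact H₁.table_eq d
      · have hr1 : (S.erase x).filter (fun y => g.parent y = none) ⊆
            (S.filter (fun y => h₁.parent y = none)).erase x ∪ h₁.children S x := by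
          intro y hy
          simp only [Finset.mem_filter, Finset.mem_erase, Finset.mem_union, children] at hy ⊢
          rcases h6 y with h11 | h11
          · exact Or.inl ⟨hy.1.1, hy.1.2, h11 ▸ hy.2⟩
          · exact Or.inr ⟨hy.1.2, h11.1⟩
        have hr2 := (Finset.card_le_card hr1).trans (Finset.card_union_le _ _)
        rw [← H₁.core.deg_eq x hxS] at hr2
        have hr3 := H₁.core.deg_lt hL hxS
        have hr4 : ((S.filter (fun y => h₁.parent y = none)).erase x).card ≤
          (S.filter (fun y => h₁.parent y = none)).card := Finset.card_erase_le
        have hm : ((S.erase x).filter (fun y => g.mark y = true)).card ≤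
            (S.filter (fun y => h₁.mark y = true)).card := by
          rw [e3]
          exact Finset.card_le_card (Finset.filter_subset_filter _ (Finset.erase_subset _ _))
        have hkids := Finset.add_sum_erase S (fun y => (h₁.kids y).length) hxS
        simp only [pot, e4] at hk ⊢
        simp only [List.length_nil] at h10
        omega

end FibHeap

section

open Prog

variable {V : Type} [DecidableEq V]

/-! ### Walks -/

/-- There is an edge of length `c` between `x` and `y`. -/
def Net.Adj (N : Net V) (x y : V) (c : ℝ) : Prop := (x, y, c) ∈ N.edges ∨ (y, x, c) ∈ N.edges

omit [DecidableEq V] in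
theorem Net.Adj.symm {N : Net V} {x y : V} {c : ℝ} (h : N.Adj x y c) : N.Adj y x c := Or.symm h

/-- There is a walk of length `l` from `x` to `y`. -/
inductive Net.Walk (N : Net V) : V → V → ℝ → Prop
  | nil (x : V) : Net.Walk N x x 0
  | snoc {x y z : V} {l c : ℝ} : Net.Walk N x y l → N.Adj y z c → Net.Walk N x z (l + c)

/-- The vertices are distinct, the edges join vertices, and their lengths are positive. -/
structure Net.Valid (N : Net V) : Prop where
  nodup : N.verts.Nodup
  edge : ∀ e ∈ N.edges, e.1 ∈ N.verts ∧ e.2.1 ∈ N.verts ∧ 0 < e.2.2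

section

omit [DecidableEq V]

theorem Net.Valid.adj {N : Net V} (hN : N.Valid) {x y : V} {c : ℝ} (h : N.Adj x y c) :
    x ∈ N.verts ∧ y ∈ N.verts ∧ 0 < c := by
  rcases h with h | h
  · exact hN.edge _ h
  · exact ⟨(hN.edge _ h).2.1, (hN.edge _ h).1, (hN.edge _ h).2.2⟩

namespace Net.Walk

variable {N : Net V} {x y z : V} {l l' c : ℝ}

theorem trans (h : N.Walk x y l) (h' : N.Walk y z l') : N.Walk x z (l + l') := by
  induction h' with
  | nil => simpa using h
  | snoc _ h2 ih => rw [← add_assoc]; exact ih.snoc h2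

theorem single (h : N.Adj x y c) : N.Walk x y c := by
  simpa using (Net.Walk.nil x).snoc h

theorem symm (h : N.Walk x y l) : N.Walk y x l := by
  induction h with
  | nil => exact Net.Walk.nil _
  | snoc _ h2 ih => rw [add_comm]; exact (single h2.symm).trans ih

theorem nonneg (hN : N.Valid) (h : N.Walk x y l) : 0 ≤ l := by
  induction h with
  | nil => exact le_rfl
  | snoc _ h2 ih => exact add_nonneg ih (hN.adj h2).2.2.le

theorem mem_iff (hN : N.Valid) (h : N.Walk x y l) : x ∈ N.verts ↔ y ∈ N.verts := by
  induction h with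
  | nil => exact Iff.rfl
  | snoc _ h2 ih => exact ih.trans ⟨fun _ => (hN.adj h2).2.1, fun _ => (hN.adj h2).1⟩

theorem eq_or_pos (hN : N.Valid) (h : N.Walk x y l) : (x = y ∧ l = 0) ∨ 0 < l := by
  cases h with
  | nil => exact Or.inl ⟨rfl, rfl⟩
  | snoc h1 h2 => exact Or.inr (add_pos_of_nonneg_of_pos (h1.nonneg hN) (hN.adj h2).2.2)

theorem mono {N' : Net V} (hE : ∀ e ∈ N'.edges, e ∈ N.edges) (h : N'.Walk x y l) :
    N.Walk x y l := by
  induction h with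
  | nil => exact Net.Walk.nil _
  | snoc _ h2 ih => exact ih.snoc (h2.imp (hE _) (hE _))

end Net.Walk

end

/-! ### Dijkstra's algorithm -/

/-- The key of a terminal is its voltage, the key of a non-terminal is `∞`. -/
def initKey (v₀ : V → Option ℝ) (x : V) : WithTop ℝ := (v₀ x).elim ⊤ (fun a => (a : WithTop ℝ))

theorem sum_length_update_cons (S : Finset V) {β : Type} (a : V → List β) (x : V) (b : β) :
    ∑ y ∈ S, (Function.update a x (b :: a x) y).length ≤ ∑ y ∈ S, (a y).length + 1 := by
  have h1 : ∀ y, (Function.update a x (b :: a x) y).length =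
      (a y).length + if y = x then 1 else 0 := by
    intro y
    by_cases h : y = x
    · subst h; simp
    · simp [h]
  simp only [h1, Finset.sum_add_distrib]
  gcongr
  rw [Finset.sum_ite_eq']
  split_ifs <;> simp

theorem spec_adjacency (N : Net V) : Spec (adjacency N) (fun a k =>
    (∀ x y c, (y, c) ∈ a x ↔ N.Adj x y c) ∧
    ∑ x ∈ N.verts.toFinset, (a x).length ≤ 2 * N.edges.length ∧
    k = N.verts.length + N.edges.length) := by
  unfold adjacency
  simp only [spec_bind, spec_newArray]
  refine (spec_loop (fun r a k =>
    (∀ x y c, ((y, c) ∈ a x ∨ (x, y, c) ∈ r ∨ (y, x, c) ∈ r) ↔ N.Adj x y c) ∧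
    ∑ x ∈ N.verts.toFinset, (a x).length + 2 * r.length ≤ 2 * N.edges.length ∧
    k + r.length = N.edges.length) ?_ ?_).mono ?_
  · simp [Net.Adj]
  · rintro ⟨p, q, l⟩ r a k ⟨h1, h2, h3⟩
    simp only [List.length_cons] at h2 h3
    rw [spec_ret]
    refine ⟨fun x y c => ?_, ?_, by omega⟩
    · rw [← h1 x y c]
      simp only [Function.update_apply, List.mem_cons, Prod.mk.injEq]
      by_cases hxq : x = q <;> by_cases hxp : x = p <;> by_cases hqp : q = p <;>
        simp_all <;> tauto
    · have h4 := sum_length_update_cons N.verts.toFinset a p (q, l)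
      have h5 := sum_length_update_cons N.verts.toFinset
        (Function.update a p ((q, l) :: a p)) q (p, l)
      simp only at h4 h5 ⊢
      omega
  · rintro a k ⟨h1, h2, h3⟩
    refine ⟨by simpa using h1, by simpa using h2, ?_⟩
    simp at h3
    omega

/-- The invariants of Dijkstra's algorithm with the vertices in `A` in the heap; the edges in
`pending` have not been processed. -/
structure DInv (N : Net V) (v₀ : V → Option ℝ) (α : ℝ) (s : DState V) (A : Finset V)
    (pending : V → V → ℝ → Prop) : Prop where
  heap : s.heap.Inv A 0
  sub : A ⊆ N.verts.toFinset
  fin : ∀ x ∈ N.verts, s.finished x = true ↔ x ∉ A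
  value : ∀ x ∈ N.verts, x ∉ A → s.value x = s.heap.key x
  le_init : ∀ x ∈ N.verts, s.heap.key x ≤ initKey v₀ x
  mono : ∀ x ∈ N.verts, x ∉ A → ∀ y ∈ A, s.heap.key x ≤ s.heap.key y
  edge : ∀ x y c, N.Adj x y c → x ∉ A → ¬ pending x y c →
    s.heap.key y ≤ s.heap.key x + ((α * c : ℝ) : WithTop ℝ)
  ptr : ∀ y ∈ N.verts, (s.parent y = none ∧ s.heap.key y = initKey v₀ y) ∨
    ∃ z c, s.parent y = some z ∧ z ∉ A ∧ N.Adj z y c ∧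
      s.heap.key y = s.heap.key z + ((α * c : ℝ) : WithTop ℝ) ∧ s.heap.key y ≠ ⊤
  att : ∀ y ∈ N.verts, s.heap.key y ≠ ⊤ → ∃ t a l, v₀ t = some a ∧ N.Walk t y l ∧
    s.heap.key y = ((a + α * l : ℝ) : WithTop ℝ)

/-- `hmax` says that the vertex finished last has the largest finished key. A key lowered to that
value plus a nonnegative length thus stays above all finished keys. -/
theorem spec_relax {N : Net V} (hN : N.Valid) {v₀ : V → Option ℝ} {α : ℝ} (hα : 0 ≤ α)
    {s : DState V} {A : Finset V} {x : V} {y : V × ℝ} {r : List (V × ℝ)} {fuel : ℕ}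
    (H : DInv N v₀ α s A (fun x' y' c => x' = x ∧ (y', c) ∈ y :: r))
    (hx : x ∈ N.verts) (hxA : x ∉ A) (hmax : ∀ x' ∈ N.verts, x' ∉ A → s.heap.key x' ≤ s.heap.key x)
    (hxy : N.Adj x y.1 y.2) (hf : A.card < fuel) :
    Spec (relax fuel α x s y) (fun s' k =>
      DInv N v₀ α s' A (fun x' y' c => x' = x ∧ (y', c) ∈ r) ∧
      (∀ x', x' ∉ A → s'.heap.key x' = s.heap.key x') ∧
      k + s'.heap.pot 5 A ≤ s.heap.pot 5 A + 13) := by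
  obtain ⟨_, hyV, hc⟩ := hN.adj hxy
  have hαc : 0 ≤ α * y.2 := mul_nonneg hα hc.le
  have hval := H.value x hx hxA
  have hle : s.heap.key x ≤ s.heap.key x + ((α * y.2 : ℝ) : WithTop ℝ) :=
    le_add_of_nonneg_right (by exact_mod_cast hαc)
  unfold relax
  simp only [hval]
  split_ifs with hcond
  · obtain ⟨hfin, hlt⟩ := hcond
    have hyA : y.1 ∈ A := by
      by_contra h
      rw [(H.fin _ hyV).2 h] at hfin
      cases hfin
    rw [spec_bind]
    refine (FibHeap.spec_decreaseKey H.heap hf hlt.le).mono ?_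
    rintro h' k ⟨h1, h2, h3⟩
    rw [spec_ret]
    have hold : ∀ x', x' ∉ A → h'.key x' = s.heap.key x' := by
      intro x' hx'
      rw [h2, Function.update_of_ne]
      rintro rfl
      exact hx' hyA
    have hky : h'.key y.1 = s.heap.key x + ((α * y.2 : ℝ) : WithTop ℝ) := by simp [h2]
    have hkz : ∀ z, z ≠ y.1 → h'.key z = s.heap.key z := by
      intro z hz; rw [h2, Function.update_of_ne hz]
    have hkle : ∀ z, h'.key z ≤ s.heap.key z := by
      intro z
      by_cases hz : z = y.1
      · subst hz; rw [hky]; exact hlt.le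
      · rw [hkz z hz]
    refine ⟨⟨h1, H.sub, H.fin, fun z hz hzA => ?_, fun z hz => (hkle z).trans (H.le_init z hz),
      fun z hz hzA w hw => ?_, fun z w c hzw hzA hp => ?_, fun z hz => ?_, fun z hz hzt => ?_⟩,
      hold, by simpa using h3⟩
    · rw [H.value z hz hzA]; exact (hold z hzA).symm
    · rw [hold z hzA]
      by_cases hwy : w = y.1
      · subst hwy; rw [hky]; exact (hmax z hz hzA).trans hle
      · rw [hkz w hwy]; exact H.mono z hz hzA w hw
    · rw [hold z hzA]
      by_cases hzy : z = x ∧ w = y.1 ∧ c = y.2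
      · obtain ⟨rfl, rfl, rfl⟩ := hzy
        exact hky.le
      · refine (hkle w).trans (H.edge z w c hzw hzA ?_)
        rintro ⟨h4, h5⟩
        rcases List.mem_cons.1 h5 with h6 | h6
        · subst h4
          exact hzy ⟨rfl, by rw [← h6], by rw [← h6]⟩
        · exact hp ⟨h4, h6⟩
    · simp only [Function.update_apply]
      by_cases hzy : z = y.1
      · subst hzy
        rw [if_pos rfl]
        refine Or.inr ⟨x, y.2, rfl, hxA, hxy, ?_, ?_⟩
        · rw [hky, hold x hxA]
        · rw [hky]; exact hlt.ne_top
      · rw [if_neg hzy, hkz z hzy]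
        rcases H.ptr z hz with h4 | ⟨w, c, h4, h5, h6, h7, h8⟩
        · exact Or.inl h4
        · exact Or.inr ⟨w, c, h4, h5, h6, by rw [hold w h5]; exact h7, h8⟩
    · by_cases hzy : z = y.1
      · subst hzy
        have hxt : s.heap.key x ≠ ⊤ := by
          intro h4
          rw [h4] at hlt
          simp at hlt
        obtain ⟨t, a, l, h4, h5, h6⟩ := H.att x hx hxt
        refine ⟨t, a, l + y.2, h4, h5.snoc hxy, ?_⟩
        simp only
        rw [hky, h6, ← WithTop.coe_add]
        congr 1; ring
      · simp only [hkz z hzy] at hzt ⊢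
        exact H.att z hz hzt
  · rw [spec_ret]
    refine ⟨⟨H.heap, H.sub, H.fin, H.value, H.le_init, H.mono, fun z w c hzw hzA hp => ?_, H.ptr,
      H.att⟩, fun _ _ => rfl, by omega⟩
    by_cases hzy : z = x ∧ w = y.1 ∧ c = y.2
    · obtain ⟨rfl, rfl, rfl⟩ := hzy
      by_cases hyA : y.1 ∈ A
      · refine not_lt.1 fun h4 => hcond ⟨?_, h4⟩
        by_contra h5
        exact (H.fin _ hyV).1 (by simpa using h5) hyA
      -- A finished neighbour satisfies the edge inequality without being relaxed, since its key is
      -- at most that of `x`.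
      · exact (hmax _ hyV hyA).trans hle
    · refine H.edge z w c hzw hzA ?_
      rintro ⟨h4, h5⟩
      rcases List.mem_cons.1 h5 with h6 | h6
      · subst h4
        exact hzy ⟨rfl, by rw [← h6], by rw [← h6]⟩
      · exact hp ⟨h4, h6⟩

/-- Per vertex, `30 * L + 1` for the removal and 1 for the iteration; per adjacency entry, 13 for a
possible decrease and 1 for the loop. The last terms belong to the final call on the empty heap. -/
theorem spec_dijkstraLoop {N : Net V} (hN : N.Valid) {v₀ : V → Option ℝ} {α : ℝ} (hα : 0 ≤ α)
    {adj : V → List (V × ℝ)} (hadj : ∀ x y c, (y, c) ∈ adj x ↔ N.Adj x y c) {L : ℕ}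
    (fuel : ℕ) : ∀ (s : DState V) (A : Finset V), DInv N v₀ α s A (fun _ _ _ => False) →
    A.card < 2 ^ L → A.card + 3 * L + 1 < fuel →
    Spec (dijkstraLoop α adj fuel s) (fun s' k => DInv N v₀ α s' ∅ (fun _ _ _ => False) ∧
      k ≤ s.heap.pot 5 A + A.card * (30 * L + 2) + 14 * (∑ x ∈ A, (adj x).length) +
        9 * L + 2) := by
  induction fuel with
  | zero => intro s A _ _ hf; omega
  | succ fuel ih =>
    intro s A H hL hf
    unfold dijkstraLoop
    rw [spec_tick, spec_bind]
    refine (FibHeap.spec_popMin hL (by omega) H.heap).mono ?_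
    rintro o k (⟨hA, rfl, hk⟩ | ⟨x, h, rfl, hxA, hmin, hh, hkey, hk⟩)
    · subst hA
      simp only [spec_ret]
      exact ⟨H, by omega⟩
    simp only [spec_bind]
    have hxV : x ∈ N.verts := by simpa using H.sub hxA
    have hxA' : x ∉ A.erase x := by simp
    have hcard := Finset.card_erase_add_one hxA
    have hnot : ∀ z, z ∉ A.erase x → z = x ∨ z ∉ A := by
      intro z hz
      by_cases hzx : z = x
      · exact Or.inl hzx
      · exact Or.inr fun h1 => hz (Finset.mem_erase.2 ⟨hzx, h1⟩)
    refine (spec_loop (fun r s' j =>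
      DInv N v₀ α s' (A.erase x) (fun x' y' c => x' = x ∧ (y', c) ∈ r) ∧
      (∀ x' ∈ N.verts, x' ∉ A.erase x → s'.heap.key x' ≤ s'.heap.key x) ∧
      (∀ y ∈ r, N.Adj x y.1 y.2) ∧
      j + s'.heap.pot 5 (A.erase x) + 14 * r.length ≤
        h.pot 5 (A.erase x) + 14 * (adj x).length) ?_ ?_).mono ?_
    · refine ⟨⟨hh, (Finset.erase_subset _ _).trans H.sub, fun z hz => ?_, fun z hz hzA => ?_,
        fun z hz => ?_, fun z hz hzA y hy => ?_, fun z y c hzy hzA hp => ?_, fun z hz => ?_,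
        fun z hz => ?_⟩, fun z hz hzA => ?_, fun y hy => (hadj x y.1 y.2).1 hy, by simp⟩
      · simp only [Function.update_apply]
        by_cases hzx : z = x
        · simp [hzx]
        · simp [hzx, H.fin z hz]
      · simp only [Function.update_apply]
        split_ifs with hzx
        · rw [hzx]
        · rw [hkey]
          exact H.value z hz ((hnot z hzA).resolve_left hzx)
      · simp only [hkey]; exact H.le_init z hz
      · simp only [hkey]
        have hyA := (Finset.mem_erase.1 hy).2
        rcases hnot z hzA with rfl | h1
        · exact hmin y hyA
        · exact H.mono z hz h1 y hyA
      · simp only [hkey]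
        rcases hnot z hzA with rfl | h1
        · exact absurd ⟨rfl, (hadj _ _ _).2 hzy⟩ hp
        · exact H.edge z y c hzy h1 (fun h => h)
      · simp only [hkey]
        rcases H.ptr z hz with h1 | ⟨w, c, h4, h5, h6⟩
        · exact Or.inl h1
        · exact Or.inr ⟨w, c, h4, fun h7 => h5 (Finset.mem_erase.1 h7).2, h6⟩
      · simp only [hkey]; exact H.att z hz
      · simp only [hkey]
        rcases hnot z hzA with rfl | h1
        · exact le_rfl
        · exact H.mono z hz h1 x hxA
    · rintro y r s' j ⟨h1, h2, h3, h4⟩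
      refine (spec_relax hN hα h1 hxV hxA' h2 (h3 y (by simp)) (by omega)).mono ?_
      rintro s'' i ⟨h5, h6, h7⟩
      refine ⟨h5, fun z hz hzA => ?_, fun w hw => h3 w (List.mem_cons_of_mem _ hw), ?_⟩
      · rw [h6 z hzA, h6 x hxA']; exact h2 z hz hzA
      · simp only [List.length_cons] at h4; omega
    · rintro s' j ⟨h1, -, -, h4⟩
      have h1' : DInv N v₀ α s' (A.erase x) (fun _ _ _ => False) := by simpa using h1
      refine (ih s' _ h1' (by omega) (by omega)).mono ?_
      rintro s'' i ⟨h5, h6⟩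
      refine ⟨h5, ?_⟩
      have h7 := Finset.add_sum_erase A (fun y => (adj y).length) hxA
      have h8 : A.card * (30 * L + 2) = (A.erase x).card * (30 * L + 2) + (30 * L + 2) := by
        rw [← hcard]; ring
      simp only [List.length_nil] at h4 h7
      omega

/-- The values and pointers that `ModDijkstra` computes. -/
structure DistSpec (N : Net V) (v₀ : V → Option ℝ) (α : ℝ) (val : V → WithTop ℝ)
    (par : V → Option V) : Prop where
  att : ∀ y ∈ N.verts, val y ≠ ⊤ → ∃ t a l, v₀ t = some a ∧ N.Walk t y l ∧
    val y = ((a + α * l : ℝ) : WithTop ℝ)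
  le : ∀ t a y l, y ∈ N.verts → v₀ t = some a → N.Walk t y l →
    val y ≤ ((a + α * l : ℝ) : WithTop ℝ)
  ptr : ∀ y ∈ N.verts, ∀ z, par y = some z → ∃ c, N.Adj z y c ∧
    val y = val z + ((α * c : ℝ) : WithTop ℝ) ∧ val y ≠ ⊤
  unreached : ∀ y ∈ N.verts, par y = none → val y = initKey v₀ y

/-- With an empty heap the edge inequality holds everywhere, and it adds up along any walk from a
terminal. -/
theorem DInv.distSpec {N : Net V} (hN : N.Valid) {v₀ : V → Option ℝ} {α : ℝ} {s : DState V}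
    (H : DInv N v₀ α s ∅ (fun _ _ _ => False)) : DistSpec N v₀ α s.value s.parent where
  att y hy h := by
    rw [H.value y hy (by simp)] at h ⊢
    exact H.att y hy h
  le t a y l hy ha hw := by
    induction hw with
    | nil =>
      rw [H.value _ hy (by simp)]
      simpa [initKey, ha] using H.le_init _ hy
    | @snoc y z l c hw hyz ih =>
      have hy' := (hN.adj hyz).1
      have h1 := H.edge y z c hyz (by simp) (fun h => h)
      rw [H.value _ hy (by simp)]
      refine h1.trans ?_
      rw [← H.value _ hy' (by simp)]
      refine (add_le_add_left (ih hy') _).trans (le_of_eq ?_)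
      rw [← WithTop.coe_add]
      congr 1; ring
  ptr y hy z hz := by
    rcases H.ptr y hy with ⟨h1, _⟩ | ⟨w, c, h1, _, h2, h3, h4⟩
    · rw [h1] at hz; cases hz
    · rw [h1] at hz; cases hz
      rw [H.value y hy (by simp), H.value _ (hN.adj h2).1 (by simp)]
      exact ⟨c, h2, h3, h4⟩
  unreached y hy h := by
    rw [H.value y hy (by simp)]
    rcases H.ptr y hy with ⟨_, h1⟩ | ⟨w, c, h1, _⟩
    · exact h1
    · rw [h] at h1; cases h1

/-- The size of a network, with weight `L` for the vertices. -/
def Net.size (N : Net V) (L : ℕ) : ℕ := N.edges.length + N.verts.length * L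

theorem spec_modDijkstra {N : Net V} (hN : N.Valid) (v₀ : V → Option ℝ) {α : ℝ} (hα : 0 ≤ α)
    {L : ℕ} (hL0 : 0 < L) (hL : N.verts.length < 2 ^ L) (hne : N.verts ≠ []) {fuel : ℕ}
    (hf : N.verts.length + 3 * L + 1 < fuel) :
    Spec (modDijkstra fuel N v₀ α) (fun r k => DistSpec N v₀ α r.1 r.2 ∧
      k ≤ 100 * N.size L) := by
  have hcard := List.toFinset_card_of_nodup hN.nodup
  unfold modDijkstra
  rw [spec_bind]
  refine (spec_adjacency N).mono ?_
  rintro adj k₁ ⟨hadj, hsum, hk₁⟩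
  rw [spec_bind]
  refine (FibHeap.spec_init hN.nodup).mono ?_
  rintro h k₂ ⟨hinv, hkey, hk₂⟩
  rw [spec_bind]
  refine (spec_loop (fun r g j => g.Inv N.verts.toFinset 0 ∧ r.Nodup ∧
    (∀ x ∈ r, g.key x = ⊤) ∧ (∀ x ∈ N.verts, x ∉ r → g.key x = initKey v₀ x) ∧
    j + g.pot 5 N.verts.toFinset + 14 * r.length ≤
      h.pot 5 N.verts.toFinset + 14 * N.verts.length) ?_ ?_).mono ?_
  · exact ⟨hinv, hN.nodup, by simp [hkey], fun x h1 h2 => absurd h1 h2, by omega⟩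
  · rintro x r g j ⟨h1, h2, h3, h4, h5⟩
    obtain ⟨hxr, hr⟩ := List.nodup_cons.1 h2
    simp only [List.length_cons] at h5
    cases hx : v₀ x with
    | none =>
      rw [spec_ret]
      refine ⟨h1, hr, fun z hz => h3 z (List.mem_cons_of_mem _ hz), fun z hz hzr => ?_, by omega⟩
      by_cases hzx : z = x
      · subst hzx
        rw [h3 z (by simp)]
        simp [initKey, hx]
      · exact h4 z hz (by simp [hzx, hzr])
    | some a =>
      have hk : (a : WithTop ℝ) ≤ g.key x := by rw [h3 x (by simp)]; exact le_top
      refine (FibHeap.spec_decreaseKey h1 (by omega) hk).mono ?_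
      rintro g' i ⟨h6, h7, h8⟩
      refine ⟨h6, hr, fun z hz => ?_, fun z hz hzr => ?_, by omega⟩
      · rw [h7, Function.update_of_ne]
        · exact h3 z (List.mem_cons_of_mem _ hz)
        · rintro rfl; exact hxr hz
      · rw [h7]
        by_cases hzx : z = x
        · subst hzx
          simp [initKey, hx]
        · rw [Function.update_of_ne hzx]
          exact h4 z hz (by simp [hzx, hzr])
  rintro g k₃ ⟨h1, -, -, h4, h5⟩
  simp only [spec_bind, spec_newArray, spec_ret]
  refine (spec_dijkstraLoop (N := N) (v₀ := v₀) (L := L) hN hα hadj fuel _ N.verts.toFinset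
    ?_ (by omega) (by omega)).mono ?_
  · refine ⟨h1, Finset.Subset.refl _, by simp,
      fun x h h' => absurd (List.mem_toFinset.2 h) h', fun x hx => (h4 x hx (by simp)).le,
      fun x h h' => absurd (List.mem_toFinset.2 h) h', fun x y c hxy hx => absurd (by simpa using (hN.adj hxy).1) hx,
      fun y hy => Or.inl ⟨rfl, h4 y hy (by simp)⟩, fun y hy hyt => ?_⟩
    simp only [h4 y hy (by simp)] at hyt ⊢
    cases hv : v₀ y with
    | none => simp [initKey, hv] at hyt
    | some a => exact ⟨y, a, 0, hv, Net.Walk.nil y, by simp [initKey, hv]⟩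
  · rintro s k ⟨h6, h7⟩
    refine ⟨h6.distSpec hN, ?_⟩
    have h8 := List.length_pos_iff.2 hne
    simp only [List.length_nil] at h5
    simp only at h7
    rw [hcard] at h7
    have h9 : N.verts.length ≤ N.verts.length * L := Nat.le_mul_of_pos_right _ hL0
    have h10 : L ≤ N.verts.length * L := Nat.le_mul_of_pos_left _ h8
    have h11 : N.verts.length * (30 * L + 2) = 30 * (N.verts.length * L) + 2 * N.verts.length := by
      ring
    rw [h11] at h7
    simp only [Net.size]
    omega

end

section

open Prog

/-! ### Step bounds in natural numbers, and the counting argument for random pivots -/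

namespace Prog

variable {α β : Type} {Q : β → Prop} {C B : ℕ}

theorem Triple.le_nat {p : Prog β} (h : Triple p Q (B : ℝ≥0∞)) (hC : B ≤ C) :
    Triple p Q (C : ℝ≥0∞) :=
  h.mono (fun _ => id) (by exact_mod_cast hC)

theorem Triple.bind_nat {p : Prog α} {f : α → Prog β} {Q' : α → Prop} {B' : ℕ}
    (h : Triple p Q' (B' : ℝ≥0∞)) (h' : ∀ a, Q' a → Triple (f a) Q (B : ℝ≥0∞))
    (hC : B' + B ≤ C) : Triple (p >>= f) Q (C : ℝ≥0∞) :=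
  (h.bind h').mono (fun _ => id) (by exact_mod_cast hC)

theorem Triple.tick_nat {p : Prog β} (h : Triple p Q (B : ℝ≥0∞)) (hC : B + 1 ≤ C) :
    Triple (Prog.tick p) Q (C : ℝ≥0∞) :=
  h.tick.mono (fun _ => id) (by rw [add_comm]; exact_mod_cast hC)

theorem Triple.ret_nat {b : β} (h : Q b) : Triple (Prog.ret b) Q (C : ℝ≥0∞) :=
  (Triple.ret h).mono (fun _ => id) zero_le

theorem Triple.charge_bind {f : Unit → Prog β} {k : ℕ} (h : Triple (f ()) Q (B : ℝ≥0∞))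
    (hC : k + B ≤ C) : Triple (charge k >>= f) Q (C : ℝ≥0∞) :=
  Triple.bind_nat (Q' := fun _ => True) (B' := k) (Spec.triple (by simp)) (fun _ _ => h) hC

theorem Triple.argmax_bind {l : List α} {g : α → ℝ} {f : Option α → Prog β}
    (h : Triple (f (l.argmax g)) Q (B : ℝ≥0∞)) (hC : l.length + B ≤ C) :
    Triple (Prog.argmax l g >>= f) Q (C : ℝ≥0∞) :=
  Triple.bind_nat (Q' := fun o => o = l.argmax g) (B' := l.length)
    (Spec.triple (by simp)) (fun _ ho => ho ▸ h) hC

theorem Triple.select_bind {l : List α} {p : α → Bool} {f : List α → Prog β}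
    (h : Triple (f (l.filter p)) Q (B : ℝ≥0∞)) (hC : l.length + B ≤ C) :
    Triple (Prog.select l p >>= f) Q (C : ℝ≥0∞) :=
  Triple.bind_nat (Q' := fun o => o = l.filter p) (B' := l.length)
    (Spec.triple (by simp)) (fun _ ho => ho ▸ h) hC

theorem Triple.sample_bind_nat {l : List α} {f : α → Prog β} (hl : l ≠ []) (F : α → ℕ)
    (h : ∀ a ∈ l, Triple (f a) Q (F a : ℝ≥0∞)) (hB : (l.map F).sum ≤ B * l.length)
    (hC : l.length + 1 + B ≤ C) : Triple (sample l >>= f) Q (C : ℝ≥0∞) := by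
  refine (Triple.sample_bind hl h).mono (fun _ => id) ?_
  have h1 : (l.map fun a => (F a : ℝ≥0∞)).sum = ((l.map F).sum : ℕ) := by
    rw [Nat.cast_list_sum, List.map_map]; rfl
  have h2 : (l.length : ℝ≥0∞) ≠ 0 := by simpa using hl
  have h3 : (l.map fun a => (F a : ℝ≥0∞)).sum / l.length ≤ B := by
    rw [h1]
    refine ENNReal.div_le_of_le_mul ?_
    exact_mod_cast hB
  refine (add_le_add_right h3 _).trans ?_
  exact_mod_cast hC

/-- The relation "`b` has the property `H` at a level at which `a` does not have it". -/
def Beats (H : ℝ → α → Prop) (b a : α) : Prop := ∃ x, H x b ∧ ¬ H x a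

/-- Since `H` is antitone in the level, the sets of levels of any two entries are nested. Comparing
them replaces comparing pressures and avoids defining the pressure as a supremum. -/
theorem Beats.asymm {H : ℝ → α → Prop} (hH : ∀ a x y, x ≤ y → H y a → H x a) {a b : α}
    (h : Beats H b a) (h' : Beats H a b) : False := by
  obtain ⟨x, h1, h2⟩ := h
  obtain ⟨y, h3, h4⟩ := h'
  rcases le_total x y with h5 | h5
  · exact h2 (hH _ _ _ h5 h3)
  · exact h4 (hH _ _ _ h5 h1)

open Classical in
/-- The number of entries of `l` that beat `a`. -/
noncomputable def numBeats (H : ℝ → α → Prop) (l : List α) (a : α) : ℕ :=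
  (l.filter fun b => decide (Beats H b a)).length

/-- Solves the recurrence of the searches: a call that spends `c` and then `2 * D` per surviving
entry spends on average at most `c` plus `D` per entry. If `c` is at most `D` per entry, the bound
`2 * D` per entry reproduces itself. -/
theorem sum_numBeats {H : ℝ → α → Prop} (hH : ∀ a x y, x ≤ y → H y a → H x a) (l : List α)
    (c D : ℕ) : (l.map fun a => c + 2 * D * numBeats H l a).sum ≤ (c + D * l.length) * l.length := by
  classical
  have h1 := sum_length_filter_le l (fun b a => decide (Beats H b a)) (by
    intro a b h h'
    exact Beats.asymm hH (of_decide_eq_true h) (of_decide_eq_true h'))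
  rw [List.sum_map_add, List.sum_map_mul_left]
  simp only [List.map_const', List.sum_replicate, smul_eq_mul]
  have h2 : (l.map fun a => numBeats H l a).sum =
    (l.map fun a => (l.filter fun b => decide (Beats H b a)).length).sum := rfl
  rw [h2]
  nlinarith

/-- All survivors have the property at level `x` and the pivot `a` does not, so each survivor beats
the pivot. -/
theorem length_filter_le_numBeats {H : ℝ → α → Prop} {l : List α} {p : α → Bool} {x : ℝ} {a : α}
    (hp : ∀ b ∈ l, p b = true → H x b) (ha : ¬ H x a) :
    (l.filter p).length ≤ numBeats H l a := by
  classical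
  unfold numBeats
  rw [← List.countP_eq_length_filter, ← List.countP_eq_length_filter]
  exact List.countP_mono_left fun b hb h => decide_eq_true ⟨x, hp b hb h, ha⟩

end Prog

variable {V : Type}

/-! ### Stars -/

/-- `t` lies on a path in the star with gradient more than `β`. -/
def StarHigh (T : List V) (v d : V → ℝ) (β : ℝ) (t : V) : Prop :=
  ∃ s ∈ T, β * (d t + d s) < |v t - v s|

theorem StarHigh.anti {T : List V} {v d : V → ℝ} (hd : ∀ t ∈ T, 0 < d t) {t : V} (ht : t ∈ T)
    {β γ : ℝ} (h : β ≤ γ) (H : StarHigh T v d γ t) : StarHigh T v d β t := by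
  obtain ⟨s, hs, h1⟩ := H
  refine ⟨s, hs, lt_of_le_of_lt ?_ h1⟩
  exact mul_le_mul_of_nonneg_right h (add_pos (hd t ht) (hd s hs)).le

/-- The terminals `t₁`, `t₂` are the ends of a steepest path in the star. -/
def StarPost (T : List V) (v d : V → ℝ) (t : V × V) : Prop :=
  t.1 ∈ T ∧ t.2 ∈ T ∧ v t.2 ≤ v t.1 ∧
    ∀ s ∈ T, ¬ StarHigh T v d ((v t.1 - v t.2) / (d t.1 + d t.2)) s

/-- Being high is symmetric in the two ends of a path, so a partner of a high terminal is itself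
high and survives the filter. Above level `α` nothing is lost, and the optimum among the survivors
is at least `α` because some terminal survives. -/
theorem starPost_of_filter {T : List V} {v d : V → ℝ} (hd : ∀ t ∈ T, 0 < d t) {α : ℝ}
    {p : V → Bool} (hp : ∀ t ∈ T, p t = true ↔ StarHigh T v d α t) (hne : T.filter p ≠ [])
    {t : V × V} (H : StarPost (T.filter p) v d t) : StarPost T v d t := by
  obtain ⟨h1, h2, h3, h4⟩ := H
  set γ := (v t.1 - v t.2) / (d t.1 + d t.2) with hγ
  refine ⟨(List.mem_filter.1 h1).1, (List.mem_filter.1 h2).1, h3, ?_⟩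
  have key : ∀ β, α ≤ β → ∀ s ∈ T, StarHigh T v d β s →
      s ∈ T.filter p ∧ StarHigh (T.filter p) v d β s := by
    intro β hβ s hs hh
    have hs' : s ∈ T.filter p := List.mem_filter.2 ⟨hs, (hp s hs).2 (hh.anti hd hs hβ)⟩
    obtain ⟨r, hr, h5⟩ := hh
    refine ⟨hs', r, List.mem_filter.2 ⟨hr, (hp r hr).2 ?_⟩, h5⟩
    refine StarHigh.anti hd hr hβ ⟨s, hs, ?_⟩
    rwa [add_comm, abs_sub_comm]
  have hαγ : α ≤ γ := by
    by_contra hlt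
    obtain ⟨s, hs⟩ := List.exists_mem_of_ne_nil _ hne
    obtain ⟨hsT, hsp⟩ := List.mem_filter.1 hs
    have h5 := (key α le_rfl s hsT ((hp s hsT).1 hsp)).2
    exact h4 s hs (h5.anti (fun t ht => hd t (List.mem_filter.1 ht).1) hs (not_le.1 hlt).le)
  intro s hs hh
  obtain ⟨h5, h6⟩ := key γ hαγ s hs hh
  exact h4 s h5 h6

/-- Apart from the recursive call at most `7 * T.length` steps are made, and the recursion doubles
this. The pivot `t₁` is never high at its own optimum `α`, so the list shrinks strictly. -/
theorem triple_starSteepestPath (v d : V → ℝ) (fuel : ℕ) : ∀ (T : List V), T ≠ [] →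
    (∀ t ∈ T, 0 < d t) → T.length < fuel →
    Triple (starSteepestPath fuel T v d) (StarPost T v d) (14 * T.length : ℕ) := by
  induction fuel with
  | zero => intro T _ _ hf; omega
  | succ fuel ih =>
    intro T hT hd hf
    have hpos := List.length_pos_iff.2 hT
    unfold starSteepestPath
    refine Triple.tick_nat (B := 13 * T.length) ?_ (by omega)
    let H' : ℝ → V → Prop := fun β t => t ∈ T ∧ StarHigh T v d β t
    have hH' : ∀ a x y, x ≤ y → H' y a → H' x a := fun a x y hxy h => ⟨h.1, h.2.anti hd h.1 hxy⟩
    refine Triple.sample_bind_nat hT (fun a => 4 * T.length + 2 * 7 * numBeats H' T a)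
      (fun t₁ ht₁ => ?_) (sum_numBeats hH' T (4 * T.length) 7) (by omega)
    refine Triple.argmax_bind (B := 3 * T.length + 2 * 7 * numBeats H' T t₁) ?_ (by omega)
    cases harg : T.argmax (fun t => |v t₁ - v t| / (d t₁ + d t)) with
    | none => rw [List.argmax_eq_none] at harg; exact absurd harg hT
    | some t₂ =>
      have ht₂ := List.argmax_mem harg
      simp only
      set α := |v t₂ - v t₁| / (d t₁ + d t₂) with hα
      refine Triple.argmax_bind (B := 2 * T.length + 2 * 7 * numBeats H' T t₁) ?_ (by omega)
      refine Triple.argmax_bind (B := T.length + 2 * 7 * numBeats H' T t₁) ?_ (by omega)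
      cases ha : T.argmax (fun t => -(v t + α * d t)) with
      | none => rw [List.argmax_eq_none] at ha; exact absurd ha hT
      | some a =>
      cases hb : T.argmax (fun t => v t - α * d t) with
      | none => rw [List.argmax_eq_none] at hb; exact absurd hb hT
      | some b =>
      simp only
      have hα0 : 0 ≤ α := div_nonneg (abs_nonneg _) (add_pos (hd _ ht₁) (hd _ ht₂)).le
      -- The entries `a` and `b` attain the extreme values over all of `T`, so the two scans detect
      -- a steep partner below or above `t` without trying all pairs.
      have hp : ∀ t ∈ T, (decide (v t > v a + α * d a + α * d t) ||
          decide (v t < v b - α * d b - α * d t)) = true ↔ StarHigh T v d α t := by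
        intro t ht
        rw [Bool.or_eq_true, decide_eq_true_iff, decide_eq_true_iff]
        constructor
        · rintro (h1 | h1)
          · refine ⟨a, List.argmax_mem ha, lt_of_lt_of_le ?_ (le_abs_self _)⟩
            rw [mul_add]; linarith
          · refine ⟨b, List.argmax_mem hb, lt_of_lt_of_le ?_ (neg_le_abs _)⟩
            rw [mul_add]; linarith
        · rintro ⟨s, hs, h1⟩
          have h2 := List.le_of_mem_argmax hs ha
          have h3 := List.le_of_mem_argmax hs hb
          rw [mul_add] at h1
          rcases lt_abs.1 h1 with h4 | h4
          · left; linarith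
          · right; linarith
      have hno : ¬ StarHigh T v d α t₁ := by
        rintro ⟨s, hs, h1⟩
        have h2 := List.le_of_mem_argmax hs harg
        rw [abs_sub_comm (v t₁) (v t₂), ← hα,
          div_le_iff₀ (add_pos (hd _ ht₁) (hd _ hs))] at h2
        exact absurd h1 (not_lt.2 h2)
      refine Triple.select_bind (B := 2 * 7 * numBeats H' T t₁) ?_ (by omega)
      set p : V → Bool := fun t => decide (v t > v a + α * d a + α * d t) ||
          decide (v t < v b - α * d b - α * d t) with hpdef
      split_ifs with hemp hv
      · refine Triple.ret_nat ⟨ht₁, ht₂, hv, fun s hs hh => ?_⟩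
        have h1 : (v t₁ - v t₂) / (d t₁ + d t₂) = α := by
          rw [hα, abs_sub_comm, abs_of_nonneg (sub_nonneg.2 hv)]
        simp only [h1] at hh
        have h2 : s ∈ T.filter p := List.mem_filter.2 ⟨hs, (hp s hs).2 hh⟩
        rw [List.isEmpty_iff.1 hemp] at h2
        cases h2
      · refine Triple.ret_nat ⟨ht₂, ht₁, (not_le.1 hv).le, fun s hs hh => ?_⟩
        have h1 : (v t₂ - v t₁) / (d t₂ + d t₁) = α := by
          rw [hα, abs_of_nonneg (sub_nonneg.2 (not_le.1 hv).le), add_comm]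
        simp only [h1] at hh
        have h2 : s ∈ T.filter p := List.mem_filter.2 ⟨hs, (hp s hs).2 hh⟩
        rw [List.isEmpty_iff.1 hemp] at h2
        cases h2
      · have hne : T.filter p ≠ [] := by simpa [List.isEmpty_iff] using hemp
        have hlen : (T.filter p).length ≤ numBeats H' T t₁ :=
          length_filter_le_numBeats (H := H') (fun t ht h => ⟨ht, (hp t ht).1 h⟩)
            (fun h => hno h.2)
        have hlt : (T.filter p).length < T.length := by
          rw [List.length_filter_lt_length_iff_exists]
          exact ⟨t₁, ht₁, fun h => hno ((hp t₁ ht₁).1 h)⟩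
        exact ((ih _ hne (fun t ht => hd t (List.mem_filter.1 ht).1) (by omega)).mono
          (fun t ht => starPost_of_filter hd hp hne ht) le_rfl).le_nat (by omega)

end

section

open Prog

variable {V : Type}

/-! ### Pressure -/

/-- There is a terminal path through `x` with gradient more than `β`. -/
def HP (N : Net V) (v₀ : V → Option ℝ) (β : ℝ) (x : V) : Prop :=
  ∃ t₁ t₂ a₁ a₂ l₁ l₂, v₀ t₁ = some a₁ ∧ v₀ t₂ = some a₂ ∧ N.Walk t₁ x l₁ ∧ N.Walk x t₂ l₂ ∧
    β * (l₁ + l₂) < a₁ - a₂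

theorem HP.anti {N : Net V} (hN : N.Valid) {v₀ : V → Option ℝ} {x : V} {β γ : ℝ} (h : β ≤ γ)
    (H : HP N v₀ γ x) : HP N v₀ β x := by
  obtain ⟨t₁, t₂, a₁, a₂, l₁, l₂, h1, h2, h3, h4, h5⟩ := H
  refine ⟨t₁, t₂, a₁, a₂, l₁, l₂, h1, h2, h3, h4, lt_of_le_of_lt ?_ h5⟩
  exact mul_le_mul_of_nonneg_right h (add_nonneg (h3.nonneg hN) (h4.nonneg hN))

/-- The requirements of the algorithms: the graph is well formed, has no edges between terminals, and
every vertex is connected to a terminal. -/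
structure Ready (N : Net V) (v₀ : V → Option ℝ) : Prop where
  valid : N.Valid
  free : ∀ x y c, N.Adj x y c → v₀ x = none ∨ v₀ y = none
  reach : ∀ x ∈ N.verts, ∃ t a l, v₀ t = some a ∧ N.Walk t x l

open Classical in
/-- The subgraph induced on the vertices with pressure more than `α`. -/
noncomputable def hpNet (N : Net V) (v₀ : V → Option ℝ) (α : ℝ) : Net V where
  verts := N.verts.filter (fun x => decide (HP N v₀ α x))
  edges := N.edges.filter (fun e => decide (HP N v₀ α e.1 ∧ HP N v₀ α e.2.1))

theorem mem_hpNet_verts {N : Net V} {v₀ : V → Option ℝ} {α : ℝ} {x : V} :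
    x ∈ (hpNet N v₀ α).verts ↔ x ∈ N.verts ∧ HP N v₀ α x := by
  classical
  simp [hpNet]

theorem mem_hpNet_edges {N : Net V} {v₀ : V → Option ℝ} {α : ℝ} {e : V × V × ℝ} :
    e ∈ (hpNet N v₀ α).edges ↔ e ∈ N.edges ∧ HP N v₀ α e.1 ∧ HP N v₀ α e.2.1 := by
  classical
  simp [hpNet]

/-- A walk survives in the induced subgraph as soon as each of its vertices has high pressure; `hp`
may use how the vertex splits the walk. -/
theorem hpNet_walk_of {N : Net V} {v₀ : V → Option ℝ} {α : ℝ} {x y : V} {l : ℝ}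
    (h : N.Walk x y l)
    (hp : ∀ z p q, N.Walk x z p → N.Walk z y q → p + q = l → HP N v₀ α z) :
    (hpNet N v₀ α).Walk x y l := by
  induction h with
  | nil => exact Net.Walk.nil _
  | @snoc y z l c h1 h2 ih =>
    refine (ih fun w p q h3 h4 h5 => hp w p (q + c) h3 (h4.snoc h2) (by rw [← h5]; ring)).snoc ?_
    have hy := hp y l c h1 (Net.Walk.single h2) rfl
    have hz := hp z (l + c) 0 (h1.snoc h2) (Net.Walk.nil _) (by ring)
    exact h2.imp (fun h => mem_hpNet_edges.2 ⟨h, hy, hz⟩) (fun h => mem_hpNet_edges.2 ⟨h, hz, hy⟩)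

/-- Every vertex of a steep terminal walk lies on that same walk and hence has high pressure itself,
so the whole walk survives. -/
theorem HP.hpNet {N : Net V} (hN : N.Valid) {v₀ : V → Option ℝ} {α β : ℝ} (hαβ : α ≤ β) {x : V}
    (h : HP N v₀ β x) : HP (hpNet N v₀ α) v₀ β x := by
  obtain ⟨t₁, t₂, a₁, a₂, l₁, l₂, h1, h2, h3, h4, h5⟩ := h
  have hle : α * (l₁ + l₂) ≤ β * (l₁ + l₂) :=
    mul_le_mul_of_nonneg_right hαβ (add_nonneg (h3.nonneg hN) (h4.nonneg hN))
  refine ⟨t₁, t₂, a₁, a₂, l₁, l₂, h1, h2, hpNet_walk_of h3 fun z p q h6 h7 h8 => ?_,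
    hpNet_walk_of h4 fun z p q h6 h7 h8 => ?_, h5⟩
  · refine ⟨t₁, t₂, a₁, a₂, p, q + l₂, h1, h2, h6, h7.trans h4, ?_⟩
    rw [← add_assoc, h8]; linarith
  · refine ⟨t₁, t₂, a₁, a₂, l₁ + p, q, h1, h2, h3.trans h6, h7, ?_⟩
    rw [add_assoc, h8]; linarith

theorem Ready.hpNet {N : Net V} {v₀ : V → Option ℝ} (H : Ready N v₀) (α : ℝ) :
    Ready (hpNet N v₀ α) v₀ where
  valid :=
    { nodup := by classical exact H.valid.nodup.filter _
      edge := fun e he => by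
        obtain ⟨h1, h2, h3⟩ := mem_hpNet_edges.1 he
        obtain ⟨h4, h5, h6⟩ := H.valid.edge e h1
        exact ⟨mem_hpNet_verts.2 ⟨h4, h2⟩, mem_hpNet_verts.2 ⟨h5, h3⟩, h6⟩ }
  free x y c h := H.free x y c
    (h.imp (fun h => (mem_hpNet_edges.1 h).1) (fun h => (mem_hpNet_edges.1 h).1))
  reach x hx := by
    obtain ⟨t₁, _, a₁, _, l₁, _, h1, _, h3, _⟩ :=
      (mem_hpNet_verts.1 hx).2.hpNet H.valid le_rfl
    exact ⟨t₁, a₁, l₁, h1, h3⟩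

/-- A network with a terminal path of positive gradient has an edge. -/
theorem HP.exists_edge {N : Net V} {v₀ : V → Option ℝ} {α : ℝ} {x : V}
    (h : HP N v₀ α x) : N.edges ≠ [] := by
  obtain ⟨t₁, t₂, a₁, a₂, l₁, l₂, h1, h2, h3, h4, h5⟩ := h
  intro hE
  have hno : ∀ {y z : V} {l : ℝ}, N.Walk y z l → y = z ∧ l = 0 := by
    intro y z l hw
    cases hw with
    | nil => exact ⟨rfl, rfl⟩
    | snoc _ h => simp [Net.Adj, hE] at h
  obtain ⟨rfl, rfl⟩ := hno h3
  obtain ⟨rfl, rfl⟩ := hno h4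
  rw [h1] at h2
  cases h2
  simp at h5

/-! ### Paths -/

/-- The path `P` joins terminals and has gradient `P.grad`. -/
structure PPost (N : Net V) (v₀ : V → Option ℝ) (P : TPath V) : Prop where
  grad_nonneg : 0 ≤ P.grad
  length_le : P.steps.length ≤ 2 * N.verts.length
  walk : ∀ q ∈ P.steps, ∃ t t' b' b, v₀ t = some P.start ∧ N.Walk t q.1 q.2 ∧ v₀ t' = some b' ∧
    N.Walk q.1 t' b ∧ P.start - P.grad * q.2 = b' + P.grad * b
  free : ∃ q ∈ P.steps, v₀ q.1 = none

/-- The distances `d` and pointers `par` of a tree of shortest paths to `x`. -/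
structure SPTree (N : Net V) (x : V) (d : V → ℝ) (par : V → Option V) : Prop where
  walk : ∀ y l, N.Walk y x l → N.Walk y x (d y)
  le : ∀ y l, N.Walk y x l → d y ≤ l
  ptr : ∀ y l z, N.Walk y x l → par y = some z → ∃ c, N.Adj y z c ∧ d y = d z + c
  root : ∀ y l, N.Walk y x l → par y = none → y = x

namespace SPTree

variable {N : Net V} {x : V} {d : V → ℝ} {par : V → Option V}

theorem dist_self (hN : N.Valid) (H : SPTree N x d par) : d x = 0 :=
  le_antisymm (H.le x 0 (Net.Walk.nil x)) ((H.walk x 0 (Net.Walk.nil x)).nonneg hN)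

theorem dist_pos (hN : N.Valid) (H : SPTree N x d par) {y : V} {l : ℝ} (h : N.Walk y x l)
    (hne : y ≠ x) : 0 < d y :=
  ((H.walk y l h).eq_or_pos hN).resolve_left fun h => hne h.1

end SPTree

variable [DecidableEq V]

/-- With `x` as the only source, of voltage 0, and slope 1, the values are distances to `x`;
infinite values mark the other components. -/
theorem DistSpec.tree {N : Net V} (hN : N.Valid) {x : V} (hx : x ∈ N.verts) {val : V → WithTop ℝ}
    {par : V → Option V} (H : DistSpec N (fun y => if y = x then some 0 else none) 1 val par) :
    SPTree N x (fun y => (val y).untopD 0) par ∧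
      ∀ y ∈ N.verts, val y < ⊤ ↔ ∃ l, N.Walk y x l := by
  have hatt : ∀ y ∈ N.verts, val y ≠ ⊤ →
      N.Walk y x ((val y).untopD 0) ∧ val y = (((val y).untopD 0 : ℝ) : WithTop ℝ) := by
    intro y hy h
    obtain ⟨t, a, l, h1, h2, h3⟩ := H.att y hy h
    split_ifs at h1 with htx
    cases h1
    subst htx
    rw [h3]
    simpa using h2.symm
  have hle : ∀ y l, N.Walk y x l → val y ≤ ((l : ℝ) : WithTop ℝ) := by
    intro y l h
    simpa using H.le x 0 y l ((h.mem_iff hN).2 hx) (by simp) h.symm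
  have htop : ∀ y l, N.Walk y x l → val y ≠ ⊤ := fun y l h =>
    ne_top_of_le_ne_top WithTop.coe_ne_top (hle y l h)
  refine ⟨⟨fun y l h => (hatt y ((h.mem_iff hN).2 hx) (htop y l h)).1, fun y l h => ?_,
    fun y l z h hz => ?_, fun y l h hp => ?_⟩, fun y hy => ⟨fun h => ?_, fun ⟨l, h⟩ => ?_⟩⟩
  · have h1 := (hatt y ((h.mem_iff hN).2 hx) (htop y l h)).2
    have h2 := hle y l h
    rw [h1] at h2
    exact WithTop.coe_le_coe.1 h2
  · have hy := (h.mem_iff hN).2 hx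
    obtain ⟨c, h1, h2, h3⟩ := H.ptr y hy z hz
    refine ⟨c, h1.symm, ?_⟩
    have hz' : val z ≠ ⊤ := by
      intro h4
      rw [h4] at h2
      exact h3 (by simpa using h2)
    have h4 := (hatt y hy h3).2
    have h5 := (hatt z (hN.adj h1).1 hz').2
    rw [h4, h5, ← WithTop.coe_add, one_mul] at h2
    exact WithTop.coe_injective h2
  · have h1 := H.unreached y ((h.mem_iff hN).2 hx) hp
    by_contra hne
    exact htop y l h (by rw [h1]; simp [initKey, hne])
  · exact ⟨_, (hatt y hy h.ne).1⟩
  · exact lt_top_iff_ne_top.2 (htop y l h)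

/-- Edge lengths are positive, so the distance falls strictly along the pointers, and the number of
vertices no farther than `y` bounds the depth. The clause about `par y` serves to exhibit a
non-terminal on the path later. -/
theorem spec_follow {N : Net V} (hN : N.Valid) {x : V} (hx : x ∈ N.verts) {d : V → ℝ}
    {par : V → Option V} (H : SPTree N x d par) (fuel : ℕ) : ∀ (y : V) (l : ℝ), N.Walk y x l →
    (N.verts.toFinset.filter (fun w => d w ≤ d y)).card < fuel →
    Spec (follow par fuel y) (fun A k => k = A.length ∧ A.Nodup ∧
      (∀ w ∈ A, d w ≤ d y ∧ N.Walk y w (d y - d w) ∧ N.Walk w x (d w)) ∧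
      (∃ m, A = m ++ [x]) ∧ y ∈ A ∧ (∀ z, par y = some z → z ∈ A)) := by
  induction fuel with
  | zero => intro y l _ hf; omega
  | succ fuel ih =>
    intro y l hy hf
    unfold follow
    cases hp : par y with
    | none =>
      have := H.root y l hy hp
      subst this
      simp only [spec_tick, spec_ret]
      refine ⟨by simp, by simp, ?_, ⟨[], by simp⟩, by simp, by simp⟩
      intro w hw
      have : w = y := by simpa using hw
      subst this
      refine ⟨le_rfl, ?_, H.walk w l hy⟩
      rw [sub_self]; exact Net.Walk.nil w
    | some z =>
      obtain ⟨c, h1, h2⟩ := H.ptr y l z hy hp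
      have hc := (hN.adj h1).2.2
      have hz : N.Walk z x (c + l) := (Net.Walk.single h1.symm).trans hy
      simp only [spec_tick, spec_bind, spec_ret]
      refine (ih z _ hz ?_).mono ?_
      · refine lt_of_lt_of_le ?_ (Nat.lt_succ_iff.1 hf)
        refine Finset.card_lt_card ((Finset.ssubset_iff_of_subset ?_).2 ⟨y, ?_, ?_⟩)
        · intro w hw
          simp only [Finset.mem_filter] at hw ⊢
          exact ⟨hw.1, by linarith [hw.2]⟩
        · simp [(hN.adj h1).1]
        · simp only [Finset.mem_filter, not_and, not_le]
          intro _
          linarith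
      · rintro A k ⟨h3, h4, h5, ⟨m, h6⟩, h7, -⟩
        refine ⟨by simp [h3], List.nodup_cons.2 ⟨fun h8 => ?_, h4⟩, fun w hw => ?_,
          ⟨y :: m, by simp [h6]⟩, by simp, fun w hw => ?_⟩
        · have := (h5 y h8).1
          linarith
        · rcases List.mem_cons.1 hw with rfl | hw
          · refine ⟨le_rfl, ?_, H.walk w l hy⟩
            rw [sub_self]; exact Net.Walk.nil w
          · obtain ⟨h8, h9, h10⟩ := h5 w hw
            refine ⟨by linarith, ?_, h10⟩
            have := (Net.Walk.single h1).trans h9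
            rwa [show c + (d z - d w) = d y - d w by rw [h2]; ring] at this
        · cases hw
          exact List.mem_cons_of_mem _ h7

theorem spec_pathThrough {N : Net V} (hN : N.Valid) {x : V} (hx : x ∈ N.verts) {d : V → ℝ}
    {par : V → Option V} (H : SPTree N x d par) (v : V → ℝ) {fuel : ℕ}
    (hf : N.verts.length < fuel) {t₁ t₂ : V} {l₁ l₂ : ℝ} (h₁ : N.Walk t₁ x l₁)
    (h₂ : N.Walk t₂ x l₂) :
    Spec (pathThrough fuel v d par t₁ t₂) (fun P k => k ≤ 4 * N.verts.length ∧
      P.start = v t₁ ∧ P.grad = (v t₁ - v t₂) / (d t₁ + d t₂) ∧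
      P.steps.length ≤ 2 * N.verts.length ∧
      (∀ q ∈ P.steps, N.Walk t₁ q.1 q.2 ∧ N.Walk q.1 t₂ (d t₁ + d t₂ - q.2)) ∧
      ∀ w, w = x ∨ par t₁ = some w ∨ par t₂ = some w → ∃ l, (w, l) ∈ P.steps) := by
  have hfuel : ∀ y, (N.verts.toFinset.filter (fun w => d w ≤ d y)).card < fuel := fun y =>
    lt_of_le_of_lt ((Finset.card_filter_le _ _).trans (List.toFinset_card_le _)) hf
  have hlen : ∀ A : List V, A.Nodup → (∀ w ∈ A, N.Walk w x (d w)) →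
      A.length ≤ N.verts.length := by
    intro A hA hAx
    rw [← List.toFinset_card_of_nodup hA, ← List.toFinset_card_of_nodup hN.nodup]
    refine Finset.card_le_card fun w hw => ?_
    rw [List.mem_toFinset] at hw ⊢
    exact ((hAx w hw).mem_iff hN).2 hx
  unfold pathThrough
  rw [spec_bind]
  refine (spec_follow hN hx H fuel t₁ l₁ h₁ (hfuel _)).mono ?_
  rintro A k ⟨rfl, a1, a2, ⟨m, a3⟩, a4, a5⟩
  rw [spec_bind]
  refine (spec_follow hN hx H fuel t₂ l₂ h₂ (hfuel _)).mono ?_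
  rintro B k ⟨rfl, b1, b2, ⟨m', b3⟩, b4, b5⟩
  simp only [spec_bind, spec_charge, spec_ret]
  have hA := hlen A a1 fun w hw => (a2 w hw).2.2
  have hB := hlen B b1 fun w hw => (b2 w hw).2.2
  -- Both halves contain `x`; the tail removes its second occurrence.
  have htail : B.reverse.tail = m'.reverse := by simp [b3]
  have hmem : ∀ w ∈ m', w ∈ B := fun w hw => by rw [b3]; simp [hw]
  refine ⟨by omega, trivial, trivial, ?_, ?_, ?_⟩
  · simp only [List.length_append, List.length_map, List.length_tail, List.length_reverse]
    omega
  · intro q hq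
    rw [htail] at hq
    simp only [List.mem_append, List.mem_map, List.mem_reverse] at hq
    rcases hq with ⟨w, hw, rfl⟩ | ⟨w, hw, rfl⟩
    · obtain ⟨-, h3, h4⟩ := a2 w hw
      refine ⟨h3, ?_⟩
      have := h4.trans (H.walk t₂ l₂ h₂).symm
      rwa [show d w + d t₂ = d t₁ + d t₂ - (d t₁ - d w) by ring] at this
    · obtain ⟨-, h3, h4⟩ := b2 w (hmem w hw)
      refine ⟨(H.walk t₁ l₁ h₁).trans h4.symm, ?_⟩
      have := h3.symm
      rwa [show d t₂ - d w = d t₁ + d t₂ - (d t₁ + d w) by ring] at this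
  · intro w hw
    have hxA : x ∈ A := by rw [a3]; simp
    simp only [List.mem_append, List.mem_map, htail, List.mem_reverse]
    by_cases hwA : w ∈ A
    · exact ⟨_, Or.inl ⟨w, hwA, rfl⟩⟩
    · rcases hw with rfl | hw | hw
      · exact absurd hxA hwA
      · exact absurd (a5 w hw) hwA
      · have := b5 w hw
        rw [b3, List.mem_append, List.mem_singleton] at this
        rcases this with h3 | rfl
        · exact ⟨_, Or.inr ⟨w, h3, rfl⟩⟩
        · exact absurd hxA hwA

omit [DecidableEq V] in
/-- A path that is assembled from two shortest paths to `x` is a terminal path. -/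
theorem pPost_of_pathThrough {N : Net V} {v₀ : V → Option ℝ} {d : V → ℝ} {P : TPath V}
    {t₁ t₂ : V} {a₁ a₂ : ℝ} (h1 : v₀ t₁ = some a₁) (h2 : v₀ t₂ = some a₂) (hle : a₂ ≤ a₁)
    (hd : 0 < d t₁ + d t₂) (hs : P.start = a₁) (hg : P.grad = (a₁ - a₂) / (d t₁ + d t₂))
    (hl : P.steps.length ≤ 2 * N.verts.length)
    (hw : ∀ q ∈ P.steps, N.Walk t₁ q.1 q.2 ∧ N.Walk q.1 t₂ (d t₁ + d t₂ - q.2))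
    (hf : ∃ q ∈ P.steps, v₀ q.1 = none) : PPost N v₀ P where
  grad_nonneg := by rw [hg]; exact div_nonneg (sub_nonneg.2 hle) hd.le
  length_le := hl
  walk q hq := by
    refine ⟨t₁, t₂, a₂, _, by rw [hs, h1], (hw q hq).1, h2, (hw q hq).2, ?_⟩
    have : P.grad * (d t₁ + d t₂) = a₁ - a₂ := by rw [hg, div_mul_cancel₀ _ hd.ne']
    rw [mul_sub, this, hs]
    ring
  free := hf

/-- What `VertexSteepestPath` guarantees. -/
def VPost (N : Net V) (v₀ : V → Option ℝ) (x : V) (o : Option (TPath V)) : Prop :=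
  (∀ P, o = some P → PPost N v₀ P ∧ ¬ HP N v₀ P.grad x) ∧
    (o = none → v₀ x ≠ none ∧ ∀ β, 0 ≤ β → ¬ HP N v₀ β x)

theorem triple_pathThrough {N : Net V} (hN : N.Valid) {v₀ : V → Option ℝ} {x : V}
    (hx : x ∈ N.verts) {d : V → ℝ} {par : V → Option V} (H : SPTree N x d par) {v : V → ℝ}
    {fuel : ℕ} (hf : N.verts.length < fuel) {t₁ t₂ w : V} {l₁ l₂ a₁ a₂ : ℝ}
    (h₁ : N.Walk t₁ x l₁) (h₂ : N.Walk t₂ x l₂) (ha₁ : v₀ t₁ = some a₁) (ha₂ : v₀ t₂ = some a₂)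
    (hv₁ : v t₁ = a₁) (hv₂ : v t₂ = a₂) (hle : a₂ ≤ a₁) (hd : 0 < d t₁ + d t₂)
    (hw : w = x ∨ par t₁ = some w ∨ par t₂ = some w) (hwf : v₀ w = none)
    (hHP : ¬ HP N v₀ ((a₁ - a₂) / (d t₁ + d t₂)) x) :
    Triple (do
      let P ← pathThrough fuel v d par t₁ t₂
      ret (some P)) (VPost N v₀ x) (4 * N.verts.length : ℕ) := by
  refine Triple.bind_nat (B := 0) (Q' := fun P => PPost N v₀ P ∧ ¬ HP N v₀ P.grad x)
    (B' := 4 * N.verts.length) (Spec.triple ?_) (fun P hP => Triple.ret_nat ?_) (by omega)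
  · refine (spec_pathThrough hN hx H v hf h₁ h₂).mono ?_
    rintro P k ⟨h3, h4, h5, h6, h7, h8⟩
    rw [hv₁] at h4
    rw [hv₁, hv₂] at h5
    refine ⟨⟨pPost_of_pathThrough ha₁ ha₂ hle hd h4 h5 h6 h7 ?_, by rwa [h5]⟩, h3⟩
    obtain ⟨l, hl⟩ := h8 w hw
    exact ⟨_, hl, hwf⟩
  · refine ⟨fun P' hP' => ?_, fun h => by cases h⟩
    cases hP'
    exact hP

theorem triple_vertexSteepestPath {N : Net V} {v₀ : V → Option ℝ} (H : Ready N v₀) {x : V}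
    (hx : x ∈ N.verts) {L : ℕ} (hL0 : 0 < L) (hL : N.verts.length < 2 ^ L) {fuel : ℕ}
    (hf : N.verts.length + 3 * L + 1 < fuel) :
    Triple (vertexSteepestPath fuel N v₀ x) (VPost N v₀ x) (130 * N.size L : ℕ) := by
  have hN := H.valid
  have hne : N.verts ≠ [] := List.ne_nil_of_mem hx
  have hsize : N.verts.length ≤ N.size L :=
    (Nat.le_mul_of_pos_right _ hL0).trans (Nat.le_add_left _ _)
  unfold vertexSteepestPath
  refine Triple.charge_bind (B := 129 * N.size L) ?_ (by omega)
  refine Triple.bind_nat (B := 29 * N.size L)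
    (spec_modDijkstra hN _ zero_le_one hL0 hL hne hf).triple ?_ (by omega)
  rintro ⟨val, par⟩ hr
  obtain ⟨hT, hreach⟩ := hr.tree hN hx
  simp only at hT hreach ⊢
  set d : V → ℝ := fun y => (val y).untopD 0 with hd
  set v : V → ℝ := fun y => (v₀ y).getD 0 with hv
  have hvs : ∀ t a, v₀ t = some a → v t = a := fun t a h => by simp [hv, h]
  refine Triple.charge_bind (B := 27 * N.size L) ?_ (by omega)
  refine Triple.select_bind (B := 26 * N.size L) ?_ (by omega)
  set T := N.verts.filter (fun t => (v₀ t).isSome && decide (val t < ⊤)) with hTdef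
  have hTlen : T.length ≤ N.verts.length := List.length_filter_le _ _
  have hmemT : ∀ t, t ∈ T ↔ (∃ a, v₀ t = some a) ∧ ∃ l, N.Walk t x l := by
    intro t
    rw [hTdef, List.mem_filter, Bool.and_eq_true, decide_eq_true_iff, Option.isSome_iff_exists]
    constructor
    · rintro ⟨h1, h2, h3⟩
      exact ⟨h2, (hreach t h1).1 h3⟩
    · rintro ⟨h1, l, h2⟩
      have h3 := (h2.mem_iff hN).2 hx
      exact ⟨h3, h1, (hreach t h3).2 ⟨l, h2⟩⟩
  have hTw : ∀ t a l, v₀ t = some a → N.Walk t x l → t ∈ T ∧ d t ≤ l ∧ v t = a :=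
    fun t a l h1 h2 => ⟨(hmemT t).2 ⟨⟨a, h1⟩, l, h2⟩, hT.le t l h2, hvs t a h1⟩
  by_cases hxs : (v₀ x).isSome
  · simp only [hxs, if_true]
    obtain ⟨a, ha⟩ := Option.isSome_iff_exists.1 hxs
    have hdx : d x = 0 := hT.dist_self hN
    refine Triple.select_bind (B := 25 * N.size L) ?_ (by omega)
    have hT₁ : (T.filter (fun t => decide (t ≠ x))).length ≤ N.verts.length :=
      (List.length_filter_le _ _).trans hTlen
    refine Triple.argmax_bind (B := 24 * N.size L) ?_ (by omega)
    change Triple (match (T.filter (fun t => decide (t ≠ x))).argmax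
      (fun y => |v x - v y| / d y) with
      | none => ret none
      | some y =>
        if v x ≥ v y then do
          let P ← pathThrough fuel v d par x y
          ret (some P)
        else do
          let P ← pathThrough fuel v d par y x
          ret (some P)) _ _
    cases harg : (T.filter (fun t => decide (t ≠ x))).argmax (fun y => |v x - v y| / d y) with
    | none =>
      refine Triple.ret_nat ⟨(fun _ h => by cases h), fun _ => ⟨by simp [ha], ?_⟩⟩
      rw [List.argmax_eq_none] at harg
      -- With `x` as the only terminal in reach, every terminal walk through `x` has voltage drop 0
      -- and hence no positive gradient.
      have hall : ∀ t b l, v₀ t = some b → N.Walk t x l → t = x := by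
        intro t b l h1 h2
        by_contra h3
        have : t ∈ T.filter (fun t => decide (t ≠ x)) :=
          List.mem_filter.2 ⟨(hTw t b l h1 h2).1, by simpa using h3⟩
        rw [harg] at this
        cases this
      rintro β hβ ⟨t₁, t₂, a₁, a₂, l₁, l₂, h1, h2, h3, h4, h5⟩
      have e1 := hall _ _ _ h1 h3
      have e2 := hall _ _ _ h2 h4.symm
      rw [e1, ha] at h1
      rw [e2, ha] at h2
      cases h1; cases h2
      have := mul_nonneg hβ (add_nonneg (h3.nonneg hN) (h4.nonneg hN))
      linarith
    | some y =>
      obtain ⟨hyT, hyx⟩ := List.mem_filter.1 (List.argmax_mem harg)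
      have hyx : y ≠ x := by simpa using hyx
      obtain ⟨⟨b, hb⟩, l, hl⟩ := (hmemT y).1 hyT
      have hdy : 0 < d y := hT.dist_pos hN hl hyx
      have hva := hvs x a ha
      have hvb := hvs y b hb
      obtain ⟨z, hz⟩ : ∃ z, par y = some z := by
        cases hp : par y with
        | none => exact absurd (hT.root y l hl hp) hyx
        | some z => exact ⟨z, rfl⟩
      -- The neighbour of the terminal `y` on the path cannot be a terminal, as edges between
      -- terminals have been removed. It is the non-terminal that the path will fix.
      have hzf : v₀ z = none := by
        obtain ⟨c, h1, _⟩ := hT.ptr y l z hl hz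
        exact (H.free y z c h1).resolve_left (by simp [hb])
      have hbound : ∀ t a' l', v₀ t = some a' → N.Walk t x l' →
          |a - a'| ≤ |a - b| / d y * l' := by
        intro t a' l' h1 h2
        obtain ⟨h3, h4, h5⟩ := hTw t a' l' h1 h2
        have hg : 0 ≤ |a - b| / d y := div_nonneg (abs_nonneg _) hdy.le
        by_cases htx : t = x
        · rw [htx, ha] at h1
          cases h1
          simpa using mul_nonneg hg (h2.nonneg hN)
        · have hdt := hT.dist_pos hN h2 htx
          have h6 := List.le_of_mem_argmax (List.mem_filter.2 ⟨h3, by simpa using htx⟩) harg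
          simp only [hva, h5, hvb] at h6
          rw [div_le_iff₀ hdt] at h6
          exact h6.trans (mul_le_mul_of_nonneg_left h4 hg)
      -- A terminal walk through the terminal `x` splits at `x` into two parts whose gradients are
      -- bounded separately.
      have hHP : ¬ HP N v₀ (|a - b| / d y) x := by
        rintro ⟨t₁, t₂, a₁, a₂, l₁, l₂, h1, h2, h3, h4, h5⟩
        have h6 := hbound _ _ _ h1 h3
        have h7 := hbound _ _ _ h2 h4.symm
        have h8 := neg_abs_le (a - a₁)
        have h9 := le_abs_self (a - a₂)
        rw [mul_add] at h5
        linarith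
      simp only [hva, hvb]
      split_ifs with hge
      · refine (triple_pathThrough hN hx hT (by omega) (Net.Walk.nil x) hl ha hb hva hvb hge
          (by rw [hdx, zero_add]; exact hdy) (Or.inr (Or.inr hz)) hzf ?_).le_nat (by omega)
        rwa [hdx, zero_add, ← abs_of_nonneg (sub_nonneg.2 hge)]
      · refine (triple_pathThrough hN hx hT (by omega) hl (Net.Walk.nil x) hb ha hvb hva
          (not_le.1 hge).le (by rw [hdx, add_zero]; exact hdy) (Or.inr (Or.inl hz)) hzf
          ?_).le_nat (by omega)
        rwa [hdx, add_zero, ← abs_of_nonneg (sub_nonneg.2 (not_le.1 hge).le), abs_sub_comm]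
  · have hxn : v₀ x = none := by simpa using hxs
    simp only [hxn, Option.isSome_none, Bool.false_eq_true, if_false]
    have hdT : ∀ t ∈ T, 0 < d t := by
      intro t ht
      obtain ⟨⟨b, hb⟩, l, hl⟩ := (hmemT t).1 ht
      refine hT.dist_pos hN hl ?_
      rintro rfl
      rw [hxn] at hb
      cases hb
    have hTne : T ≠ [] := by
      obtain ⟨t, b, l, h1, h2⟩ := H.reach x hx
      exact List.ne_nil_of_mem (hTw t b l h1 h2).1
    refine Triple.bind_nat (B := 4 * N.verts.length)
      (triple_starSteepestPath v d fuel T hTne hdT (by omega)) ?_ (by omega)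
    rintro ⟨t₁, t₂⟩ ⟨h1, h2, h3, h4⟩
    simp only at h1 h2 h3 h4
    obtain ⟨⟨a₁, ha₁⟩, l₁, hl₁⟩ := (hmemT t₁).1 h1
    obtain ⟨⟨a₂, ha₂⟩, l₂, hl₂⟩ := (hmemT t₂).1 h2
    have hv₁ := hvs _ _ ha₁
    have hv₂ := hvs _ _ ha₂
    have hd12 := add_pos (hdT _ h1) (hdT _ h2)
    rw [hv₁, hv₂] at h3 h4
    refine triple_pathThrough hN hx hT (by omega) hl₁ hl₂ ha₁ ha₂ hv₁ hv₂ h3 hd12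
      (Or.inl rfl) hxn ?_
    -- A steep walk through `x` can only become steeper when its halves are replaced by shortest
    -- paths, and then it is a path in the star.
    rintro ⟨s₁, s₂, b₁, b₂, m₁, m₂, e1, e2, e3, e4, e5⟩
    obtain ⟨g1, g2, g3⟩ := hTw _ _ _ e1 e3
    obtain ⟨g4, g5, g6⟩ := hTw _ _ _ e2 e4.symm
    refine h4 s₁ g1 ⟨s₂, g4, ?_⟩
    rw [g3, g6]
    refine lt_of_le_of_lt ?_ (e5.trans_le (le_abs_self _))
    exact mul_le_mul_of_nonneg_left (add_le_add g2 g5)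
      (div_nonneg (sub_nonneg.2 h3) hd12.le)

end

section

open Prog

variable {V : Type} [DecidableEq V]

/-! ### Steepest paths -/

theorem spec_compVLow {N : Net V} (hN : N.Valid) {v₀ : V → Option ℝ} {α : ℝ} (hα : 0 ≤ α)
    (hr : ∀ x ∈ N.verts, ∃ t a l, v₀ t = some a ∧ N.Walk t x l)
    {L : ℕ} (hL0 : 0 < L) (hL : N.verts.length < 2 ^ L) (hne : N.verts ≠ []) {fuel : ℕ}
    (hf : N.verts.length + 3 * L + 1 < fuel) :
    Spec (compVLow fuel N v₀ α) (fun lo k =>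
      (∀ x ∈ N.verts, (∃ t a l, v₀ t = some a ∧ N.Walk t x l ∧ lo x = a + α * l) ∧
        ∀ t a l, v₀ t = some a → N.Walk t x l → lo x ≤ a + α * l) ∧
      k ≤ 101 * N.size L) := by
  have hsize : N.verts.length ≤ N.size L :=
    (Nat.le_mul_of_pos_right _ hL0).trans (Nat.le_add_left _ _)
  unfold compVLow
  rw [spec_bind]
  refine (spec_modDijkstra hN v₀ hα hL0 hL hne hf).mono ?_
  rintro ⟨val, par⟩ k ⟨H, hk⟩
  simp only [spec_bind, spec_charge, spec_ret]
  refine ⟨fun x hx => ?_, by omega⟩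
  have htop : val x ≠ ⊤ := by
    obtain ⟨t, a, l, h1, h2⟩ := hr x hx
    exact ne_top_of_le_ne_top WithTop.coe_ne_top (H.le t a x l hx h1 h2)
  obtain ⟨t, a, l, h1, h2, h3⟩ := H.att x hx htop
  simp only at h3
  refine ⟨⟨t, a, l, h1, h2, by rw [h3]; rfl⟩, fun t' a' l' h4 h5 => ?_⟩
  have h6 := H.le t' a' x l' hx h4 h5
  simp only at h6
  rw [h3] at h6 ⊢
  exact WithTop.coe_le_coe.1 h6

/-- Negating the voltages turns the maximum into the minimum that `modDijkstra` computes. -/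
theorem spec_compVHigh {N : Net V} (hN : N.Valid) {v₀ : V → Option ℝ} {α : ℝ} (hα : 0 ≤ α)
    (hr : ∀ x ∈ N.verts, ∃ t a l, v₀ t = some a ∧ N.Walk t x l)
    {L : ℕ} (hL0 : 0 < L) (hL : N.verts.length < 2 ^ L) (hne : N.verts ≠ []) {fuel : ℕ}
    (hf : N.verts.length + 3 * L + 1 < fuel) :
    Spec (compVHigh fuel N v₀ α) (fun hi k =>
      (∀ x ∈ N.verts, (∃ t a l, v₀ t = some a ∧ N.Walk t x l ∧ hi x = a - α * l) ∧
        ∀ t a l, v₀ t = some a → N.Walk t x l → a - α * l ≤ hi x) ∧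
      k ≤ 102 * N.size L) := by
  have hneg : ∀ t a, (v₀ t).map (fun a => -a) = some a ↔ v₀ t = some (-a) := by
    intro t a
    rw [Option.map_eq_some_iff]
    constructor
    · rintro ⟨b, h1, rfl⟩
      simpa using h1
    · exact fun h => ⟨-a, h, neg_neg a⟩
  have hsize : N.verts.length ≤ N.size L :=
    (Nat.le_mul_of_pos_right _ hL0).trans (Nat.le_add_left _ _)
  unfold compVHigh
  rw [spec_bind, spec_charge, spec_bind]
  refine (spec_modDijkstra hN (fun x => (v₀ x).map (fun a => -a)) hα hL0 hL hne hf).mono ?_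
  rintro ⟨val, par⟩ k ⟨H, hk⟩
  simp only [spec_bind, spec_charge, spec_ret]
  refine ⟨fun x hx => ?_, by omega⟩
  have htop : val x ≠ ⊤ := by
    obtain ⟨t, a, l, h1, h2⟩ := hr x hx
    exact ne_top_of_le_ne_top WithTop.coe_ne_top
      (H.le t (-a) x l hx ((hneg _ _).2 (by rwa [neg_neg])) h2)
  obtain ⟨t, a, l, h1, h2, h3⟩ := H.att x hx htop
  simp only at h3
  refine ⟨⟨t, -a, l, (hneg _ _).1 h1, h2, ?_⟩, fun t' a' l' h4 h5 => ?_⟩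
  · rw [h3, WithTop.untopD_coe]; ring
  · have h6 := H.le t' (-a') x l' hx ((hneg _ _).2 (by rwa [neg_neg])) h5
    simp only at h6
    rw [h3] at h6 ⊢
    have := WithTop.coe_le_coe.1 h6
    rw [WithTop.untopD_coe]
    linarith

theorem spec_compHighPressGraph {N : Net V} {v₀ : V → Option ℝ} (H : Ready N v₀) {α : ℝ}
    (hα : 0 ≤ α) {L : ℕ} (hL0 : 0 < L) (hL : N.verts.length < 2 ^ L) (hne : N.verts ≠ [])
    {fuel : ℕ} (hf : N.verts.length + 3 * L + 1 < fuel) :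
    Spec (compHighPressGraph fuel N v₀ α) (fun N' k => N' = hpNet N v₀ α ∧
      k ≤ 204 * N.size L) := by
  have hsize : N.verts.length ≤ N.size L :=
    (Nat.le_mul_of_pos_right _ hL0).trans (Nat.le_add_left _ _)
  have hsize' : N.edges.length + N.verts.length ≤ N.size L := by
    have := Nat.le_mul_of_pos_right N.verts.length hL0
    simp only [Net.size]
    omega
  unfold compHighPressGraph
  rw [spec_bind]
  refine (spec_compVLow H.valid hα H.reach hL0 hL hne hf).mono ?_
  rintro lo k ⟨hlo, hk⟩
  rw [spec_bind]
  refine (spec_compVHigh H.valid hα H.reach hL0 hL hne hf).mono ?_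
  rintro hi k' ⟨hhi, hk'⟩
  simp only [spec_bind, spec_select, spec_ret]
  refine ⟨?_, by omega⟩
  -- The terminals attaining the two extremes are the ends of the best candidate for a walk of
  -- gradient above `α` through `x`.
  have key : ∀ x ∈ N.verts, hi x > lo x ↔ HP N v₀ α x := by
    intro x hx
    constructor
    · intro h
      obtain ⟨⟨t, a, l, h1, h2, h3⟩, -⟩ := hlo x hx
      obtain ⟨⟨t', a', l', h1', h2', h3'⟩, -⟩ := hhi x hx
      refine ⟨t', t, a', a, l', l, h1', h1, h2', h2.symm, ?_⟩
      rw [mul_add]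
      linarith
    · rintro ⟨t₁, t₂, a₁, a₂, l₁, l₂, h1, h2, h3, h4, h5⟩
      have h6 := (hhi x hx).2 _ _ _ h1 h3
      have h7 := (hlo x hx).2 _ _ _ h2 h4.symm
      rw [mul_add] at h5
      change lo x < hi x
      linarith
  classical
  unfold hpNet
  congr 1
  · refine List.filter_congr fun x hx => ?_
    rw [Bool.eq_iff_iff, decide_eq_true_iff, decide_eq_true_iff, key x hx]
  · refine List.filter_congr fun e he => ?_
    obtain ⟨h1, h2, -⟩ := H.valid.edge e he
    rw [Bool.eq_iff_iff, Bool.and_eq_true, decide_eq_true_iff, decide_eq_true_iff,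
      decide_eq_true_iff, key _ h1, key _ h2]

/-- What `SteepestPath` guarantees. -/
def SPost (N : Net V) (v₀ : V → Option ℝ) (P : TPath V) : Prop :=
  PPost N v₀ P ∧ ∀ x, ¬ HP N v₀ P.grad x

omit [DecidableEq V] in
-- An edge of the subgraph witnesses pressure above `α`, so the path found there has gradient at
-- least `α`; at or above that level both networks have the same vertices of high pressure.
theorem sPost_of_hpNet {N : Net V} {v₀ : V → Option ℝ} (H : Ready N v₀) {α : ℝ}
    (hne : (hpNet N v₀ α).edges ≠ []) {P : TPath V} (hP : SPost (hpNet N v₀ α) v₀ P) :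
    SPost N v₀ P := by
  classical
  obtain ⟨h1, h2⟩ := hP
  have hE : ∀ e ∈ (hpNet N v₀ α).edges, e ∈ N.edges := fun e he => (mem_hpNet_edges.1 he).1
  have hα : α ≤ P.grad := by
    by_contra hlt
    obtain ⟨e, he⟩ := List.exists_mem_of_ne_nil _ hne
    have h3 := (mem_hpNet_edges.1 he).2.1.hpNet H.valid le_rfl
    exact h2 _ (h3.anti (H.hpNet α).valid (not_le.1 hlt).le)
  refine ⟨⟨h1.grad_nonneg, h1.length_le.trans ?_, fun q hq => ?_, h1.free⟩,
    fun x hx => h2 x (hx.hpNet H.valid hα)⟩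
  · have : (hpNet N v₀ α).verts.length ≤ N.verts.length := List.length_filter_le _ _
    omega
  · obtain ⟨t, t', b', b, h3, h4, h5, h6, h7⟩ := h1.walk q hq
    exact ⟨t, t', b', b, h3, h4.mono hE, h5, h6.mono hE, h7⟩

/-- The size is a sum over edges and vertices, and each summand needs its own random pivot: the edge
bounds the surviving edges, the vertex the surviving vertices. The work outside the recursion is at
most 610 times the size, and the halving turns this into 1220. Vertices carry weight `L` throughout.
-/
theorem triple_steepestPath {v₀ : V → Option ℝ} {L : ℕ} (hL0 : 0 < L) (fuel : ℕ) :
    ∀ N : Net V, Ready N v₀ → N.edges ≠ [] → N.verts.length < 2 ^ L →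
    2 * N.verts.length + 3 * L + 3 < fuel →
    Triple (steepestPath fuel N v₀) (SPost N v₀) (1220 * N.size L : ℕ) := by
  induction fuel with
  | zero => intro N _ _ _ hf; omega
  | succ fuel ih =>
    intro N H hE hL hf
    have hN := H.valid
    obtain ⟨e₀, he₀⟩ := List.exists_mem_of_ne_nil _ hE
    have hV : N.verts ≠ [] := List.ne_nil_of_mem (hN.edge e₀ he₀).1
    have hEpos := List.length_pos_iff.2 hE
    have hsize : N.size L = N.edges.length + L * N.verts.length := by
      rw [Net.size, mul_comm]
    have hsize' : N.verts.length ≤ L * N.verts.length := Nat.le_mul_of_pos_left _ hL0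
    have hf' : N.verts.length + 3 * L + 1 < fuel := by omega
    set HV : ℝ → V → Prop := fun β x => HP N v₀ β x with hHV
    set HE : ℝ → V × V × ℝ → Prop := fun β e => HP N v₀ β e.1 ∧ HP N v₀ β e.2.1 with hHE
    have hHVa : ∀ a x y, x ≤ y → HV y a → HV x a := fun a x y hxy h => h.anti hN hxy
    have hHEa : ∀ a x y, x ≤ y → HE y a → HE x a := fun a x y hxy h =>
      ⟨h.1.anti hN hxy, h.2.anti hN hxy⟩
    unfold steepestPath
    refine Triple.tick_nat (B := 1219 * N.size L) ?_ (by omega)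
    refine Triple.sample_bind_nat hE
      (fun e => (600 * N.size L + N.verts.length + 610 * (L * N.verts.length)) +
        2 * 610 * numBeats HE N.edges e) (fun e he => ?_)
      (sum_numBeats hHEa N.edges _ 610) (by omega)
    obtain ⟨hx₁, hx₂, -⟩ := hN.edge e he
    refine Triple.sample_bind_nat hV
      (fun x => (599 * N.size L + 2 * 610 * numBeats HE N.edges e) +
        2 * (610 * L) * numBeats HV N.verts x) (fun x₃ hx₃ => ?_)
      (sum_numBeats hHVa N.verts _ (610 * L)) (by rw [mul_assoc 610]; omega)
    refine Triple.bind_nat (triple_vertexSteepestPath H hx₁ hL0 hL hf')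
      (B := (469 * N.size L + 2 * 610 * numBeats HE N.edges e) +
        2 * (610 * L) * numBeats HV N.verts x₃) (fun P₁ hP₁ => ?_) (by omega)
    refine Triple.bind_nat (triple_vertexSteepestPath H hx₂ hL0 hL hf')
      (B := (339 * N.size L + 2 * 610 * numBeats HE N.edges e) +
        2 * (610 * L) * numBeats HV N.verts x₃) (fun P₂ hP₂ => ?_) (by omega)
    refine Triple.bind_nat (triple_vertexSteepestPath H hx₃ hL0 hL hf')
      (B := (209 * N.size L + 2 * 610 * numBeats HE N.edges e) +
        2 * (610 * L) * numBeats HV N.verts x₃) (fun P₃ hP₃ => ?_) (by omega)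
    have hlen : (P₁.toList ++ P₂.toList ++ P₃.toList).length ≤ 3 := by
      cases P₁ <;> cases P₂ <;> cases P₃ <;> simp
    refine Triple.argmax_bind (B := (204 * N.size L + 2 * 610 * numBeats HE N.edges e) +
        2 * (610 * L) * numBeats HV N.verts x₃) ?_ (by omega)
    have hmem : ∀ P, P ∈ P₁.toList ++ P₂.toList ++ P₃.toList ↔
        P₁ = some P ∨ P₂ = some P ∨ P₃ = some P := by
      intro P
      simp
    cases harg : (P₁.toList ++ P₂.toList ++ P₃.toList).argmax (fun P => P.grad) with
    | none =>
      rw [List.argmax_eq_none] at harg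
      have hno : ∀ P, ¬ (P₁ = some P ∨ P₂ = some P ∨ P₃ = some P) := by
        intro P
        rw [← hmem, harg]
        simp
      have h1 : P₁ = none := Option.eq_none_iff_forall_ne_some.2 fun P h => hno P (Or.inl h)
      have h2 : P₂ = none :=
        Option.eq_none_iff_forall_ne_some.2 fun P h => hno P (Or.inr (Or.inl h))
      -- One end of the sampled edge is not a terminal, and there a path is always found; so the
      -- list of candidates cannot be empty.
      rcases H.free e.1 e.2.1 e.2.2 (Or.inl he) with h3 | h3
      · exact absurd h3 (hP₁.2 h1).1
      · exact absurd h3 (hP₂.2 h2).1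
    | some P =>
      have hPm := (hmem P).1 (List.argmax_mem harg)
      have hPP : PPost N v₀ P := by
        rcases hPm with h | h | h
        · exact (hP₁.1 P h).1
        · exact (hP₂.1 P h).1
        · exact (hP₃.1 P h).1
      have hno : ∀ x o, VPost N v₀ x o → (∀ Q, o = some Q → P₁ = some Q ∨ P₂ = some Q ∨
          P₃ = some Q) → ¬ HP N v₀ P.grad x := by
        intro x o ho hmo
        cases o with
        | none => exact (ho.2 rfl).2 _ hPP.grad_nonneg
        | some Q =>
          have h1 := List.le_of_mem_argmax ((hmem Q).2 (hmo Q rfl)) harg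
          exact fun h => (ho.1 Q rfl).2 (h.anti hN h1)
      have hn₁ := hno _ _ hP₁ (fun Q h => Or.inl h)
      have hn₃ := hno _ _ hP₃ (fun Q h => Or.inr (Or.inr h))
      simp only
      refine Triple.bind_nat (spec_compHighPressGraph H hPP.grad_nonneg hL0 hL hV hf').triple
        (B := 2 * 610 * numBeats HE N.edges e + 2 * (610 * L) * numBeats HV N.verts x₃)
        ?_ (by omega)
      rintro N' rfl
      split_ifs with hemp
      · refine Triple.ret_nat ⟨hPP, fun x hx => ?_⟩
        exact (hx.hpNet hN le_rfl).exists_edge (List.isEmpty_iff.1 hemp)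
      · have hE' : (hpNet N v₀ P.grad).edges ≠ [] := by simpa [List.isEmpty_iff] using hemp
        have hlt : (hpNet N v₀ P.grad).verts.length < N.verts.length := by
          classical
          unfold hpNet
          rw [List.length_filter_lt_length_iff_exists]
          exact ⟨x₃, hx₃, by simpa using hn₃⟩
        have hlV : (hpNet N v₀ P.grad).verts.length ≤ numBeats HV N.verts x₃ := by
          classical
          exact length_filter_le_numBeats (H := HV) (fun x _ h => by simpa using h) hn₃
        -- A surviving edge has both ends of high pressure, whereas the sampled edge already fails
        -- at its first end.
        have hlE : (hpNet N v₀ P.grad).edges.length ≤ numBeats HE N.edges e := by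
          classical
          exact length_filter_le_numBeats (H := HE) (fun x _ h => by simpa using h)
            (fun h => hn₁ h.1)
        refine ((ih _ (H.hpNet _) hE' (by omega) (by omega)).mono
          (fun Q hQ => sPost_of_hpNet H hE' hQ) le_rfl).le_nat ?_
        have h4 := Nat.mul_le_mul_right L hlV
        have h5 : 2 * (610 * L) * numBeats HV N.verts x₃ =
          1220 * (numBeats HV N.verts x₃ * L) := by ring
        rw [h5]
        simp only [Net.size]
        omega

end

section

open Prog

variable {V : Type}

/-! ### Lexicographic comparison -/

/-- Equal heads cancel from both counts. If the first difference had the larger entry on the left,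
that entry would be missing on the right, contradicting the counts above `M` or at `M`. -/
theorem lex_of_count {M : ℝ} : ∀ {s r : List ℝ}, s.Pairwise (· ≥ ·) → r.Pairwise (· ≥ ·) →
    (∀ x, M < x → s.count x = r.count x) → s.count M < r.count M → List.Lex (· < ·) s r := by
  intro s
  induction s with
  | nil =>
    intro r _ _ _ h
    cases r with
    | nil => simp at h
    | cons b r => exact List.Lex.nil
  | cons a s ih =>
    intro r hs hr hgt hM
    cases r with
    | nil => simp at hM
    | cons b r =>
      rcases lt_trichotomy a b with hab | rfl | hab
      · exact List.Lex.rel hab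
      · refine List.Lex.cons (ih (List.pairwise_cons.1 hs).2 (List.pairwise_cons.1 hr).2
          (fun x hx => ?_) ?_)
        · have := hgt x hx
          simp only [List.count_cons] at this
          omega
        · simp only [List.count_cons] at hM
          omega
      · exfalso
        have hle : ∀ x ∈ b :: r, x ≤ b := by
          intro x hx
          rcases List.mem_cons.1 hx with rfl | hx
          · exact le_rfl
          · exact (List.pairwise_cons.1 hr).1 x hx
        rcases lt_or_ge M a with h | h
        · have h1 := hgt a h
          rw [List.count_eq_zero.2 fun h2 => not_lt.2 (hle a h2) hab] at h1
          simp at h1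
        · rw [List.count_eq_zero.2 fun h2 => absurd (hle M h2) (not_le.2 (hab.trans_le h))] at hM
          omega

theorem lex_sort_map {ι : Type} (s : Finset ι) (f g : ι → ℝ) {β : ℝ}
    (h1 : ∃ e ∈ s, f e ≤ β ∧ β < g e) (h2 : ∀ e ∈ s, f e ≤ β ∨ f e = g e) :
    List.Lex (· < ·) ((s.val.map f).sort (· ≥ ·)) ((s.val.map g).sort (· ≥ ·)) := by
  classical
  have hcount : ∀ (f : ι → ℝ) x, ((s.val.map f).sort (· ≥ ·)).count x =
      (s.filter fun e => x = f e).card := by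
    intro f x
    rw [← Multiset.coe_count, Multiset.sort_eq, Multiset.count_map]
    rfl
  have hne : (s.filter fun e => f e ≠ g e ∧ β < g e).Nonempty := by
    obtain ⟨e, he, h3, h4⟩ := h1
    exact ⟨e, Finset.mem_filter.2 ⟨he, (h3.trans_lt h4).ne, h4⟩⟩
  -- The largest value of `g` above `β` at which the functions differ is the decisive level: above
  -- it the level sets agree, and at it those of `f` lie strictly inside those of `g`.
  obtain ⟨m, hm, hmax⟩ := Finset.exists_max_image _ g hne
  obtain ⟨hms, hmne, hmβ⟩ := Finset.mem_filter.1 hm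
  have hfg : ∀ e ∈ s, β < f e → f e = g e := fun e he h =>
    (h2 e he).resolve_left (not_le.2 h)
  refine lex_of_count (M := g m) (Multiset.pairwise_sort _ _) (Multiset.pairwise_sort _ _)
    (fun x hx => ?_) ?_
  · rw [hcount, hcount]
    congr 1
    refine Finset.filter_congr fun e he => ⟨?_, ?_⟩
    · rintro rfl
      exact hfg e he (hmβ.trans hx)
    · rintro rfl
      by_contra h3
      have := hmax e (Finset.mem_filter.2 ⟨he, fun h => h3 h.symm, hmβ.trans hx⟩)
      linarith
  · rw [hcount, hcount]
    refine Finset.card_lt_card ((Finset.ssubset_iff_of_subset ?_).2 ⟨m, ?_, ?_⟩)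
    · intro e he
      obtain ⟨he, h3⟩ := Finset.mem_filter.1 he
      refine Finset.mem_filter.2 ⟨he, h3.trans (hfg e he ?_)⟩
      rw [← h3]; exact hmβ
    · exact Finset.mem_filter.2 ⟨hms, rfl⟩
    · intro h
      exact hmne (Finset.mem_filter.1 h).2.symm

/-! ### Correctness of `CompLexMin` -/

/-- All terminal walks have gradient at most `α`. -/
def GradLE (N : Net V) (v₀ : V → Option ℝ) (α : ℝ) : Prop :=
  ∀ t t' a a' l, v₀ t = some a → v₀ t' = some a' → N.Walk t t' l → a - a' ≤ α * l

theorem SPost.gradLE {N : Net V} {v₀ : V → Option ℝ} {P : TPath V} (h : SPost N v₀ P) :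
    GradLE N v₀ P.grad := by
  intro t t' a a' l h1 h2 h3
  by_contra h4
  exact h.2 t ⟨t, t', a, a', 0, l, h1, h2, Net.Walk.nil t, h3, by rw [zero_add]; exact not_le.1 h4⟩

theorem Net.Walk.sub_le {N : Net V} {w : V → ℝ} {β : ℝ}
    (h : ∀ x y c, N.Adj x y c → w x - w y ≤ β * c) {x y : V} {l : ℝ} (hw : N.Walk x y l) :
    w x - w y ≤ β * l := by
  induction hw with
  | nil => simp
  | snoc _ h2 ih =>
    have := h _ _ _ h2
    rw [mul_add]
    linarith

/-- The properties of the output `v` of `CompLexMin`: it extends `v₀`, its gradient is bounded by that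
of the terminal walks, and any other extension is worse above some threshold. -/
structure Good (N : Net V) (v₀ : V → Option ℝ) (v : V → ℝ) : Prop where
  ext : Extends v v₀
  grad : ∀ α, GradLE N v₀ α → ∀ x y c, N.Adj x y c → v x - v y ≤ α * c
  best : ∀ w, Extends w v₀ → (∀ x ∈ N.verts, w x = v x) ∨ ∃ β,
    (∃ x y c, N.Adj x y c ∧ β * c < w x - w y ∧ v x - v y ≤ β * c ∧ v y - v x ≤ β * c) ∧
    ∀ x y c, N.Adj x y c → (v x - v y ≤ β * c ∧ v y - v x ≤ β * c) ∨ (w x = v x ∧ w y = v y)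

/-- The network without the edges between terminals. -/
def freeNet (N : Net V) (v₀ : V → Option ℝ) : Net V :=
  { verts := N.verts, edges := N.edges.filter (fun e => !((v₀ e.1).isSome && (v₀ e.2.1).isSome)) }

theorem freeNet_adj {N : Net V} {v₀ : V → Option ℝ} {x y : V} {c : ℝ} :
    (freeNet N v₀).Adj x y c ↔ N.Adj x y c ∧ (v₀ x = none ∨ v₀ y = none) := by
  simp only [Net.Adj, freeNet, List.mem_filter, Bool.not_and, Bool.or_eq_true,
    Bool.not_eq_true', Option.isSome_eq_false_iff, Option.isNone_iff_eq_none]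
  tauto

/-- Deleting edges between terminals separates no vertex from all terminals: a walk can be restarted
at the last terminal it visits. -/
theorem freeNet_ready {N : Net V} (hN : N.Valid) {v₀ : V → Option ℝ}
    (hr : ∀ x ∈ N.verts, ∃ t a l, v₀ t = some a ∧ N.Walk t x l) : Ready (freeNet N v₀) v₀ where
  valid := ⟨hN.nodup, fun e he => hN.edge e (List.mem_filter.1 he).1⟩
  free _ _ _ h := (freeNet_adj.1 h).2
  reach x hx := by
    obtain ⟨t, a, l, h1, h2⟩ := hr x hx
    clear hx
    induction h2 with
    | nil => exact ⟨t, a, 0, h1, Net.Walk.nil t⟩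
    | @snoc y z l c _ h3 ih =>
      obtain ⟨t', a', l', h4, h5⟩ := ih
      cases hz : v₀ z with
      | some b => exact ⟨z, b, 0, hz, Net.Walk.nil z⟩
      | none => exact ⟨t', a', l' + c, h4, h5.snoc (freeNet_adj.2 ⟨h3, Or.inr hz⟩)⟩

/-- Every value of `u` lies on a terminal path of gradient `α`. -/
def OnPath (N : Net V) (v₀ u : V → Option ℝ) (α : ℝ) : Prop :=
  ∀ x a, u x = some a → (∃ t b l, v₀ t = some b ∧ N.Walk t x l ∧ a = b - α * l) ∧
    ∃ t b l, v₀ t = some b ∧ N.Walk x t l ∧ a = b + α * l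

/-- Extending a walk between fixed vertices at both ends by walks of gradient exactly `α` gives a
walk between original terminals; the added voltage drops and lengths cancel. -/
theorem OnPath.gradLE {N : Net V} {v₀ u : V → Option ℝ} {α : ℝ} (h : OnPath N v₀ u α)
    (hα : GradLE N v₀ α) : GradLE N u α := by
  intro x y a b l hx hy hw
  obtain ⟨⟨t, c, p, h1, h2, h3⟩, -⟩ := h x a hx
  obtain ⟨-, t', c', q, h4, h5, h6⟩ := h y b hy
  have := hα t t' c c' _ h1 h4 ((h2.trans hw).trans h5)
  rw [mul_add, mul_add] at this
  linarith

/-- If `w` respects the fixed path, the threshold of the recursive call serves. Otherwise the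
threshold is `P.grad`: the output never exceeds it on free edges, and `w` does so somewhere. -/
theorem good_of_fix {N : Net V} {v₀ u : V → Option ℝ} {P : TPath V}
    (hN : N.Valid) (hP : SPost (freeNet N v₀) v₀ P) (hu : OnPath (freeNet N v₀) v₀ u P.grad)
    (hext : ∀ x a, v₀ x = some a → u x = some a) {v : V → ℝ} (hv : Good (freeNet N v₀) u v) :
    Good N v₀ v := by
  have hN' : (freeNet N v₀).Valid := ⟨hN.nodup, fun e he => hN.edge e (List.mem_filter.1 he).1⟩
  have hvext : Extends v v₀ := fun x a h => hv.ext x a (hext x a h)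
  have hgrad := hv.grad P.grad (hu.gradLE hP.gradLE)
  have hsplit : ∀ x y c, N.Adj x y c → (freeNet N v₀).Adj x y c ∨
      ∃ a b, v₀ x = some a ∧ v₀ y = some b := by
    intro x y c h
    cases hx : v₀ x with
    | none => exact Or.inl (freeNet_adj.2 ⟨h, Or.inl hx⟩)
    | some a =>
      cases hy : v₀ y with
      | none => exact Or.inl (freeNet_adj.2 ⟨h, Or.inr hy⟩)
      | some b => exact Or.inr ⟨a, b, rfl, rfl⟩
  refine ⟨hvext, fun α hα x y c hxy => ?_, fun w hw => ?_⟩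
  · rcases hsplit x y c hxy with h | ⟨a, b, ha, hb⟩
    · obtain ⟨q, hq, hqf⟩ := hP.1.free
      obtain ⟨t, t', b', b, h1, h2, h3, h4, h5⟩ := hP.1.walk q hq
      -- A non-terminal on the path makes its length positive, so `P.grad` is the gradient of a
      -- genuine terminal walk and cannot exceed `α`.
      have hpos : 0 < q.2 := by
        refine (h2.eq_or_pos hN').resolve_left fun h => ?_
        rw [← h.1, h1] at hqf
        cases hqf
      have h6 := h4.nonneg hN'
      have hE : ∀ e ∈ (freeNet N v₀).edges, e ∈ N.edges := fun e he => (List.mem_filter.1 he).1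
      have h7 := hα t t' _ _ _ h1 h3 ((h2.mono hE).trans (h4.mono hE))
      have h8 : P.grad ≤ α := by
        refine le_of_mul_le_mul_right ?_ (add_pos_of_pos_of_nonneg hpos h6)
        refine le_trans (le_of_eq ?_) h7
        rw [mul_add]; linarith
      exact (hgrad x y c h).trans (mul_le_mul_of_nonneg_right h8 (hN'.adj h).2.2.le)
    · rw [hvext x a ha, hvext y b hb]
      exact hα x y a b c ha hb (Net.Walk.single hxy)
  · have hTT : ∀ x y a b, v₀ x = some a → v₀ y = some b → w x = v x ∧ w y = v y := by
      intro x y a b ha hb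
      rw [hvext x a ha, hvext y b hb, hw x a ha, hw y b hb]
      exact ⟨rfl, rfl⟩
    have hsub : ∀ x y c, (freeNet N v₀).Adj x y c → N.Adj x y c := fun x y c h =>
      (freeNet_adj.1 h).1
    by_cases hwu : Extends w u
    · rcases hv.best w hwu with h | ⟨β, ⟨x, y, c, h1, h2⟩, h3⟩
      · exact Or.inl h
      · refine Or.inr ⟨β, ⟨x, y, c, hsub _ _ _ h1, h2⟩, fun x y c hxy => ?_⟩
        rcases hsplit x y c hxy with h | ⟨a, b, ha, hb⟩
        · exact h3 x y c h
        · exact Or.inr (hTT x y a b ha hb)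
    · right
      -- If all edge gradients of `w` were at most `P.grad`, the two walks of gradient `P.grad`
      -- through each fixed vertex would bound `w` there from below and above by the same value.
      have hbad : ∃ x y c, (freeNet N v₀).Adj x y c ∧ P.grad * c < w x - w y := by
        by_contra hno
        have hno' : ∀ x y c, (freeNet N v₀).Adj x y c → w x - w y ≤ P.grad * c := by
          intro x y c h
          by_contra h'
          exact hno ⟨x, y, c, h, not_le.1 h'⟩
        refine hwu fun x a hx => ?_
        obtain ⟨⟨t, b, l, h1, h2, h3⟩, t', b', l', h1', h2', h3'⟩ := hu x a hx
        have h4 := h2.sub_le hno'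
        have h4' := h2'.sub_le hno'
        rw [hw t b h1] at h4
        rw [hw t' b' h1'] at h4'
        linarith
      obtain ⟨x, y, c, h1, h2⟩ := hbad
      refine ⟨P.grad, ⟨x, y, c, hsub _ _ _ h1, h2, hgrad _ _ _ h1, hgrad _ _ _ h1.symm⟩,
        fun x y c hxy => ?_⟩
      rcases hsplit x y c hxy with h | ⟨a, b, ha, hb⟩
      · exact Or.inl ⟨hgrad _ _ _ h, hgrad _ _ _ h.symm⟩
      · exact Or.inr (hTT x y a b ha hb)

variable [DecidableEq V]

theorem spec_fixPath (v₀ : V → Option ℝ) (P : TPath V) : Spec (fixPath v₀ P) (fun u k =>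
    k = P.steps.length ∧ (∀ x a, v₀ x = some a → u x = some a) ∧
    (∀ x a, u x = some a → v₀ x = some a ∨ ∃ q ∈ P.steps, q.1 = x ∧ a = P.start - P.grad * q.2) ∧
    ∀ q ∈ P.steps, u q.1 ≠ none) := by
  unfold fixPath
  refine (spec_loop (fun r u k => k + r.length = P.steps.length ∧
    (∀ q ∈ r, q ∈ P.steps) ∧ (∀ x a, v₀ x = some a → u x = some a) ∧
    (∀ x a, u x = some a → v₀ x = some a ∨ ∃ q ∈ P.steps, q.1 = x ∧ a = P.start - P.grad * q.2) ∧
    ∀ q ∈ P.steps, q ∈ r ∨ u q.1 ≠ none) ?_ ?_).mono ?_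
  · exact ⟨by omega, fun _ h => h, fun _ _ h => h, fun _ _ h => Or.inl h, fun _ h => Or.inl h⟩
  · rintro p r u k ⟨h1, h2, h3, h4, h5⟩
    simp only [List.length_cons] at h1
    rw [spec_ret]
    by_cases hp : u p.1 = none
    · simp only [hp, Option.isNone_none, if_true]
      refine ⟨by omega, fun q hq => h2 q (List.mem_cons_of_mem _ hq), fun x a hx => ?_,
        fun x a hx => ?_, fun q hq => ?_⟩
      · rw [Function.update_of_ne]
        · exact h3 x a hx
        · rintro rfl
          rw [h3 _ a hx] at hp
          cases hp
      · by_cases hxp : x = p.1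
        · subst hxp
          rw [Function.update_self] at hx
          cases hx
          exact Or.inr ⟨p, h2 p (by simp), rfl, rfl⟩
        · rw [Function.update_of_ne hxp] at hx
          exact h4 x a hx
      · by_cases hqp : q.1 = p.1
        · right; rw [hqp]; simp
        · rw [Function.update_of_ne hqp]
          refine (h5 q hq).imp_left fun h => (List.mem_cons.1 h).resolve_left ?_
          rintro rfl
          exact hqp rfl
    · have hp' : (u p.1).isNone = false := by simpa [Option.isSome_iff_ne_none] using hp
      simp only [hp', Bool.false_eq_true, if_false]
      refine ⟨by omega, fun q hq => h2 q (List.mem_cons_of_mem _ hq), h3, h4, fun q hq => ?_⟩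
      rcases h5 q hq with h | h
      · rcases List.mem_cons.1 h with rfl | h
        · exact Or.inr hp
        · exact Or.inl h
      · exact Or.inr h
  · rintro u k ⟨h1, -, h3, h4, h5⟩
    exact ⟨by simpa using h1, h3, h4, by simpa using h5⟩

omit [DecidableEq V] in
theorem onPath_of_fix {N : Net V} {v₀ u : V → Option ℝ} {P : TPath V} (hP : PPost N v₀ P)
    (h : ∀ x a, u x = some a →
      v₀ x = some a ∨ ∃ q ∈ P.steps, q.1 = x ∧ a = P.start - P.grad * q.2) :
    OnPath N v₀ u P.grad := by
  intro x a hx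
  rcases h x a hx with h1 | ⟨q, hq, rfl, rfl⟩
  · exact ⟨⟨x, a, 0, h1, Net.Walk.nil x, by simp⟩, x, a, 0, h1, Net.Walk.nil x, by simp⟩
  · obtain ⟨t, t', b', b, h1, h2, h3, h4, h5⟩ := hP.walk q hq
    exact ⟨⟨t, _, _, h1, h2, rfl⟩, t', b', b, h3, h4, h5⟩

/-- Each round fixes a vertex and costs 1220 sizes for the path; 5 more cover the filters, writing
the path, and the terminal check of the next round. -/
theorem triple_compLexMin {L : ℕ} (hL0 : 0 < L) (fuel : ℕ) : ∀ (N : Net V) (v₀ : V → Option ℝ),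
    N.Valid → (∀ x ∈ N.verts, ∃ t a l, v₀ t = some a ∧ N.Walk t x l) →
    N.verts.length < 2 ^ L →
    (N.verts.filter (fun x => (v₀ x).isNone)).length + 2 * N.verts.length + 3 * L + 3 < fuel →
    Triple (compLexMin fuel N v₀)
      (fun u => ∃ v, (∀ x ∈ N.verts, u x = some (v x)) ∧ Good N v₀ v)
      ((N.verts.filter (fun x => (v₀ x).isNone)).length * (1225 * N.size L) +
        N.verts.length + 1 : ℕ) := by
  induction fuel with
  | zero => intro N v₀ _ _ _ hf; omega
  | succ fuel ih =>
    intro N v₀ hN hr hL hf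
    unfold compLexMin
    refine Triple.tick_nat (B := (N.verts.filter (fun x => (v₀ x).isNone)).length *
      (1225 * N.size L) + N.verts.length) ?_ (by omega)
    refine Triple.select_bind (B := (N.verts.filter (fun x => (v₀ x).isNone)).length *
      (1225 * N.size L)) ?_ (by omega)
    split_ifs with hemp
    · refine Triple.ret_nat ⟨fun x => (v₀ x).getD 0, ?_⟩
      have hall : ∀ x ∈ N.verts, v₀ x = some ((v₀ x).getD 0) := by
        intro x hx
        cases hv : v₀ x with
        | some a => rfl
        | none =>
          have : x ∈ N.verts.filter (fun x => (v₀ x).isNone) :=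
            List.mem_filter.2 ⟨hx, by simp [hv]⟩
          rw [List.isEmpty_iff.1 hemp] at this
          cases this
      refine ⟨hall, fun x a h => by simp [h], fun α hα x y c hxy => ?_,
        fun w hw => Or.inl fun x hx => hw x _ (hall x hx)⟩
      exact hα x y _ _ c (hall x (hN.adj hxy).1) (hall y (hN.adj hxy).2.1) (Net.Walk.single hxy)
    · have H := freeNet_ready hN hr
      obtain ⟨x, hx⟩ := List.exists_mem_of_ne_nil _
        (show N.verts.filter (fun x => (v₀ x).isNone) ≠ [] by simpa [List.isEmpty_iff] using hemp)
      have hfree : 1 ≤ (N.verts.filter (fun x => (v₀ x).isNone)).length :=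
        List.length_pos_iff.2 (List.ne_nil_of_mem hx)
      obtain ⟨hxV, hxn⟩ := List.mem_filter.1 hx
      have hxn : v₀ x = none := by simpa using hxn
      have hE : (freeNet N v₀).edges ≠ [] := by
        obtain ⟨t, a, l, h1, h2⟩ := H.reach x hxV
        intro h3
        cases h2 with
        | nil => rw [hxn] at h1; cases h1
        | snoc _ h => simp [Net.Adj, h3] at h
      have hsz : (freeNet N v₀).size L ≤ N.size L :=
        Nat.add_le_add_right (List.length_filter_le _ _) _
      have hsize : N.edges.length + N.verts.length ≤ N.size L := by
        have := Nat.le_mul_of_pos_right N.verts.length hL0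
        simp only [Net.size]
        omega
      obtain ⟨f, hfeq⟩ : ∃ f, (N.verts.filter (fun x => (v₀ x).isNone)).length = f + 1 :=
        ⟨_, (Nat.sub_add_cancel hfree).symm⟩
      rw [hfeq] at hf ⊢
      have hVpos := List.length_pos_iff.2 (List.ne_nil_of_mem hxV)
      rw [add_mul, one_mul]
      refine Triple.select_bind (B := f * (1225 * N.size L) + 1224 * N.size L) ?_ (by omega)
      change Triple (steepestPath fuel (freeNet N v₀) v₀ >>= fun P => fixPath v₀ P >>= fun v₁ =>
        compLexMin fuel (freeNet N v₀) v₁) _ _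
      refine Triple.bind_nat (triple_steepestPath hL0 fuel _ H hE hL ?_)
        (B := f * (1225 * N.size L) + 4 * N.size L) (fun P hP => ?_) (by omega)
      · change 2 * N.verts.length + 3 * L + 3 < fuel
        omega
      have hPl : P.steps.length ≤ 2 * N.verts.length := hP.1.length_le
      refine Triple.bind_nat (((spec_fixPath v₀ P).mono
        (fun u k h => ⟨h.2, h.1.le.trans hPl⟩)).triple)
        (B := f * (1225 * N.size L) + N.verts.length + 1) (fun u hu => ?_) (by omega)
      obtain ⟨hu1, hu2, hu3⟩ := hu
      -- No terminal is lost and the non-terminal on the path is gained, so the number of rounds is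
      -- bounded.
      have hlt : (N.verts.filter (fun x => (u x).isNone)).length ≤ f := by
        obtain ⟨q, hq, hqn⟩ := hP.1.free
        have hqV : q.1 ∈ N.verts := by
          obtain ⟨t, t', b', b, h1, h2, -⟩ := hP.1.walk q hq
          generalize q.2 = l at h2
          cases h2 with
          | nil => rw [hqn] at h1; cases h1
          | snoc _ h => exact (H.valid.adj h).2.1
        have hsub : N.verts.filter (fun x => (u x).isNone) =
            (N.verts.filter (fun x => (v₀ x).isNone)).filter (fun x => (u x).isNone) := by
          rw [List.filter_filter]
          refine List.filter_congr fun y _ => ?_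
          cases hy : u y with
          | some a => simp
          | none =>
            cases hy' : v₀ y with
            | none => simp
            | some a => rw [hu1 y a hy'] at hy; cases hy
        have : ((N.verts.filter (fun x => (v₀ x).isNone)).filter
            (fun x => (u x).isNone)).length <
            (N.verts.filter (fun x => (v₀ x).isNone)).length := by
          rw [List.length_filter_lt_length_iff_exists]
          exact ⟨q.1, List.mem_filter.2 ⟨hqV, by simp [hqn]⟩, by simpa using hu3 q hq⟩
        rw [hsub]
        omega
      refine ((ih (freeNet N v₀) u H.valid (fun y hy => ?_) hL ?_).mono ?_ le_rfl).le_nat ?_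
      · obtain ⟨t, a, l, h1, h2⟩ := H.reach y hy
        exact ⟨t, a, l, hu1 t a h1, h2⟩
      · change (N.verts.filter (fun x => (u x).isNone)).length + 2 * N.verts.length + 3 * L + 3 <
          fuel
        omega
      · rintro u' ⟨v, h1, h2⟩
        exact ⟨v, h1, good_of_fix hN hP (onPath_of_fix hP.1 hu2) hu1 h2⟩
      · have h1 := Nat.mul_le_mul hlt (Nat.mul_le_mul_left 1225 hsz)
        have h2 : (freeNet N v₀).verts = N.verts := rfl
        rw [h2]
        omega

end

open Prog

/-! ### The main theorem -/

/-! ### Translation between networks, graphs and sorted gradient lists -/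

section Encoding

variable {V : Type} {N : Net V} {G : SimpleGraph V} {len : Sym2 V → ℝ}

theorem Net.Encodes.adj_iff (h : N.Encodes G len) {x y : V} :
    (∃ c, N.Adj x y c) ↔ G.Adj x y := by
  rw [← SimpleGraph.mem_edgeSet, ← h.mem_edges, List.mem_map]
  constructor
  · rintro ⟨c, h1 | h1⟩
    · exact ⟨_, h1, rfl⟩
    · exact ⟨_, h1, Sym2.eq_swap⟩
  · rintro ⟨⟨a, b, c⟩, h1, h2⟩
    rcases Sym2.eq_iff.1 h2 with ⟨rfl, rfl⟩ | ⟨rfl, rfl⟩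
    · exact ⟨c, Or.inl h1⟩
    · exact ⟨c, Or.inr h1⟩

theorem Net.Encodes.length_of_adj (h : N.Encodes G len) {x y : V} {c : ℝ} (hxy : N.Adj x y c) :
    c = len s(x, y) := by
  rcases hxy with h1 | h1
  · exact h.length_eq _ h1
  · rw [Sym2.eq_swap]; exact h.length_eq _ h1

theorem Net.Encodes.valid (h : N.Encodes G len) (hlen : ∀ e ∈ G.edgeSet, 0 < len e) :
    N.Valid where
  nodup := h.verts_nodup
  edge e he := by
    refine ⟨h.mem_verts _, h.mem_verts _, ?_⟩
    rw [h.length_eq e he]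
    exact hlen _ ((h.mem_edges _).1 (List.mem_map.2 ⟨e, he, rfl⟩))

theorem Net.Encodes.reach (h : N.Encodes G len) {v₀ : V → Option ℝ} (hw : WellPosed G v₀) (x : V) :
    ∃ t a l, v₀ t = some a ∧ N.Walk t x l := by
  obtain ⟨t, ht, hs⟩ := hw (G.connectedComponentMk x)
  obtain ⟨a, ha⟩ := Option.isSome_iff_exists.1 hs
  obtain ⟨p⟩ : G.Reachable x t := (SimpleGraph.ConnectedComponent.eq.1 ht).symm
  have key : ∀ {x y : V}, G.Walk x y → ∃ l, N.Walk x y l := by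
    intro x y p
    induction p with
    | nil => exact ⟨0, Net.Walk.nil _⟩
    | cons hxy _ ih =>
      obtain ⟨l, hl⟩ := ih
      obtain ⟨c, hc⟩ := h.adj_iff.2 hxy
      exact ⟨_, (Net.Walk.single hc).trans hl⟩
  obtain ⟨l, hl⟩ := key p
  exact ⟨t, a, l, ha, hl.symm⟩

theorem Net.Encodes.length_verts [Fintype V] [DecidableEq V] (h : N.Encodes G len) :
    N.verts.length = Fintype.card V := by
  rw [← List.toFinset_card_of_nodup h.verts_nodup]
  congr 1
  ext x
  simpa using h.mem_verts x

theorem Net.Encodes.length_edges [Fintype V] [DecidableEq V] [DecidableRel G.Adj]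
    (h : N.Encodes G len) : N.edges.length = G.edgeFinset.card := by
  rw [← List.length_map (fun e : V × V × ℝ => s(e.1, e.2.1)),
    ← List.toFinset_card_of_nodup h.edges_nodup]
  congr 1
  ext e
  rw [List.mem_toFinset, h.mem_edges, SimpleGraph.mem_edgeFinset]

/-- Above the threshold `β` of `Good.best` the gradients of `v` coincide with those of `w`, and some
edge of `w` crosses `β` where `v` does not. -/
theorem Good.lex [Fintype V] [DecidableEq V] [DecidableRel G.Adj] (h : N.Encodes G len)
    (hlen : ∀ e ∈ G.edgeSet, 0 < len e) {v₀ : V → Option ℝ} {v w : V → ℝ} (hv : Good N v₀ v)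
    (hw : Extends w v₀) (hne : w ≠ v) :
    List.Lex (· < ·) (sortedGrad G len v) (sortedGrad G len w) := by
  rcases hv.best w hw with h1 | ⟨β, ⟨x, y, c, h1, h2, h3, h4⟩, h5⟩
  · exact absurd (funext fun x => h1 x (h.mem_verts x)) hne
  have habs : ∀ (u : V → ℝ) x y, absGrad len u s(x, y) = |u x - u y| / len s(x, y) :=
    fun _ _ _ => rfl
  have hle : ∀ {x y c}, N.Adj x y c → v x - v y ≤ β * c ∧ v y - v x ≤ β * c →
      absGrad len v s(x, y) ≤ β := by
    intro x y c h6 h7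
    have hc := h.length_of_adj h6
    have hpos := ((h.valid hlen).adj h6).2.2
    rw [habs, ← hc, div_le_iff₀ hpos, abs_le]
    constructor <;> linarith [h7.1, h7.2]
  refine lex_sort_map G.edgeFinset _ _ (β := β) ⟨s(x, y), ?_, hle h1 ⟨h3, h4⟩, ?_⟩ fun e he => ?_
  · rw [SimpleGraph.mem_edgeFinset, SimpleGraph.mem_edgeSet]
    exact h.adj_iff.1 ⟨c, h1⟩
  · rw [habs, ← h.length_of_adj h1, lt_div_iff₀ ((h.valid hlen).adj h1).2.2]
    exact h2.trans_le (le_abs_self _)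
  · induction e using Sym2.ind with
    | _ p q =>
      rw [SimpleGraph.mem_edgeFinset, SimpleGraph.mem_edgeSet] at he
      obtain ⟨c, hc⟩ := h.adj_iff.2 he
      rcases h5 p q c hc with h6 | ⟨h6, h7⟩
      · exact Or.inl (hle hc h6)
      · right; rw [habs, habs, h6, h7]

end Encoding

theorem lex_lt_asymm {s r : List ℝ} (h : List.Lex (· < ·) s r) (h' : List.Lex (· < ·) r s) :
    False :=
  lt_asymm (show s < r from h) (show r < s from h')

/-- For `n ≥ 2` the term `n + 1` is absorbed because `n * log n ≥ 1`; for `n ≤ 1` the natural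
logarithm vanishes or is multiplied by 0, and `hf0` removes the term in `f`. -/
theorem steps_le {n m : ℕ} {f : ℕ} (hf : f ≤ n) (hf0 : n ≤ 1 → f = 0) :
    ((f * (1225 * (m + n * (Nat.log 2 n + 1))) + n + 1 : ℕ) : ℝ) ≤
      4000 * (n * (m + n * Real.log n) + 1) := by
  have hlog0 : 0 ≤ Real.log n := Real.log_natCast_nonneg n
  have hnn : (0 : ℝ) ≤ n := Nat.cast_nonneg n
  have hmm : (0 : ℝ) ≤ m := Nat.cast_nonneg m
  have hrhs : (0 : ℝ) ≤ n * (m + n * Real.log n) := by positivity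
  rcases Nat.lt_or_ge 1 n with hn | hn
  · have h2 : (0.6931471803 : ℝ) < Real.log 2 := Real.log_two_gt_d9
    have h3 : (Nat.log 2 n : ℝ) * Real.log 2 ≤ Real.log n := by
      rw [← Real.log_pow]
      refine Real.log_le_log (by positivity) ?_
      exact_mod_cast Nat.pow_log_le_self 2 (by omega)
    have h4 : Real.log 2 ≤ Real.log n :=
      Real.log_le_log (by norm_num) (by exact_mod_cast hn)
    -- Both summands are at most `log n / log 2`, and `2 / log 2 < 3`.
    have h5 : (Nat.log 2 n : ℝ) + 1 ≤ 3 * Real.log n := by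
      have : (0 : ℝ) ≤ Nat.log 2 n := Nat.cast_nonneg _
      nlinarith
    have h6 : (f : ℝ) ≤ n := by exact_mod_cast hf
    have h7 : (2 : ℝ) ≤ n := by exact_mod_cast hn
    have h8 : (n : ℝ) ≤ n * (m + n * Real.log n) := by
      have : (1 : ℝ) ≤ n * Real.log n := by nlinarith
      nlinarith
    push_cast
    calc (f : ℝ) * (1225 * (m + n * (Nat.log 2 n + 1))) + n + 1
        ≤ n * (1225 * (m + n * (3 * Real.log n))) + n + 1 := by gcongr
      _ ≤ 3675 * (n * (m + n * Real.log n)) + n + 1 := by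
        have : (0 : ℝ) ≤ n * m := by positivity
        nlinarith
      _ ≤ _ := by linarith
  · rw [hf0 hn]
    have : (n : ℝ) ≤ 1 := by exact_mod_cast hn
    push_cast
    linarith

theorem triple_compLexMin_of_encodes {n : ℕ} {G : SimpleGraph (Fin n)} [DecidableRel G.Adj]
    {len : Sym2 (Fin n) → ℝ} {v₀ : Fin n → Option ℝ} {N : Net (Fin n)}
    (hlen : ∀ e ∈ G.edgeSet, 0 < len e) (hw : WellPosed G v₀) (h : N.Encodes G len) {fuel : ℕ}
    (hfuel : 3 * n + 3 * (Nat.log 2 n + 1) + 3 < fuel) :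
    Triple (compLexMin fuel N v₀) (fun u => ∃ v, u = (fun x => some (v x)) ∧ Good N v₀ v)
      (ENNReal.ofReal (4000 * (n * (G.edgeFinset.card + n * Real.log n) + 1))) := by
  have hV : N.verts.length = n := by simpa using h.length_verts
  have hfr : (N.verts.filter (fun x => (v₀ x).isNone)).length ≤ n :=
    (List.length_filter_le _ _).trans hV.le
  refine (triple_compLexMin (L := Nat.log 2 n + 1) (Nat.succ_pos _) fuel N v₀ (h.valid hlen)
    (fun x _ => h.reach hw x) ?_ (by omega)).mono ?_ ?_
  · rw [hV]; exact Nat.lt_pow_succ_log_self (by norm_num) n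
  · rintro u ⟨v, h1, h2⟩
    exact ⟨v, funext fun x => h1 x (h.mem_verts x), h2⟩
  · rw [← ENNReal.ofReal_natCast]
    refine ENNReal.ofReal_le_ofReal ?_
    rw [Net.size, hV, h.length_edges]
    refine steps_le hfr fun hn => ?_
    -- With at most one vertex, well-posedness makes every vertex a terminal, so no round is made.
    rw [List.length_eq_zero_iff, List.filter_eq_nil_iff]
    intro x _
    obtain ⟨t, a, -, h1, -⟩ := h.reach hw x
    have : Subsingleton (Fin n) := Fin.subsingleton_iff_le_one.2 hn
    rw [Subsingleton.elim x t, h1]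
    simp

theorem mainTheorem4 :
    ∃ C : ℝ, 0 < C ∧
      ∀ (n : ℕ) (G : SimpleGraph (Fin n)) [DecidableRel G.Adj] (len : Sym2 (Fin n) → ℝ)
        (v₀ : Fin n → Option ℝ) (N : Net (Fin n)),
        (∀ e ∈ G.edgeSet, 0 < len e) → WellPosed G v₀ → N.Encodes G len →
        ∃ v : Fin n → ℝ,
          IsLexMinimizer G len v₀ v ∧
          (∀ w : Fin n → ℝ, IsLexMinimizer G len v₀ w → w = v) ∧
          ∀ᶠ fuel : ℕ in atTop,
            (∀ o ∈ (compLexMin fuel N v₀).run.support, o.1 = some (fun x => some (v x))) ∧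
            (compLexMin fuel N v₀).expectedTime ≤
              ENNReal.ofReal (C * (n * (G.edgeFinset.card + n * Real.log n) + 1)) := by
  refine ⟨4000, by norm_num, fun n G _ len v₀ N hlen hw h => ?_⟩
  have main := fun fuel hfuel => triple_compLexMin_of_encodes hlen hw h (fuel := fuel) hfuel
  -- Existence is read off from an arbitrary outcome of a run with enough fuel, so no compactness
  -- argument is needed.
  obtain ⟨v, hv⟩ : ∃ v, Good N v₀ v := by
    obtain ⟨o, ho⟩ := (compLexMin (3 * n + 3 * (Nat.log 2 n + 1) + 4) N v₀).run.support_nonempty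
    obtain ⟨-, -, v, -, hv⟩ := (main _ (by omega)).support ENNReal.ofReal_ne_top o ho
    exact ⟨v, hv⟩
  have hlex := fun w => hv.lex h hlen (w := w)
  have huniq : ∀ w, Good N v₀ w → w = v := by
    intro w hw
    by_contra hne
    exact lex_lt_asymm (hlex w hw.ext hne) (hw.lex h hlen hv.ext (Ne.symm hne))
  refine ⟨v, ⟨hv.ext, fun w hw => ?_⟩, fun w hw => ?_, ?_⟩
  · by_cases hne : w = v
    · exact Or.inl (by rw [hne])
    · exact Or.inr (hlex w hw hne)
  · by_contra hne
    have h1 := hlex w hw.1 hne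
    rcases hw.2 v hv.ext with h2 | h2
    · rw [h2] at h1
      exact lex_lt_asymm h1 h1
    · exact lex_lt_asymm h1 h2
  · filter_upwards [eventually_gt_atTop (3 * n + 3 * (Nat.log 2 n + 1) + 3)] with fuel hfuel
    refine ⟨fun o ho => ?_, (main fuel hfuel).expectedTime_le⟩
    obtain ⟨u, h1, w, rfl, hw⟩ := (main fuel hfuel).support ENNReal.ofReal_ne_top o ho
    rw [h1, huniq w hw]
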